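/- Let $\{v_{j,k}:\ j<k,\ j,k\in\mathbb Z\}$ be i.i.d. random variables with values in $[-\infty,\infty)$, distributed as $v$; $v_{j,k}$ is the weight of the directed edge $(j,k)$. A path from $j$ to $k$ is a sequence $j=j_0<j_1<\dots<j_m=k$, $m\ge 1$, and its weight is $\sum_{s=1}^m v_{j_{s-1},j_s}$. For $j<k$ let $w_{j,k}$ be the maximal weight of all paths from $j$ to $k$, and $w^+_{j,k}$ the maximal weight of those paths from $j$ to $k$ all of whose edges have positive weight ($-\infty$ if there are none). Let $v^+$ have the conditional distribution of $v$ given $v>0$, and assume $$\mathbf P(v>0)>0,\qquad \mathbf P(v^+=c)<1\ \text{ for every } c>0,\qquad \mathbf E e^{Cv^+}<\infty\ \text{ for some } C>0.$$ A vertex $x$ is *skeleton-plus* if it is joined to every other vertex (from every $j<x$, and to every $k>x$) by a path all of whose edges have positive weight; let $0\le t_0^+<t_1^+$ be the first two non-negative skeleton-plus vertices. Put $\operatorname{ess\,inf} v^+=\inf\{t>0:\mathbf P(v^+<t)>0\}$, $\gamma^+=1/\mathbf E(t_1^+-t_0^+)$ and $$V=\mathbf E\min\{v_{i,j}:\ t_0^+\le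 i<j\le t_1^+,\ v_{i,j}>0\}.$$ For $a,b>0$ let $\mathcal R(a,b)$ be the random set of vertices $x$ such that $w_{x-j,x}\ge aj$ and $w_{x,x+i}\ge ai$ and $v_{x-j,x+i}<b(j+i)$ for all $i,j\ge1$, and let $\mathcal R^+(a,b)$ be defined in the same way with $w^+$ in place of $w$. Let $c_1,c_2$ satisfy $$\gamma^+\operatorname{ess\,inf}v^+<c_2\le c_1<\gamma^+V .$$ Then, almost surely, the set $\mathcal R^+=\mathcal R^+(c_1,c_2)$ of renewal-plus vertices is unbounded in both directions, so that it can be enumerated as $\dots<\Gamma^+_{-1}<0\le\Gamma_0^+<\Gamma_1^+<\dots$, and there is a constant $C>0$ such that $$\mathbf E e^{C\Gamma_0^+}<\infty,\qquad \mathbf E e^{C(\Gamma_1^+-\Gamma_0^+)}<\infty .$$ The same holds (with $C>0$ chosen small enough for all these sets at once) for the vertices $\Gamma_0,\Gamma_1$ of the set $\mathcal R$ of renewal vertices, enumerated in the same way, both for $\mathcal R=\mathcal R(c_1,c_2)$ and for $\mathcal R=\mathcal R(c_2,c_1)$. -/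

import Mathlib

open MeasureTheory ProbabilityTheory

namespace DirectedGraph

/-- Directed edges `(j, k)` with `j < k` between vertices in `ℤ`. -/
abbrev Edge : Type := {e : ℤ × ℤ // e.1 < e.2}

/-- Paths `j = j₀ < j₁ < ... < jₘ = k` with `m ≥ 1` edges. -/
inductive GPath : ℤ → ℤ → Type
  | edge {j k : ℤ} (h : j < k) : GPath j k
  | cons {j l k : ℤ} (h : j < l) (p : GPath l k) : GPath j k

/-- The weight of a path: the sum of the weights of its edges. -/
noncomputable def GPath.weight (u : ℤ → ℤ → EReal) : {j k : ℤ} → GPath j k → EReal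
  | j, k, .edge _ => u j k
  | j, _, .cons (l := l) _ p => u j l + p.weight u

/-- All edges of the path have positive weight. -/
def GPath.Positive (u : ℤ → ℤ → EReal) : {j k : ℤ} → GPath j k → Prop
  | j, k, .edge _ => 0 < u j k
  | j, _, .cons (l := l) _ p => 0 < u j l ∧ p.Positive u

/-- `w_{j,k}`: the maximal weight of all paths from `j` to `k`; `w_{j,j} = 0`. -/
noncomputable def maxWeight (u : ℤ → ℤ → EReal) (j k : ℤ) : EReal :=
  if j = k then 0 else ⨆ π : GPath j k, π.weight u

/-- `w⁺_{j,k}`: the maximal weight of all paths from `j` to `k` whose edges all have positive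
weight (`-∞` if there are none). -/
noncomputable def maxWeightPlus (u : ℤ → ℤ → EReal) (j k : ℤ) : EReal :=
  if j = k then 0 else ⨆ (π : GPath j k) (_ : π.Positive u), π.weight u

/-- Skeleton-plus vertices: those joined to every other vertex by a path with edges of positive
weight. -/
def skeletonPlus (u : ℤ → ℤ → EReal) : Set ℤ :=
  {x | (∀ j < x, ∃ π : GPath j x, π.Positive u) ∧ (∀ k > x, ∃ π : GPath x k, π.Positive u)}

/-- `⋂_{i ≥ 1} {w_{x,x+i} ≥ c i}`. -/
def RightGrowth (u : ℤ → ℤ → EReal) (c : ℝ) (x : ℤ) : Prop :=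
  ∀ i : ℕ, 1 ≤ i → ((c * i : ℝ) : EReal) ≤ maxWeight u x (x + i)

/-- `⋂_{j ≥ 1} {w_{x-j,x} ≥ c j}`. -/
def LeftGrowth (u : ℤ → ℤ → EReal) (c : ℝ) (x : ℤ) : Prop :=
  ∀ j : ℕ, 1 ≤ j → ((c * j : ℝ) : EReal) ≤ maxWeight u (x - j) x

/-- `⋂_{i,j ≥ 1} {v_{x-j,x+i} < c (j + i)}`. -/
def CrossingBound (u : ℤ → ℤ → EReal) (c : ℝ) (x : ℤ) : Prop :=
  ∀ j i : ℕ, 1 ≤ j → 1 ≤ i → u (x - j) (x + i) < ((c * (j + i) : ℝ) : EReal)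

/-- `⋂_{i ≥ 1} {w⁺_{x,x+i} ≥ c i}`. -/
def RightGrowthPlus (u : ℤ → ℤ → EReal) (c : ℝ) (x : ℤ) : Prop :=
  ∀ i : ℕ, 1 ≤ i → ((c * i : ℝ) : EReal) ≤ maxWeightPlus u x (x + i)

/-- `⋂_{j ≥ 1} {w⁺_{x-j,x} ≥ c j}`. -/
def LeftGrowthPlus (u : ℤ → ℤ → EReal) (c : ℝ) (x : ℤ) : Prop :=
  ∀ j : ℕ, 1 ≤ j → ((c * j : ℝ) : EReal) ≤ maxWeightPlus u (x - j) x

/-- Renewal vertices with growth constant `a` and crossing constant `b`. -/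
def renewal (u : ℤ → ℤ → EReal) (a b : ℝ) : Set ℤ :=
  {x | LeftGrowth u a x ∧ CrossingBound u b x ∧ RightGrowth u a x}

/-- Renewal-plus vertices with growth constant `a` and crossing constant `b`. -/
def renewalPlus (u : ℤ → ℤ → EReal) (a b : ℝ) : Set ℤ :=
  {x | LeftGrowthPlus u a x ∧ CrossingBound u b x ∧ RightGrowthPlus u a x}

/-- The set of vertices is unbounded in both directions, so that it can be enumerated as
`... < A₋₁ < 0 ≤ A₀ < A₁ < ...`. -/
def BiInfinite (A : Set ℤ) : Prop := ¬ BddAbove A ∧ ¬ BddBelow A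

/-- `A₀`: the smallest non-negative element of `A`. -/
noncomputable def point0 (A : Set ℤ) : ℤ := sInf {x | x ∈ A ∧ 0 ≤ x}

/-- `A₁`: the smallest element of `A` above `A₀`. -/
noncomputable def point1 (A : Set ℤ) : ℤ := sInf {x | x ∈ A ∧ point0 A < x}

/-- The law of `v⁺`: the conditional law of `v` given `v > 0`, where `ν` is the law of `v`. -/
noncomputable def posLaw (ν : Measure EReal) : Measure ℝ :=
  (ProbabilityTheory.cond ν (Set.Ioi 0)).map EReal.toReal

/-- `ess inf v⁺ = inf {t > 0 : P(v⁺ < t) > 0}`. -/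
noncomputable def essInfPlus (ν : Measure EReal) : ℝ :=
  sInf {t : ℝ | 0 < t ∧ 0 < posLaw ν (Set.Iio t)}

/-- The standing conditions on the law `ν` of the weights: `P(v > 0) > 0`, `v⁺` is not
deterministic and has a finite exponential moment. -/
structure MainCondition (ν : Measure EReal) : Prop where
  pos : 0 < ν (Set.Ioi 0)
  nondegenerate : ∀ c : ℝ, 0 < c → posLaw ν {c} < 1
  expMoment : ∃ C : ℝ, 0 < C ∧ Integrable (fun x : ℝ => Real.exp (C * x)) (posLaw ν)

section Random

variable {Ω : Type*} [MeasurableSpace Ω]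

/-- The weights `v_{j,k}`, `j < k`, are independent random variables with values in `[-∞, ∞)` and
common law `ν`. The values `v j k` for `j ≥ k` play no role. -/
structure IsIIDWeights (P : Measure Ω) (ν : Measure EReal) (v : ℤ → ℤ → Ω → EReal) : Prop where
  measurable : ∀ j k : ℤ, j < k → Measurable (v j k)
  ne_top : ∀ j k : ℤ, j < k → ∀ ω, v j k ω ≠ ⊤
  law : ∀ j k : ℤ, j < k → P.map (v j k) = ν
  indep : iIndepFun (fun e : Edge => v e.1.1 e.1.2) P

/-- The configuration of weights at the sample point `ω`. -/
def config (v : ℤ → ℤ → Ω → EReal) (ω : Ω) : ℤ → ℤ → EReal := fun j k => v j k ω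

/-- `γ⁺ = 1 / E(t₁⁺ - t₀⁺)`, where `t₀⁺ < t₁⁺` are the first two non-negative skeleton-plus
vertices. -/
noncomputable def gammaPlus (P : Measure Ω) (v : ℤ → ℤ → Ω → EReal) : ℝ :=
  (∫ ω, ((point1 (skeletonPlus (config v ω)) - point0 (skeletonPlus (config v ω)) : ℤ) : ℝ) ∂P)⁻¹

/-- The minimum of the positive weights of edges `(i, j)` with `a ≤ i < j ≤ b`. -/
noncomputable def minPosWeight (u : ℤ → ℤ → EReal) (a b : ℤ) : ℝ :=
  sInf {r : ℝ | 0 < r ∧ ∃ i j : ℤ, a ≤ i ∧ i < j ∧ j ≤ b ∧ u i j = (r : EReal)}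

/-- `V`: the mean of the smallest positive edge weight between `t₀⁺` and `t₁⁺`. -/
noncomputable def meanMin (P : Measure Ω) (v : ℤ → ℤ → Ω → EReal) : ℝ :=
  ∫ ω, minPosWeight (config v ω) (point0 (skeletonPlus (config v ω)))
    (point1 (skeletonPlus (config v ω))) ∂P

/-- `E exp(C A₀)` and `E exp(C (A₁ - A₀))` are finite for the random set of vertices `A`. -/
def ExpMoments (P : Measure Ω) (A : Ω → Set ℤ) (C : ℝ) : Prop :=
  Integrable (fun ω => Real.exp (C * (point0 (A ω) : ℝ))) P ∧
  Integrable (fun ω => Real.exp (C * ((point1 (A ω) : ℝ) - (point0 (A ω) : ℝ)))) P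

end Random

end DirectedGraph

open DirectedGraph

namespace DirectedGraph

/-! Since `w⁺ ≤ w` and `c₂ ≤ c₁`, the renewal-plus set for `(c₁, c₂)` lies in both renewal sets. If
`A ⊆ B` are unbounded in both directions, then `0 ≤ point0 B < point1 B ≤ point1 A`. One exponential
moment of `point1` of the renewal-plus set therefore settles all claims, and it is enough that long
stretches without renewal-plus vertices have exponentially small probability.

Being a renewal-plus vertex is an intersection over scales `m` of events that depend only on the
edges within distance `m`. `expSmall_of_local` yields exponential gap tails for any such
intersection, provided that the failure probability at scale `m` is exponentially small and the
whole intersection has positive probability. If all vertices of a stretch fail, the intervals on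
which the failures depend cover it. A greedy chain of these intervals splits into two families of
disjoint, hence independent, failures, and Cauchy-Schwarz together with a union bound over the
chains concludes. The same principle applies to skeleton-plus vertices.

The crossing bound fails at scale `m` with exponentially small probability by the exponential moment
of `v⁺`. For the growth of `w⁺` the skeleton is used. The events that describe the first cycle
`[t₀⁺, t₁⁺]` factorise over disjoint sets of edges. With `τ` its length and `M` its smallest
positive weight, `c < γ⁺V` says `E (cτ - M) < 0`, so `E exp (θ (cτ - M)) ≤ 1` for some `θ > 0`. As
`w⁺` is superadditive and at least `M` on each cycle, a renewal inequality gives `E exp (-θ w⁺) ≤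
exp (-θ c n)` on spanning intervals of length `n`. Markov's inequality and the abundance of
skeleton-plus vertices near both ends then give `expSmall_maxWeightPlus_lt`.

For positivity, the conditions to the left of a vertex, across it and to its right use disjoint
edges. Growth holds from some distance on with positive probability, and a finite run of heavy edges
placed in front repairs the beginning. The crossing bound splits into independent events, each of
positive probability because `γ⁺ ess inf v⁺ < c₂` forces `P(v < c₂) > 0`. -/

/-- Configurations of edge weights. Only the weights `u j k` with `j < k` matter. -/
abbrev Conf : Type := ℤ → ℤ → EReal

/-! ### Paths with positive edges and superadditivity of `w⁺` -/

/-- Some path from `j` to `k` with edges of positive weight has weight `r`. -/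
def PathWeight (u : Conf) (j k : ℤ) (r : EReal) : Prop :=
  ∃ π : GPath j k, π.Positive u ∧ π.weight u = r

theorem GPath.lt {j k : ℤ} (π : GPath j k) : j < k := by
  induction π with
  | edge h => exact h
  | cons h p ih => exact h.trans ih

theorem PathWeight.lt {u : Conf} {j k : ℤ} {r : EReal} (h : PathWeight u j k r) : j < k :=
  h.choose.lt

theorem PathWeight.edge {u : Conf} {j k : ℤ} (h : j < k) (hu : 0 < u j k) :
    PathWeight u j k (u j k) :=
  ⟨.edge h, by simpa [GPath.Positive] using hu, by simp [GPath.weight]⟩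

theorem PathWeight.cons {u : Conf} {j l k : ℤ} {r : EReal} (h : j < l) (hu : 0 < u j l)
    (hr : PathWeight u l k r) : PathWeight u j k (u j l + r) := by
  obtain ⟨π, hπ, rfl⟩ := hr
  exact ⟨.cons h π, by simpa [GPath.Positive] using ⟨hu, hπ⟩, by simp [GPath.weight]⟩

theorem PathWeight.induction {u : Conf} {C : ℤ → ℤ → EReal → Prop}
    (edge : ∀ j k, j < k → 0 < u j k → C j k (u j k))
    (cons : ∀ j l k r, j < l → 0 < u j l → PathWeight u l k r → C l k r → C j k (u j l + r))
    {j k : ℤ} {r : EReal} (h : PathWeight u j k r) : C j k r := by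
  obtain ⟨π, hπ, rfl⟩ := h
  induction π with
  | edge h => exact edge _ _ h (by simpa [GPath.Positive] using hπ)
  | cons h p ih =>
    simp only [GPath.Positive] at hπ
    simp only [GPath.weight]
    exact cons _ _ _ _ h hπ.1 ⟨p, hπ.2, rfl⟩ (ih hπ.2)

theorem PathWeight.pos {u : Conf} {j k : ℤ} {r : EReal} (h : PathWeight u j k r) : 0 < r := by
  refine PathWeight.induction (C := fun _ _ r => 0 < r) (fun _ _ _ h => h) ?_ h
  intro j l k r _ hu _ ih
  exact EReal.add_pos hu ih

theorem PathWeight.trans {u : Conf} {j l k : ℤ} {r s : EReal} (h : PathWeight u j l r)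
    (h' : PathWeight u l k s) : PathWeight u j k (r + s) := by
  refine PathWeight.induction (C := fun j l r => PathWeight u l k s → PathWeight u j k (r + s))
    ?_ ?_ h h'
  · intro j k hjk hu h'
    exact h'.cons hjk hu
  · intro j l k r hjl hu _ ih h'
    rw [add_assoc]
    exact (ih h').cons hjl hu

/-- There is a path from `j` to `k` with edges of positive weight. -/
def Joined (u : Conf) (j k : ℤ) : Prop := ∃ r, PathWeight u j k r

theorem joined_iff {u : Conf} {j k : ℤ} : Joined u j k ↔ ∃ π : GPath j k, π.Positive u :=
  ⟨fun ⟨_, π, h, _⟩ => ⟨π, h⟩, fun ⟨π, h⟩ => ⟨_, π, h, rfl⟩⟩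

theorem Joined.trans {u : Conf} {j l k : ℤ} (h : Joined u j l) (h' : Joined u l k) :
    Joined u j k := by
  obtain ⟨r, h⟩ := h
  obtain ⟨s, h'⟩ := h'
  exact ⟨_, h.trans h'⟩

theorem Joined.edge {u : Conf} {j k : ℤ} (h : j < k) (hu : 0 < u j k) : Joined u j k :=
  ⟨_, PathWeight.edge h hu⟩

theorem maxWeightPlus_self (u : Conf) (j : ℤ) : maxWeightPlus u j j = 0 := by
  simp [maxWeightPlus]

theorem PathWeight.le {u : Conf} {j k : ℤ} {r : EReal} (h : PathWeight u j k r) :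
    r ≤ maxWeightPlus u j k := by
  have hjk := h.lt
  obtain ⟨π, hπ, rfl⟩ := h
  rw [maxWeightPlus, if_neg hjk.ne]
  exact le_iSup₂_of_le π hπ le_rfl

/-- With `w⁺` expressed through the relation `PathWeight`, invariance under shift and reflection
needs no bijection between dependent types of paths. -/
theorem maxWeightPlus_eq_sSup (u : Conf) {j k : ℤ} (h : j < k) :
    maxWeightPlus u j k = sSup {r | PathWeight u j k r} := by
  apply le_antisymm
  · rw [maxWeightPlus, if_neg h.ne]
    exact iSup₂_le fun π hπ => le_sSup ⟨π, hπ, rfl⟩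
  · exact sSup_le fun r hr => hr.le

theorem maxWeightPlus_le_maxWeight (u : Conf) (j k : ℤ) :
    maxWeightPlus u j k ≤ maxWeight u j k := by
  rw [maxWeightPlus, maxWeight]
  split_ifs
  · exact le_rfl
  · exact iSup₂_le fun π _ => le_iSup (fun π : GPath j k => π.weight u) π

theorem Joined.maxWeightPlus_nonneg {u : Conf} {j k : ℤ} (h : Joined u j k) :
    0 ≤ maxWeightPlus u j k := by
  obtain ⟨r, h⟩ := h
  exact h.pos.le.trans h.le

/-- Concatenation of positive paths. The case of equal vertices relies on the convention `w⁺_{j,j} =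
0`. -/
theorem maxWeightPlus_add_le (u : Conf) {j l k : ℤ} (h : j ≤ l) (h' : l ≤ k) :
    maxWeightPlus u j l + maxWeightPlus u l k ≤ maxWeightPlus u j k := by
  rcases h.eq_or_lt with rfl | h
  · rw [maxWeightPlus_self, zero_add]
  rcases h'.eq_or_lt with rfl | h'
  · rw [maxWeightPlus_self, add_zero]
  rw [maxWeightPlus_eq_sSup u h, maxWeightPlus_eq_sSup u h']
  refine EReal.add_le_of_forall_lt fun a ha b hb => ?_
  obtain ⟨r, hr, har⟩ := lt_sSup_iff.1 ha
  obtain ⟨s, hs, hbs⟩ := lt_sSup_iff.1 hb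
  exact (add_le_add har.le hbs.le).trans (hr.trans hs).le

/-! ### Local description of skeleton-plus vertices -/

/-- Every vertex of `(a, b]` has an incoming positive edge from a vertex of `[a, b]`. -/
def SourceOn (u : Conf) (a b : ℤ) : Prop := ∀ k, a < k → k ≤ b → ∃ j, a ≤ j ∧ j < k ∧ 0 < u j k

/-- Every vertex of `[a, b)` has an outgoing positive edge to a vertex of `[a, b]`. -/
def SinkOn (u : Conf) (a b : ℤ) : Prop := ∀ j, a ≤ j → j < b → ∃ k, j < k ∧ k ≤ b ∧ 0 < u j k

/-- Every vertex above `a` has an incoming positive edge from a vertex of `[a, ∞)`. -/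
def Source (u : Conf) (a : ℤ) : Prop := ∀ k, a < k → ∃ j, a ≤ j ∧ j < k ∧ 0 < u j k

/-- Every vertex below `b` has an outgoing positive edge to a vertex of `(-∞, b]`. -/
def Sink (u : Conf) (b : ℤ) : Prop := ∀ j, j < b → ∃ k, j < k ∧ k ≤ b ∧ 0 < u j k

theorem SourceOn.joined {u : Conf} {a b : ℤ} (h : SourceOn u a b) {k : ℤ} (hk : a < k)
    (hkb : k ≤ b) : Joined u a k := by
  obtain ⟨n, hn⟩ : ∃ n : ℕ, k - a = n := ⟨(k - a).toNat, by omega⟩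
  induction n using Nat.strong_induction_on generalizing k with
  | _ n ih =>
    obtain ⟨j, haj, hjk, hu⟩ := h k hk hkb
    rcases haj.eq_or_lt with rfl | haj
    · exact .edge hjk hu
    · exact (ih (j - a).toNat (by omega) haj (by omega) (by omega)).trans (.edge hjk hu)

theorem SinkOn.joined {u : Conf} {a b : ℤ} (h : SinkOn u a b) {j : ℤ} (hj : j < b)
    (haj : a ≤ j) : Joined u j b := by
  obtain ⟨n, hn⟩ : ∃ n : ℕ, b - j = n := ⟨(b - j).toNat, by omega⟩
  induction n using Nat.strong_induction_on generalizing j with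
  | _ n ih =>
    obtain ⟨k, hjk, hkb, hu⟩ := h j haj hj
    rcases hkb.eq_or_lt with rfl | hkb
    · exact .edge hjk hu
    · exact (Joined.edge hjk hu).trans (ih (b - k).toNat (by omega) hkb (by omega) (by omega))

theorem Joined.exists_last {u : Conf} {j k : ℤ} (h : Joined u j k) :
    ∃ l, j ≤ l ∧ l < k ∧ 0 < u l k := by
  obtain ⟨r, h⟩ := h
  refine PathWeight.induction (C := fun j k _ => ∃ l, j ≤ l ∧ l < k ∧ 0 < u l k) ?_ ?_ h
  · exact fun j k h hu => ⟨j, le_rfl, h, hu⟩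
  · rintro j l k r hjl hu _ ⟨m, hlm, hmk, hm⟩
    exact ⟨m, hjl.le.trans hlm, hmk, hm⟩

theorem Joined.exists_first {u : Conf} {j k : ℤ} (h : Joined u j k) :
    ∃ l, j < l ∧ l ≤ k ∧ 0 < u j l := by
  obtain ⟨r, h⟩ := h
  refine PathWeight.induction (C := fun j k _ => ∃ l, j < l ∧ l ≤ k ∧ 0 < u j l) ?_ ?_ h
  · exact fun j k h hu => ⟨k, h, le_rfl, hu⟩
  · rintro j l k r hjl hu hr _
    exact ⟨l, hjl, hr.lt.le, hu⟩

theorem Source.sourceOn {u : Conf} {a : ℤ} (h : Source u a) (b : ℤ) : SourceOn u a b :=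
  fun k hk _ => h k hk

theorem Sink.sinkOn {u : Conf} {b : ℤ} (h : Sink u b) (a : ℤ) : SinkOn u a b :=
  fun j _ hj => h j hj

/-- Following one incoming edge after another from `k` down to `x` must end at `x`, so single edges
suffice in place of paths. The two conditions depend on the edges on different sides of `x`, which
is the source of all later factorisations. -/
theorem mem_skeletonPlus_iff {u : Conf} {x : ℤ} : x ∈ skeletonPlus u ↔ Sink u x ∧ Source u x := by
  simp only [skeletonPlus, Set.mem_ofPred_eq, ← joined_iff]
  constructor
  · rintro ⟨h1, h2⟩
    exact ⟨fun j hj => (h1 j hj).exists_first, fun k hk => (h2 k hk).exists_last⟩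
  · rintro ⟨h1, h2⟩
    exact ⟨fun j hj => (h1.sinkOn j).joined hj le_rfl,
      fun k hk => (h2.sourceOn k).joined hk le_rfl⟩

/-- The smallest positive weight of an edge in `[a, b]` bounds `w⁺` from below. -/
theorem minPosWeight_le_maxWeightPlus {u : Conf} (hu : ∀ j k, j < k → u j k ≠ ⊤) {a b : ℤ}
    (h : Joined u a b) : (minPosWeight u a b : EReal) ≤ maxWeightPlus u a b := by
  obtain ⟨r, h⟩ := h
  refine le_trans ?_ h.le
  refine PathWeight.induction (C := fun j k r => a ≤ j → k ≤ b → (minPosWeight u a b : EReal) ≤ r)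
    ?_ ?_ h le_rfl le_rfl
  · intro j k hjk hpos haj hkb
    have hr : u j k = ((u j k).toReal : EReal) :=
      (EReal.coe_toReal (hu j k hjk) (ne_bot_of_gt hpos)).symm
    rw [hr]
    refine EReal.coe_le_coe_iff.2 (csInf_le ⟨0, fun _ h => h.1.le⟩ ⟨?_, j, k, haj, hjk, hkb, hr⟩)
    rw [hr] at hpos
    exact_mod_cast hpos
  -- The last edge of the path already weighs enough, and earlier edges only add positive amounts.
  · intro j l k r hjl hpos hlk ih haj hkb
    refine (ih (haj.trans hjl.le) hkb).trans ?_
    exact le_add_of_nonneg_left hpos.le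

theorem minPosWeight_nonneg (u : Conf) (a b : ℤ) : 0 ≤ minPosWeight u a b :=
  Real.sInf_nonneg fun _ h => h.1.le

/-! ### Shift and reflection of configurations -/

/-- The configuration seen from the vertex `x`. -/
def shift (x : ℤ) (u : Conf) : Conf := fun j k => u (x + j) (x + k)

/-- The configuration seen in the reversed time direction. -/
def reflect (u : Conf) : Conf := fun j k => u (-k) (-j)

theorem shift_shift (x y : ℤ) (u : Conf) : shift x (shift y u) = shift (y + x) u := by
  funext j k
  simp [shift, add_assoc]

theorem shift_zero (u : Conf) : shift 0 u = u := by
  funext j k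
  simp [shift]

theorem reflect_reflect (u : Conf) : reflect (reflect u) = u := by
  funext j k
  simp [reflect]

theorem PathWeight.of_shift {x : ℤ} {u : Conf} {j k : ℤ} {r : EReal}
    (h : PathWeight (shift x u) j k r) : PathWeight u (x + j) (x + k) r := by
  refine PathWeight.induction (C := fun j k r => PathWeight u (x + j) (x + k) r) ?_ ?_ h
  · exact fun j k hjk hu => .edge (by omega) hu
  · exact fun j l k r hjl hu _ ih => ih.cons (by omega) hu

theorem pathWeight_shift {x : ℤ} {u : Conf} {j k : ℤ} {r : EReal} :
    PathWeight (shift x u) j k r ↔ PathWeight u (x + j) (x + k) r := by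
  refine ⟨.of_shift, fun h => ?_⟩
  have h' : PathWeight (shift (-x) (shift x u)) (x + j) (x + k) r := by
    rwa [shift_shift, add_neg_cancel, shift_zero]
  simpa using h'.of_shift

theorem PathWeight.of_reflect {u : Conf} {j k : ℤ} {r : EReal}
    (h : PathWeight (reflect u) j k r) : PathWeight u (-k) (-j) r := by
  refine PathWeight.induction (C := fun j k r => PathWeight u (-k) (-j) r) ?_ ?_ h
  · exact fun j k hjk hu => .edge (by omega) hu
  · intro j l k r hjl hu _ ih
    rw [add_comm]
    exact ih.trans (.edge (by omega) hu)

theorem pathWeight_reflect {u : Conf} {j k : ℤ} {r : EReal} :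
    PathWeight (reflect u) j k r ↔ PathWeight u (-k) (-j) r := by
  refine ⟨.of_reflect, fun h => ?_⟩
  have h' : PathWeight (reflect (reflect u)) (-k) (-j) r := by rwa [reflect_reflect]
  simpa using h'.of_reflect

theorem maxWeightPlus_shift (x : ℤ) (u : Conf) {j k : ℤ} (h : j < k) :
    maxWeightPlus (shift x u) j k = maxWeightPlus u (x + j) (x + k) := by
  rw [maxWeightPlus_eq_sSup _ h, maxWeightPlus_eq_sSup _ (by omega)]
  simp only [pathWeight_shift]

theorem maxWeightPlus_reflect (u : Conf) {j k : ℤ} (h : j < k) :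
    maxWeightPlus (reflect u) j k = maxWeightPlus u (-k) (-j) := by
  rw [maxWeightPlus_eq_sSup _ h, maxWeightPlus_eq_sSup _ (by omega)]
  simp only [pathWeight_reflect]

theorem leftGrowthPlus_iff_reflect (u : Conf) (c : ℝ) :
    LeftGrowthPlus u c 0 ↔ RightGrowthPlus (reflect u) c 0 := by
  refine forall_congr' fun i => forall_congr' fun hi => ?_
  rw [maxWeightPlus_reflect _ (by omega)]
  simp

/-! ### Measurability with respect to sets of edges -/

section Predicates

variable {α : Type*} {m : MeasurableSpace α}

theorem measurableSet_forall {ι : Sort*} [Countable ι] {p : ι → α → Prop}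
    (h : ∀ i, MeasurableSet {x | p i x}) : MeasurableSet {x | ∀ i, p i x} := by
  rw [Set.ofPred_forall]
  exact .iInter h

theorem measurableSet_exists {ι : Sort*} [Countable ι] {p : ι → α → Prop}
    (h : ∀ i, MeasurableSet {x | p i x}) : MeasurableSet {x | ∃ i, p i x} := by
  rw [Set.ofPred_exists]
  exact .iUnion h

theorem measurableSet_and {p q : α → Prop} (hp : MeasurableSet {x | p x})
    (hq : MeasurableSet {x | q x}) : MeasurableSet {x | p x ∧ q x} :=
  hp.inter hq

theorem measurableSet_not {p : α → Prop} (hp : MeasurableSet {x | p x}) :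
    MeasurableSet {x | ¬ p x} :=
  hp.compl

theorem measurableSet_prop_and {p : Prop} {q : α → Prop} (hq : p → MeasurableSet {x | q x}) :
    MeasurableSet {x | p ∧ q x} := by
  by_cases h : p
  · simpa [h] using hq h
  · simp [h]

end Predicates

/-- The vertices of a path after its first one. -/
def GPath.toList : {j k : ℤ} → GPath j k → List ℤ
  | _, k, .edge _ => [k]
  | _, _, .cons (l := l) _ p => l :: p.toList

/-- Makes the suprema over paths that define `w` and `w⁺` measurable. -/
theorem GPath.countable (j k : ℤ) : Countable (GPath j k) := by
  have hne : ∀ {j k : ℤ} (π : GPath j k), π.toList ≠ [] := by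
    intro j k π
    cases π <;> simp [GPath.toList]
  refine Function.Injective.countable (f := GPath.toList (j := j) (k := k)) fun π => ?_
  induction π with
  | edge h =>
    intro π' h'
    cases π' with
    | edge h => rfl
    | cons h p =>
      simp only [GPath.toList, List.cons.injEq] at h'
      exact absurd h'.2.symm (hne p)
  | cons h p ih =>
    intro π' h'
    cases π' with
    | edge h =>
      simp only [GPath.toList, List.cons.injEq] at h'
      exact absurd h'.2 (hne p)
    | cons h q =>
      simp only [GPath.toList, List.cons.injEq] at h'
      obtain ⟨rfl, h'⟩ := h'
      rw [ih h']

/-- The σ-algebra generated by the weights of the edges in `S`. -/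
noncomputable def edgeSigma (S : Set Edge) : MeasurableSpace Conf :=
  ⨆ e ∈ S, MeasurableSpace.comap (fun u : Conf => u e.1.1 e.1.2) inferInstance

/-- The edges between vertices of `[a, b]`. -/
def box (a b : ℤ) : Set Edge := {e | a ≤ e.1.1 ∧ e.1.2 ≤ b}

/-- The edges between vertices of `[a, ∞)`. -/
def above (a : ℤ) : Set Edge := {e | a ≤ e.1.1}

/-- The edges between vertices of `(-∞, b]`. -/
def below (b : ℤ) : Set Edge := {e | e.1.2 ≤ b}

theorem edgeSigma_mono {S T : Set Edge} (h : S ⊆ T) : edgeSigma S ≤ edgeSigma T :=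
  biSup_mono h

theorem measurable_weight {S : Set Edge} {j k : ℤ} (h : j < k) (hS : (⟨(j, k), h⟩ : Edge) ∈ S) :
    Measurable[edgeSigma S] (fun u : Conf => u j k) := by
  rw [measurable_iff_comap_le]
  exact le_iSup₂ (f := fun (e : Edge) (_ : e ∈ S) =>
    MeasurableSpace.comap (fun u : Conf => u e.1.1 e.1.2) inferInstance) ⟨(j, k), h⟩ hS

theorem measurableSet_pos {S : Set Edge} {j k : ℤ} (h : j < k)
    (hS : (⟨(j, k), h⟩ : Edge) ∈ S) : MeasurableSet[edgeSigma S] {u : Conf | 0 < u j k} :=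
  measurableSet_lt (mδ := edgeSigma S) measurable_const (measurable_weight h hS)

theorem measurable_of_edges {X : Type*} {mX : MeasurableSpace X} {S : Set Edge} {f : X → Conf}
    (h : ∀ e ∈ S, Measurable fun x => f x e.1.1 e.1.2) :
    @Measurable X Conf mX (edgeSigma S) f := by
  rw [measurable_iff_comap_le, edgeSigma]
  simp only [MeasurableSpace.comap_iSup, MeasurableSpace.comap_comp]
  exact iSup₂_le fun e he => (h e he).comap_le

theorem measurableSet_shift {S T : Set Edge} {A : Set Conf} (hA : MeasurableSet[edgeSigma S] A)
    (x : ℤ) (hST : ∀ e ∈ S, ∀ h : x + e.1.1 < x + e.1.2,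
      (⟨(x + e.1.1, x + e.1.2), h⟩ : Edge) ∈ T) :
    MeasurableSet[edgeSigma T] (shift x ⁻¹' A) := by
  refine measurable_of_edges (mX := edgeSigma T) (f := shift x) (fun e he => ?_) hA
  exact measurable_weight (by have := e.2; omega) (hST e he _)

theorem measurableSet_shift_box {a b : ℤ} {A : Set Conf}
    (hA : MeasurableSet[edgeSigma (box a b)] A) (x : ℤ) :
    MeasurableSet[edgeSigma (box (x + a) (x + b))] (shift x ⁻¹' A) :=
  measurableSet_shift hA x fun e he _ => ⟨by simpa using he.1, by simpa using he.2⟩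

theorem measurable_shift_univ (x : ℤ) :
    Measurable[edgeSigma Set.univ, edgeSigma Set.univ] (shift x) := by
  intro A hA
  exact measurableSet_shift hA x fun _ _ _ => trivial

theorem measurableSet_sourceOn (a b : ℤ) :
    MeasurableSet[edgeSigma (box a b)] {u : Conf | SourceOn u a b} := by
  refine measurableSet_forall (m := edgeSigma (box a b)) fun k => measurableSet_forall
    fun hk => measurableSet_forall fun hkb => measurableSet_exists fun j =>
    measurableSet_prop_and fun hj => measurableSet_prop_and fun hjk => ?_
  exact measurableSet_pos hjk ⟨hj, hkb⟩

theorem measurableSet_sinkOn (a b : ℤ) :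
    MeasurableSet[edgeSigma (box a b)] {u : Conf | SinkOn u a b} := by
  refine measurableSet_forall (m := edgeSigma (box a b)) fun j => measurableSet_forall
    fun hj => measurableSet_forall fun hjb => measurableSet_exists fun k =>
    measurableSet_prop_and fun hjk => measurableSet_prop_and fun hkb => ?_
  exact measurableSet_pos hjk ⟨hj, hkb⟩

theorem measurableSet_source (a : ℤ) :
    MeasurableSet[edgeSigma (above a)] {u : Conf | Source u a} := by
  refine measurableSet_forall (m := edgeSigma (above a)) fun k => measurableSet_forall
    fun hk => measurableSet_exists fun j =>
    measurableSet_prop_and fun hj => measurableSet_prop_and fun hjk => ?_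
  exact measurableSet_pos hjk hj

theorem measurableSet_sink (b : ℤ) :
    MeasurableSet[edgeSigma (below b)] {u : Conf | Sink u b} := by
  refine measurableSet_forall (m := edgeSigma (below b)) fun j => measurableSet_forall
    fun hj => measurableSet_exists fun k =>
    measurableSet_prop_and fun hjk => measurableSet_prop_and fun hkb => ?_
  exact measurableSet_pos hjk hkb

theorem box_subset {a b a' b' : ℤ} (ha : a' ≤ a) (hb : b ≤ b') : box a b ⊆ box a' b' :=
  fun _ he => ⟨ha.trans he.1, he.2.trans hb⟩

theorem box_subset_above (a b : ℤ) : box a b ⊆ above a := fun _ he => he.1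

theorem box_subset_below (a b : ℤ) : box a b ⊆ below b := fun _ he => he.2

theorem disjoint_below_above {a b : ℤ} (h : b ≤ a) : Disjoint (below b) (above a) := by
  rw [Set.disjoint_left]
  intro e h1 h2
  have := e.2
  simp only [below, above, Set.mem_ofPred_eq] at h1 h2
  omega

theorem measurable_gpath_weight {a b j k : ℤ} (π : GPath j k) (ha : a ≤ j) (hb : k ≤ b) :
    Measurable[edgeSigma (box a b)] (fun u : Conf => π.weight u) := by
  induction π with
  | edge h =>
    simp only [GPath.weight]
    exact measurable_weight h ⟨ha, hb⟩
  | @cons j l k h p ih =>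
    simp only [GPath.weight]
    exact Measurable.add (m := edgeSigma (box a b))
      (measurable_weight h ⟨ha, p.lt.le.trans hb⟩) (ih (ha.trans h.le) hb)

theorem measurableSet_gpath_positive {a b j k : ℤ} (π : GPath j k) (ha : a ≤ j) (hb : k ≤ b) :
    MeasurableSet[edgeSigma (box a b)] {u : Conf | π.Positive u} := by
  induction π with
  | edge h =>
    simp only [GPath.Positive]
    exact measurableSet_pos h ⟨ha, hb⟩
  | @cons j l k h p ih =>
    simp only [GPath.Positive]
    exact measurableSet_and (m := edgeSigma (box a b))
      (measurableSet_pos h ⟨ha, p.lt.le.trans hb⟩) (ih (ha.trans h.le) hb)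

theorem measurable_maxWeightPlus (a b : ℤ) :
    Measurable[edgeSigma (box a b)] (fun u : Conf => maxWeightPlus u a b) := by
  by_cases h : a = b
  · simp [maxWeightPlus, h]
  · simp only [maxWeightPlus, if_neg h]
    refine measurable_of_Ioi (mδ := edgeSigma (box a b)) fun t => ?_
    simp only [Set.preimage, Set.mem_Ioi, lt_iSup_iff]
    have := GPath.countable a b
    refine measurableSet_exists (m := edgeSigma (box a b)) fun π => ?_
    simp only [exists_prop]
    exact measurableSet_and (measurableSet_gpath_positive π le_rfl le_rfl)
      (measurableSet_lt measurable_const (measurable_gpath_weight π le_rfl le_rfl))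

theorem measurable_maxWeight (a b : ℤ) :
    Measurable[edgeSigma (box a b)] (fun u : Conf => maxWeight u a b) := by
  by_cases h : a = b
  · simp [maxWeight, h]
  · simp only [maxWeight, if_neg h]
    have := GPath.countable a b
    exact Measurable.iSup (mδ := edgeSigma (box a b))
      fun π => measurable_gpath_weight π le_rfl le_rfl

theorem minPosWeight_bddBelow (u : Conf) (a b : ℤ) :
    BddBelow {r : ℝ | 0 < r ∧ ∃ i j : ℤ, a ≤ i ∧ i < j ∧ j ≤ b ∧ u i j = (r : EReal)} :=
  ⟨0, fun _ h => h.1.le⟩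

/-- The second alternative accounts for the value `0` that `sInf` takes on the empty set, when the
interval has no positive finite weight. -/
theorem minPosWeight_lt_iff {u : Conf} {a b : ℤ} {t : ℝ} : minPosWeight u a b < t ↔
    (∃ i j, a ≤ i ∧ i < j ∧ j ≤ b ∧ 0 < u i j ∧ u i j < ⊤ ∧ u i j < (t : EReal)) ∨
      (¬ (∃ i j, a ≤ i ∧ i < j ∧ j ≤ b ∧ 0 < u i j ∧ u i j < ⊤) ∧ 0 < t) := by
  have key : ∀ i j, 0 < u i j → u i j < ⊤ → ∃ r : ℝ, 0 < r ∧ u i j = r := by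
    intro i j h0 ht
    have hr : u i j = ((u i j).toReal : EReal) :=
      (EReal.coe_toReal ht.ne (ne_bot_of_gt h0)).symm
    refine ⟨_, ?_, hr⟩
    rw [hr] at h0
    exact_mod_cast h0
  by_cases hne : ∃ i j, a ≤ i ∧ i < j ∧ j ≤ b ∧ 0 < u i j ∧ u i j < ⊤
  · simp only [hne, not_true_eq_false, false_and, or_false]
    obtain ⟨i, j, hi, hij, hj, h0, ht⟩ := hne
    obtain ⟨r, hr, hu⟩ := key i j h0 ht
    rw [minPosWeight, csInf_lt_iff (minPosWeight_bddBelow u a b) ⟨r, hr, i, j, hi, hij, hj, hu⟩]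
    constructor
    · rintro ⟨s, ⟨hs, i, j, hi, hij, hj, hu⟩, hst⟩
      exact ⟨i, j, hi, hij, hj, by rw [hu]; exact_mod_cast hs, by rw [hu]; exact EReal.coe_lt_top s,
        by rw [hu]; exact_mod_cast hst⟩
    · rintro ⟨i, j, hi, hij, hj, h0, ht, hlt⟩
      obtain ⟨s, hs, hu⟩ := key i j h0 ht
      refine ⟨s, ⟨hs, i, j, hi, hij, hj, hu⟩, ?_⟩
      rw [hu] at hlt
      exact_mod_cast hlt
  · have h1 : ¬ ∃ i j, a ≤ i ∧ i < j ∧ j ≤ b ∧ 0 < u i j ∧ u i j < ⊤ ∧ u i j < (t : EReal) := by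
      rintro ⟨i, j, hi, hij, hj, h0, ht, _⟩
      exact hne ⟨i, j, hi, hij, hj, h0, ht⟩
    have h2 : minPosWeight u a b = 0 := by
      rw [minPosWeight]
      convert Real.sInf_empty
      rw [Set.eq_empty_iff_forall_notMem]
      rintro r ⟨hr, i, j, hi, hij, hj, hu⟩
      exact hne ⟨i, j, hi, hij, hj, by rw [hu]; exact_mod_cast hr,
        by rw [hu]; exact EReal.coe_lt_top r⟩
    rw [h2]
    exact ⟨fun h => .inr ⟨hne, h⟩, fun h => h.elim (fun h => absurd h h1) And.right⟩

theorem measurable_minPosWeight (a b : ℤ) :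
    Measurable[edgeSigma (box a b)] (fun u : Conf => minPosWeight u a b) := by
  refine measurable_of_Iio (mδ := edgeSigma (box a b)) fun t => ?_
  simp only [Set.preimage, Set.mem_Iio, minPosWeight_lt_iff]
  have hw : ∀ i j, a ≤ i → i < j → j ≤ b →
      Measurable[edgeSigma (box a b)] fun u : Conf => u i j :=
    fun i j hi hij hj => measurable_weight hij ⟨hi, hj⟩
  refine MeasurableSet.union (m := edgeSigma (box a b)) ?_ (measurableSet_and
    (measurableSet_not ?_) (.const _))
  · refine measurableSet_exists fun i => measurableSet_exists fun j =>
      measurableSet_prop_and fun hi => measurableSet_prop_and fun hij =>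
      measurableSet_prop_and fun hj => ?_
    exact measurableSet_and (measurableSet_lt measurable_const (hw i j hi hij hj))
      (measurableSet_and (measurableSet_lt (hw i j hi hij hj) measurable_const)
        (measurableSet_lt (hw i j hi hij hj) measurable_const))
  · refine measurableSet_exists fun i => measurableSet_exists fun j =>
      measurableSet_prop_and fun hi => measurableSet_prop_and fun hij =>
      measurableSet_prop_and fun hj => ?_
    exact measurableSet_and (measurableSet_lt measurable_const (hw i j hi hij hj))
      (measurableSet_lt (hw i j hi hij hj) measurable_const)

/-! ### Independence and stationarity of the weights -/

section

variable {Ω : Type*} [MeasurableSpace Ω] {P : Measure Ω} {ν : Measure EReal}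
  {v : ℤ → ℤ → Ω → EReal}

theorem IsIIDWeights.measurable_config (hv : IsIIDWeights P ν v) (S : Set Edge) :
    @Measurable Ω Conf _ (edgeSigma S) (config v) :=
  measurable_of_edges fun e _ => hv.measurable _ _ e.2

theorem IsIIDWeights.measurableSet_config (hv : IsIIDWeights P ν v) {S : Set Edge}
    {A : Set Conf} (hA : MeasurableSet[edgeSigma S] A) : MeasurableSet (config v ⁻¹' A) :=
  hv.measurable_config S hA

theorem IsIIDWeights.indep_comap (hv : IsIIDWeights P ν v) {S T : Set Edge}
    (hST : Disjoint S T) : Indep (MeasurableSpace.comap (config v) (edgeSigma S))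
      (MeasurableSpace.comap (config v) (edgeSigma T)) P := by
  have h := indep_iSup_of_disjoint (m := fun e : Edge =>
    MeasurableSpace.comap (v e.1.1 e.1.2) inferInstance)
    (fun e => (hv.measurable _ _ e.2).comap_le) hv.indep hST
  simp only [edgeSigma, MeasurableSpace.comap_iSup, MeasurableSpace.comap_comp]
  exact h

theorem IsIIDWeights.measure_inter (hv : IsIIDWeights P ν v) {S T : Set Edge}
    (hST : Disjoint S T) {A B : Set Conf} (hA : MeasurableSet[edgeSigma S] A)
    (hB : MeasurableSet[edgeSigma T] B) :
    P (config v ⁻¹' A ∩ config v ⁻¹' B) = P (config v ⁻¹' A) * P (config v ⁻¹' B) :=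
  (Indep_iff _ _ _).1 (hv.indep_comap hST) _ _ ⟨A, hA, rfl⟩ ⟨B, hB, rfl⟩

theorem IsIIDWeights.lintegral_mul (hv : IsIIDWeights P ν v) {S T : Set Edge}
    (hST : Disjoint S T) {f g : Conf → ENNReal} (hf : Measurable[edgeSigma S] f)
    (hg : Measurable[edgeSigma T] g) :
    ∫⁻ ω, f (config v ω) * g (config v ω) ∂P =
      (∫⁻ ω, f (config v ω) ∂P) * ∫⁻ ω, g (config v ω) ∂P := by
  refine lintegral_mul_eq_lintegral_mul_lintegral_of_independent_measurableSpace
    (hv.measurable_config S).comap_le (hv.measurable_config T).comap_le (hv.indep_comap hST) ?_ ?_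
  · intro B hB
    exact ⟨f ⁻¹' B, hf hB, rfl⟩
  · intro B hB
    exact ⟨g ⁻¹' B, hg hB, rfl⟩

theorem edgeSigma_univ : edgeSigma Set.univ =
    MeasurableSpace.comap (fun (u : Conf) (e : Edge) => u e.1.1 e.1.2) inferInstance := by
  simp only [edgeSigma, Set.mem_univ, iSup_pos, MeasurableSpace.pi, MeasurableSpace.comap_iSup,
    MeasurableSpace.comap_comp]
  rfl

/-- Both families of weights are i.i.d. with the same marginal, so they have the same infinite
product law. Shift and reflection are the instances needed. -/
theorem IsIIDWeights.measure_reindex [IsProbabilityMeasure P] (hv : IsIIDWeights P ν v)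
    {f : Conf → Conf} {σ : Edge → Edge} (hσ : Function.Injective σ)
    (hf : ∀ u (e : Edge), f u e.1.1 e.1.2 = u (σ e).1.1 (σ e).1.2) {A : Set Conf}
    (hA : MeasurableSet[edgeSigma Set.univ] A) :
    P (config v ⁻¹' (f ⁻¹' A)) = P (config v ⁻¹' A) := by
  rw [edgeSigma_univ] at hA
  obtain ⟨B, hB, rfl⟩ := hA
  have h1 := hv.indep.map_fun_eq_infinitePi_map fun e => hv.measurable _ _ e.2
  have h2 := (hv.indep.precomp hσ).map_fun_eq_infinitePi_map fun e => hv.measurable _ _ (σ e).2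
  have hlaw : ∀ e : Edge, P.map (v e.1.1 e.1.2) = ν := fun e => hv.law _ _ e.2
  simp only [hlaw] at h1 h2
  have h3 := congrArg (fun μ => μ B) (h2.trans h1.symm)
  rw [Measure.map_apply (measurable_pi_lambda _ fun e => hv.measurable _ _ (σ e).2) hB,
    Measure.map_apply (measurable_pi_lambda _ fun e => hv.measurable _ _ e.2) hB] at h3
  refine Eq.trans (congrArg P ?_) h3
  ext ω
  simp only [Set.mem_preimage, hf]
  rfl

theorem IsIIDWeights.measure_shift [IsProbabilityMeasure P] (hv : IsIIDWeights P ν v) (x : ℤ)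
    {A : Set Conf} (hA : MeasurableSet[edgeSigma Set.univ] A) :
    P (config v ⁻¹' (shift x ⁻¹' A)) = P (config v ⁻¹' A) := by
  refine hv.measure_reindex (σ := fun e => ⟨(x + e.1.1, x + e.1.2), by have := e.2; omega⟩)
    (fun e e' h => ?_) (fun _ _ => rfl) hA
  simp only [Subtype.mk.injEq, Prod.mk.injEq, add_right_inj] at h
  exact Subtype.ext (Prod.ext h.1 h.2)

theorem IsIIDWeights.measure_reflect [IsProbabilityMeasure P] (hv : IsIIDWeights P ν v)
    {A : Set Conf} (hA : MeasurableSet[edgeSigma Set.univ] A) :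
    P (config v ⁻¹' (reflect ⁻¹' A)) = P (config v ⁻¹' A) := by
  refine hv.measure_reindex (σ := fun e => ⟨(-e.1.2, -e.1.1), by have := e.2; omega⟩)
    (fun e e' h => ?_) (fun _ _ => rfl) hA
  simp only [Subtype.mk.injEq, Prod.mk.injEq, neg_inj] at h
  exact Subtype.ext (Prod.ext h.2 h.1)

theorem IsIIDWeights.lintegral_shift [IsProbabilityMeasure P] (hv : IsIIDWeights P ν v) (x : ℤ)
    {f : Conf → ENNReal} (hf : Measurable[edgeSigma Set.univ] f) :
    ∫⁻ ω, f (shift x (config v ω)) ∂P = ∫⁻ ω, f (config v ω) ∂P := by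
  let _ : MeasurableSpace Conf := edgeSigma Set.univ
  have h1 : Measurable (config v) := hv.measurable_config Set.univ
  have h2 : Measurable (shift x) := measurable_shift_univ x
  refine (lintegral_map (μ := P) hf (h2.comp h1)).symm.trans
    (Eq.trans ?_ (lintegral_map (μ := P) hf h1))
  congr 1
  ext A hA
  rw [Measure.map_apply h1 hA, Measure.map_apply (h2.comp h1) hA]
  exact hv.measure_shift x hA

theorem measurableSet_univ_of {S : Set Edge} {A : Set Conf} (hA : MeasurableSet[edgeSigma S] A) :
    MeasurableSet[edgeSigma Set.univ] A :=
  edgeSigma_mono (Set.subset_univ S) A hA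

end

/-! ### Chains of overlapping failure intervals -/

/-- Cauchy-Schwarz for indicators. It decouples the two alternating families of intervals, which may
depend on each other. -/
theorem measure_inter_le_sqrt_mul_sqrt {Ω : Type*} [MeasurableSpace Ω] (P : Measure Ω)
    (X Y : Set Ω) : P (X ∩ Y) ≤ P X ^ (1 / 2 : ℝ) * P Y ^ (1 / 2 : ℝ) := by
  calc P (X ∩ Y) = P (X ∩ Y) ^ (1 / 2 : ℝ) * P (X ∩ Y) ^ (1 / 2 : ℝ) := by
        rw [← ENNReal.rpow_add_of_nonneg _ _ (by norm_num) (by norm_num)]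
        norm_num
    _ ≤ _ := by
        gcongr
        · exact Set.inter_subset_left
        · exact Set.inter_subset_right

section Chain

variable {Ω : Type*} [MeasurableSpace Ω] {P : Measure Ω}
  {𝓖 : ℤ → MeasurableSpace Ω} {Z : ℤ → ℕ → Set Ω} {β : ℕ → ENNReal}

/-- Greedy chains of intervals: the events `X` and `Y` collect every other interval of the chain
built so far, whose right end is `e`. -/
theorem measure_inter_chain_le (hmono : Monotone 𝓖)
    (hZ : ∀ (b : ℤ) (r : ℕ), MeasurableSet[𝓖 (b + r)] (Z b r))
    (hind : ∀ (e b : ℤ) (r : ℕ) Y, MeasurableSet[𝓖 e] Y → e < b - r → P (Y ∩ Z b r) ≤ P Y * β r)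
    {x : ENNReal} (hx : 1 ≤ x)
    (hsum : ∑' r : ℕ, (2 * r + 1 : ℕ) * β r ^ (1 / 2 : ℝ) * x ^ (2 * r + 1) ≤ 1)
    (n : ℕ) (rad : Ω → ℤ → ℕ) (k : ℕ) :
    ∀ (e : ℤ), -1 ≤ e → (n - 1 - e).toNat ≤ k → ∀ X Y B : Set Ω,
      MeasurableSet[𝓖 e] X → MeasurableSet[𝓖 e] Y →
      (∀ ω ∈ B, ∀ b : ℤ, 0 ≤ b → b < n → ω ∈ Z b (rad ω b)) →
      (∀ (b : ℤ) (r : ℕ), (∃ ω ∈ B, rad ω b = r) → 0 ≤ b → b < n → b - r ≤ e + 1 → e + 1 ≤ b + r →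
        P (Y ∩ Z b r) ≤ P Y * β r) →
      P (X ∩ Y ∩ B) * x ^ (n - 1 - e).toNat ≤ P X ^ (1 / 2 : ℝ) * P Y ^ (1 / 2 : ℝ) := by
  induction k with
  | zero =>
    intro e he hk X Y B _ _ _ _
    rw [Nat.le_zero.1 hk, pow_zero, mul_one]
    exact (measure_mono Set.inter_subset_left).trans (measure_inter_le_sqrt_mul_sqrt P X Y)
  | succ k ih =>
    intro e he hk X Y B hX hY hB hYZ
    by_cases hen : (n : ℤ) ≤ e + 1
    · rw [show (n - 1 - e).toNat = 0 by omega, pow_zero, mul_one]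
      exact (measure_mono Set.inter_subset_left).trans (measure_inter_le_sqrt_mul_sqrt P X Y)
    push Not at hen
    -- On `D r b` no interval containing `e + 1` reaches beyond `b + r`. This greedy choice is what
    -- makes the interval after next disjoint from the present one.
    set D : ℕ → ℤ → Set Ω := fun r b => {ω ∈ B | rad ω b = r ∧ 0 ≤ b ∧ b < n ∧
      ∀ b' : ℤ, 0 ≤ b' → b' < n → b' - rad ω b' ≤ e + 1 → e + 1 ≤ b' + rad ω b' →
        b' + rad ω b' ≤ b + r} with hD
    have hcover : X ∩ Y ∩ B ⊆
        ⋃ r : ℕ, ⋃ b ∈ Finset.Icc (e + 1 - r) (e + 1 + r), X ∩ Y ∩ D r b := by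
      rintro ω ⟨hXY, hω⟩
      obtain ⟨b, hb, hmax⟩ := Finset.exists_max_image
        ((Finset.Ico (0 : ℤ) n).filter fun b => b - rad ω b ≤ e + 1 ∧ e + 1 ≤ b + rad ω b)
        (fun b => b + rad ω b) ⟨e + 1, by simp; omega⟩
      simp only [Finset.mem_filter, Finset.mem_Ico, and_imp] at hb hmax
      simp only [Set.mem_iUnion, Finset.mem_Icc]
      exact ⟨rad ω b, b, by omega, hXY, hω, rfl, hb.1.1, hb.1.2, hmax⟩
    have hstep : ∀ r : ℕ, ∀ b ∈ Finset.Icc (e + 1 - r) (e + 1 + r),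
        P (X ∩ Y ∩ D r b) * x ^ (n - 1 - e).toNat ≤
          P X ^ (1 / 2 : ℝ) * P Y ^ (1 / 2 : ℝ) * (β r ^ (1 / 2 : ℝ) * x ^ (2 * r + 1)) := by
      intro r b hb
      rw [Finset.mem_Icc] at hb
      rcases (D r b).eq_empty_or_nonempty with hemp | ⟨ω₀, hω₀⟩
      · simp [hemp]
      -- The new interval is added to `Y`, and the two families exchange their roles: `X` now has to
      -- be independent of the interval chosen next.
      have h1 := ih (b + r) (by omega) (by omega) (Y ∩ Z b r) X (D r b)
        ((hmono (by omega : e ≤ b + r) Y hY).inter (hZ b r)) (hmono (by omega : e ≤ b + r) X hX)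
        (fun ω hω => hB ω hω.1) ?_
      · have h2 : P (Y ∩ Z b r) ≤ P Y * β r :=
          hYZ b r ⟨ω₀, hω₀.1, hω₀.2.1⟩ hω₀.2.2.1 hω₀.2.2.2.1 (by omega) (by omega)
        have hsub : X ∩ Y ∩ D r b ⊆ Y ∩ Z b r ∩ X ∩ D r b := by
          rintro ω ⟨⟨hωX, hωY⟩, hω⟩
          refine ⟨⟨⟨hωY, ?_⟩, hωX⟩, hω⟩
          have := hB ω hω.1 b hω.2.2.1 hω.2.2.2.1
          rwa [hω.2.1] at this
        calc P (X ∩ Y ∩ D r b) * x ^ (n - 1 - e).toNat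
            ≤ P (Y ∩ Z b r ∩ X ∩ D r b) *
              (x ^ (n - 1 - (b + r)).toNat * x ^ (2 * r + 1)) := by
              gcongr
              -- As `b - r ≤ e + 1`, the right end advances from `e` by at most `2 * r + 1`.
              rw [← pow_add]
              exact pow_le_pow_right₀ hx (by omega)
          _ ≤ ((P Y * β r) ^ (1 / 2 : ℝ) * P X ^ (1 / 2 : ℝ)) * x ^ (2 * r + 1) := by
              rw [← mul_assoc]
              refine mul_le_mul_left (h1.trans ?_) _
              gcongr
          _ = _ := by
              rw [ENNReal.mul_rpow_of_nonneg _ _ (by norm_num)]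
              ring
      · rintro b' r' ⟨ω, hω, rfl⟩ hb0 hbn hb1 hb2
        -- The next interval contains `b + r + 1`. Had it contained `e + 1` as well, it would
        -- contradict the maximality of `b + r`. Hence it starts to the right of everything on which
        -- `X` depends.
        have hlt : e + 1 < b' - rad ω b' := by
          by_contra! hle
          have := hω.2.2.2.2 b' hb0 hbn hle (by omega)
          omega
        exact hind e b' _ X hX (by omega)
    calc P (X ∩ Y ∩ B) * x ^ (n - 1 - e).toNat
        ≤ (∑' r : ℕ, ∑ b ∈ Finset.Icc (e + 1 - r) (e + 1 + r), P (X ∩ Y ∩ D r b)) *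
            x ^ (n - 1 - e).toNat := by
          gcongr
          refine (measure_mono hcover).trans ((measure_iUnion_le _).trans ?_)
          exact ENNReal.tsum_le_tsum fun r => measure_biUnion_finset_le _ _
      _ = ∑' r : ℕ, ∑ b ∈ Finset.Icc (e + 1 - r) (e + 1 + r),
            P (X ∩ Y ∩ D r b) * x ^ (n - 1 - e).toNat := by
          rw [← ENNReal.tsum_mul_right]
          simp only [Finset.sum_mul]
      _ ≤ ∑' r : ℕ, ∑ b ∈ Finset.Icc (e + 1 - r) (e + 1 + (r : ℤ)),
            P X ^ (1 / 2 : ℝ) * P Y ^ (1 / 2 : ℝ) * (β r ^ (1 / 2 : ℝ) * x ^ (2 * r + 1)) :=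
          ENNReal.tsum_le_tsum fun r => Finset.sum_le_sum (hstep r)
      _ = P X ^ (1 / 2 : ℝ) * P Y ^ (1 / 2 : ℝ) *
            ∑' r : ℕ, (2 * r + 1 : ℕ) * β r ^ (1 / 2 : ℝ) * x ^ (2 * r + 1) := by
          rw [← ENNReal.tsum_mul_left]
          refine tsum_congr fun r => ?_
          rw [Finset.sum_const, Int.card_Icc, nsmul_eq_mul,
            show (e + 1 + r + 1 - (e + 1 - r)).toNat = 2 * r + 1 by omega]
          ring
      _ ≤ _ := mul_le_of_le_one_right' hsum

/-- If every `b` in `[0, n)` is covered by the interval `[b - r, b + r]` of a failure event `Z b r`,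
and failures with disjoint intervals are independent, then the probability is exponentially small. -/
theorem measure_forall_exists_mul_pow_le [IsProbabilityMeasure P] (hmono : Monotone 𝓖)
    (hZ : ∀ (b : ℤ) (r : ℕ), MeasurableSet[𝓖 (b + r)] (Z b r))
    (hind : ∀ (e b : ℤ) (r : ℕ) Y, MeasurableSet[𝓖 e] Y → e < b - r →
      P (Y ∩ Z b r) ≤ P Y * β r)
    (hβ : ∀ b r, P (Z b r) ≤ β r) {x : ENNReal} (hx : 1 ≤ x)
    (hsum : ∑' r : ℕ, (2 * r + 1 : ℕ) * β r ^ (1 / 2 : ℝ) * x ^ (2 * r + 1) ≤ 1) (n : ℕ) :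
    P {ω | ∀ b : ℤ, 0 ≤ b → b < n → ∃ r, ω ∈ Z b r} * x ^ n ≤ 1 := by
  classical
  -- The chain starts empty: right end `-1`, and `X` and `Y` the whole space.
  have h := measure_inter_chain_le (P := P) hmono hZ hind hx hsum n
    (fun ω b => if h : ∃ r, ω ∈ Z b r then h.choose else 0) _ (-1) le_rfl le_rfl
    Set.univ Set.univ {ω | ∀ b : ℤ, 0 ≤ b → b < n → ∃ r, ω ∈ Z b r} .univ .univ
    (fun ω hω b hb hbn => by
      rw [dif_pos (hω b hb hbn)]
      exact (hω b hb hbn).choose_spec)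
    (fun b r _ _ _ _ _ => by simpa using hβ b r)
  simpa using h

end Chain

/-! ### Exponentially small sequences -/

/-- The sequence `f` decays at least exponentially. -/
def ExpSmall (f : ℕ → ENNReal) : Prop :=
  ∃ C ρ : ℝ, 0 < C ∧ 0 < ρ ∧ ρ < 1 ∧ ∀ n, f n ≤ ENNReal.ofReal (C * ρ ^ n)

namespace ExpSmall

variable {f g : ℕ → ENNReal}

theorem mono (hg : ExpSmall g) (h : ∀ n, f n ≤ g n) : ExpSmall f := by
  obtain ⟨C, ρ, hC, hρ, hρ1, hg⟩ := hg
  exact ⟨C, ρ, hC, hρ, hρ1, fun n => (h n).trans (hg n)⟩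

theorem add (hf : ExpSmall f) (hg : ExpSmall g) : ExpSmall (fun n => f n + g n) := by
  obtain ⟨C, ρ, hC, hρ, hρ1, hf⟩ := hf
  obtain ⟨D, σ, hD, hσ, hσ1, hg⟩ := hg
  refine ⟨C + D, max ρ σ, by positivity, by positivity, max_lt hρ1 hσ1, fun n => ?_⟩
  refine (add_le_add (hf n) (hg n)).trans ?_
  rw [← ENNReal.ofReal_add (by positivity) (by positivity), add_mul]
  refine ENNReal.ofReal_le_ofReal (add_le_add ?_ ?_)
  · gcongr
    exact le_max_left _ _
  · gcongr
    exact le_max_right _ _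

theorem const_mul (hf : ExpSmall f) {c : ENNReal} (hc : c ≠ ⊤) :
    ExpSmall (fun n => c * f n) := by
  obtain ⟨C, ρ, hC, hρ, hρ1, hf⟩ := hf
  refine ⟨(c.toReal + 1) * C, ρ, by positivity, hρ, hρ1, fun n => ?_⟩
  rw [mul_assoc, ENNReal.ofReal_mul (by positivity)]
  exact mul_le_mul' ((ENNReal.le_ofReal_iff_toReal_le hc (by positivity)).2 (by linarith)) (hf n)

/-- Bernoulli's inequality bounds the factor `n + 1` by a multiple of `r ^ n`, with `r > 1` so close
to one that `ρ * r < 1`. -/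
theorem nat_mul (hf : ExpSmall f) : ExpSmall (fun n => (n + 1 : ℕ) * f n) := by
  obtain ⟨C, ρ, hC, hρ, hρ1, hf⟩ := hf
  obtain ⟨r, hr1, hr⟩ : ∃ r : ℝ, 1 < r ∧ ρ * r < 1 := by
    refine ⟨2 / (1 + ρ), by rw [lt_div_iff₀ (by positivity)]; linarith, ?_⟩
    rw [mul_div_assoc', div_lt_one (by positivity)]
    linarith
  refine ⟨(1 / (r - 1) + 1) * C, ρ * r, ?_, by positivity, hr, fun n => ?_⟩
  · have : 0 < r - 1 := by linarith
    positivity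
  have hb : ((n + 1 : ℕ) : ℝ) ≤ (1 / (r - 1) + 1) * r ^ n := by
    have h1 := one_add_mul_le_pow (a := r - 1) (by linarith) n
    rw [add_sub_cancel] at h1
    have h2 : (n : ℝ) ≤ 1 / (r - 1) * r ^ n := by
      rw [one_div, inv_mul_eq_div, le_div_iff₀ (by linarith)]
      linarith
    have h3 : (1 : ℝ) ≤ r ^ n := one_le_pow₀ hr1.le
    push_cast
    linarith
  calc ((n + 1 : ℕ) : ENNReal) * f n
      ≤ ENNReal.ofReal ((n + 1 : ℕ) : ℝ) * ENNReal.ofReal (C * ρ ^ n) := by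
        gcongr
        · rw [ENNReal.ofReal_natCast]
        · exact hf n
    _ = ENNReal.ofReal (((n + 1 : ℕ) : ℝ) * (C * ρ ^ n)) := by
        rw [ENNReal.ofReal_mul (p := ((n + 1 : ℕ) : ℝ)) (by positivity)]
    _ ≤ _ := by
        refine ENNReal.ofReal_le_ofReal ?_
        calc ((n + 1 : ℕ) : ℝ) * (C * ρ ^ n)
            ≤ ((1 / (r - 1) + 1) * r ^ n) * (C * ρ ^ n) := by gcongr
          _ = _ := by rw [mul_pow]; ring

/-- Exponential decay along a sequence of indices that grows linearly. -/
theorem comp (hf : ExpSmall f) {h : ℕ → ℕ} {K : ℕ} (hK : ∀ n, n ≤ K * (h n + 1)) :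
    ExpSmall (fun n => f (h n)) := by
  obtain ⟨C, ρ, hC, hρ, hρ1, hf⟩ := hf
  -- The root of order `K + 1`, rather than `K`, avoids a separate case `K = 0`.
  set σ : ℝ := ρ ^ (1 / (K + 1 : ℝ)) with hσ
  have hσ0 : 0 < σ := Real.rpow_pos_of_pos hρ _
  have hσ1 : σ < 1 := Real.rpow_lt_one hρ.le hρ1 (by positivity)
  have hσK : σ ^ (K + 1) = ρ := by
    rw [hσ, ← Real.rpow_natCast, ← Real.rpow_mul hρ.le]
    push_cast
    rw [one_div, inv_mul_cancel₀ (by positivity), Real.rpow_one]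
  refine ⟨C / ρ, σ, by positivity, hσ0, hσ1, fun n => (hf _).trans ?_⟩
  refine ENNReal.ofReal_le_ofReal ?_
  rw [div_mul_eq_mul_div, le_div_iff₀ hρ, mul_assoc, ← pow_succ]
  gcongr
  rw [← hσK, ← pow_mul]
  refine pow_le_pow_of_le_one hσ0.le hσ1.le ((hK n).trans ?_)
  gcongr
  omega

theorem tsum_add (hf : ExpSmall f) : ExpSmall (fun n => ∑' k, f (n + k)) := by
  obtain ⟨C, ρ, hC, hρ, hρ1, hf⟩ := hf
  have h1 : 0 < 1 - ρ := by linarith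
  refine ⟨C / (1 - ρ), ρ, by positivity, hρ, hρ1, fun n => ?_⟩
  calc ∑' k, f (n + k) ≤ ∑' k, ENNReal.ofReal (C * ρ ^ (n + k)) :=
        ENNReal.tsum_le_tsum fun k => hf _
    _ = ENNReal.ofReal (∑' k, C * ρ ^ (n + k)) := by
        rw [ENNReal.ofReal_tsum_of_nonneg (fun k => by positivity)]
        simp only [pow_add, ← mul_assoc]
        exact (summable_geometric_of_lt_one hρ.le hρ1).mul_left _
    _ = _ := by
        simp only [pow_add, ← mul_assoc]
        rw [tsum_mul_left, tsum_geometric_of_lt_one hρ.le hρ1]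
        congr 1
        field_simp

theorem exists_lt (hf : ExpSmall f) {ε : ENNReal} (hε : 0 < ε) : ∃ N, ∀ n ≥ N, f n < ε := by
  obtain ⟨C, ρ, hC, hρ, hρ1, hf⟩ := hf
  have h : Filter.Tendsto (fun n => ENNReal.ofReal (C * ρ ^ n)) Filter.atTop (nhds 0) := by
    have := (tendsto_pow_atTop_nhds_zero_of_lt_one hρ.le hρ1).const_mul C
    rw [mul_zero] at this
    simpa [Function.comp_def] using (ENNReal.continuous_ofReal.tendsto 0).comp this
  obtain ⟨N, hN⟩ := Filter.eventually_atTop.1 (h.eventually (gt_mem_nhds hε))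
  exact ⟨N, fun n hn => (hf n).trans_lt (hN n hn)⟩

theorem tail (hf : ExpSmall f) {ε : ENNReal} (hε : 0 < ε) : ∃ N, ∑' k, f (N + k) < ε := by
  obtain ⟨N, hN⟩ := hf.tsum_add.exists_lt hε
  exact ⟨N, hN N le_rfl⟩

end ExpSmall

/-! ### Coarse-graining and gap tails for local conditions -/

theorem ofReal_sq_rpow_half {z : ℝ} (hz : 0 ≤ z) :
    ENNReal.ofReal (z ^ 2) ^ (1 / 2 : ℝ) = ENNReal.ofReal z := by
  rw [ENNReal.ofReal_rpow_of_nonneg (by positivity) (by norm_num), ← Real.sqrt_eq_rpow,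
    Real.sqrt_sq hz]

/-- The choice of the block length in the coarse-graining argument. -/
theorem exists_block_length {s B η : ℝ} (hs0 : 0 ≤ s) (hs : s < 1) (hB : 1 ≤ B) (hη0 : 0 < η)
    (hη : η < 1) : ∃ x : ℝ, 1 < x ∧ ∃ L : ℕ, 1 ≤ L ∧
      ∑' r : ℕ, ((2 * r + 1 : ℕ) : ENNReal) *
        ENNReal.ofReal ((if r = 0 then s else B * η ^ (r * L)) ^ 2) ^ (1 / 2 : ℝ) *
        ENNReal.ofReal x ^ (2 * r + 1) ≤ 1 := by
  have hx : 1 < 2 / (1 + s) := by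
    rw [lt_div_iff₀ (by positivity)]
    linarith
  set x : ℝ := 2 / (1 + s) with hxdef
  have hsx : s * x < 1 := by
    rw [hxdef, mul_div_assoc', div_lt_one (by positivity)]
    linarith
  set y : ℝ := min (1 / 2) ((1 - s * x) / 2) with hy
  have hy0 : 0 < y := lt_min (by norm_num) (by linarith)
  have hy1 : y ≤ 1 / 2 := min_le_left _ _
  have hy2 : 2 * y ≤ 1 - s * x := by
    have : y ≤ (1 - s * x) / 2 := min_le_right _ _
    linarith
  have hx0 : 0 < x := by linarith
  -- Absorbs the prefactors through `2 * r + 1 ≤ 3 ^ r`, `B ≤ B ^ r` and `x ^ (2 * r + 1) ≤ (x ^ 3)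
  -- ^ r`, valid for `r ≥ 1`.
  set D : ℝ := 3 * B * x ^ 3 with hD
  have hD0 : 0 < D := by positivity
  obtain ⟨L, hL⟩ : ∃ L : ℕ, η ^ L < y / D := exists_pow_lt_of_lt_one (by positivity) hη
  have hL1 : η ^ (L + 1) ≤ y / D :=
    (pow_le_pow_of_le_one hη0.le hη.le (Nat.le_succ L)).trans hL.le
  refine ⟨x, hx, L + 1, by omega, ?_⟩
  have hterm : ∀ r : ℕ, ((2 * r + 1 : ℕ) : ENNReal) *
        ENNReal.ofReal ((if r = 0 then s else B * η ^ (r * (L + 1))) ^ 2) ^ (1 / 2 : ℝ) *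
        ENNReal.ofReal x ^ (2 * r + 1) ≤ ENNReal.ofReal (if r = 0 then s * x else y ^ r) := by
    intro r
    rw [ofReal_sq_rpow_half (by split_ifs <;> positivity), ← ENNReal.ofReal_pow hx0.le,
      ← ENNReal.ofReal_natCast, ← ENNReal.ofReal_mul (by positivity),
      ← ENNReal.ofReal_mul (by split_ifs <;> positivity)]
    refine ENNReal.ofReal_le_ofReal ?_
    split_ifs with hr
    · subst hr
      simp
    · have h3 : ((2 * r + 1 : ℕ) : ℝ) ≤ 3 ^ r := by
        have := one_add_mul_le_pow (a := (2 : ℝ)) (by norm_num) r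
        push_cast
        norm_num at this
        linarith
      have hBr : B ≤ B ^ r := le_self_pow₀ hB hr
      have hxr : x ^ (2 * r + 1) ≤ (x ^ 3) ^ r := by
        rw [← pow_mul]
        exact pow_le_pow_right₀ hx.le (by omega)
      calc ((2 * r + 1 : ℕ) : ℝ) * (B * η ^ (r * (L + 1))) * x ^ (2 * r + 1)
          ≤ 3 ^ r * (B ^ r * η ^ (r * (L + 1))) * (x ^ 3) ^ r := by gcongr
        _ = (D * η ^ (L + 1)) ^ r := by
            rw [hD, mul_pow, mul_pow, mul_pow, ← pow_mul η, mul_comm (L + 1) r]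
            ring
        _ ≤ (D * (y / D)) ^ r := by gcongr
        _ = y ^ r := by rw [mul_div_cancel₀ _ hD0.ne']
  refine (ENNReal.tsum_le_tsum hterm).trans ?_
  have hsucc : HasSum (fun r : ℕ => y ^ (r + 1)) (y * (1 - y)⁻¹) := by
    simp only [pow_succ']
    exact (hasSum_geometric_of_lt_one hy0.le (by linarith)).mul_left y
  have hsum : Summable fun r : ℕ => if r = 0 then s * x else y ^ r := by
    rw [← summable_nat_add_iff 1]
    simpa using hsucc.summable
  rw [← ENNReal.ofReal_tsum_of_nonneg (fun r => by split_ifs <;> positivity) hsum,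
    hsum.tsum_eq_zero_add]
  simp only [if_true, Nat.add_eq_zero_iff, one_ne_zero, and_false, if_false, hsucc.tsum_eq]
  refine ENNReal.ofReal_le_one.2 ?_
  have : y * (1 - y)⁻¹ ≤ 2 * y := by
    rw [← div_eq_mul_inv, div_le_iff₀ (by linarith)]
    nlinarith
  linarith

section Local

variable {Ω : Type*} [MeasurableSpace Ω] {P : Measure Ω} [IsProbabilityMeasure P]
  {ν : Measure EReal} {v : ℤ → ℤ → Ω → EReal}

/-- Let the event `⋂ m, E m` have positive probability, where `E m` depends on the weights of the
edges in `[-m, m]` and its probability tends to one exponentially fast. Then the probability that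
this event is seen from none of `n` consecutive vertices decays exponentially. -/
theorem IsIIDWeights.expSmall_of_local (hv : IsIIDWeights P ν v) {E : ℕ → Set Conf}
    (hE : ∀ m : ℕ, MeasurableSet[edgeSigma (box (-m) m)] (E m))
    (hfail : ExpSmall fun m => P (config v ⁻¹' (E m)ᶜ))
    (hpos : 0 < P (config v ⁻¹' ⋂ m, E m)) :
    ∃ f, ExpSmall f ∧ ∀ (a : ℤ) (n : ℕ),
      P {ω | ∀ x, a ≤ x → x < a + n → shift x (config v ω) ∉ ⋂ m, E m} ≤ f n := by
  have hEuniv : MeasurableSet[edgeSigma Set.univ] (⋂ m, E m) :=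
    MeasurableSet.iInter (m := edgeSigma Set.univ) fun m => measurableSet_univ_of (hE m)
  obtain ⟨C, ρ, hC, hρ, hρ1, hf⟩ := hfail.tsum_add
  set q : ℝ := (P (config v ⁻¹' ⋂ m, E m)).toReal with hq
  have hq0 : 0 < q := ENNReal.toReal_pos hpos.ne' (measure_ne_top _ _)
  have hq1 : q ≤ 1 := ENNReal.toReal_le_of_le_ofReal (by norm_num) (by simpa using prob_le_one)
  have hs1 : √(1 - q) < 1 := by
    rw [Real.sqrt_lt' one_pos]
    linarith
  obtain ⟨x, hx, L, hL, hsum⟩ := exists_block_length (Real.sqrt_nonneg (1 - q)) hs1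
    (le_max_right (√C) 1) (Real.sqrt_pos.2 hρ) ((Real.sqrt_lt' one_pos).2 (by linarith))
  -- Squares, because the chain bound takes square roots. For `r = 0` only the bound `1 - q` for
  -- failure of the whole intersection is available; for `r ≥ 1` the bound is the tail of the
  -- failure probabilities from scale `r * L` on.
  set β : ℕ → ENNReal := fun r =>
    ENNReal.ofReal ((if r = 0 then √(1 - q) else max (√C) 1 * √ρ ^ (r * L)) ^ 2) with hβ
  -- The block around `2 * L * b` has half-width `L`. Failures at these scales depend only on edges
  -- inside the union of the blocks from `b - r` to `b + r`.
  set F : ℕ → Set Conf := fun r =>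
    ⋃ m : ℕ, ⋃ _ : (2 * r - 1) * L < (m : ℤ) ∧ (m : ℤ) ≤ (2 * r + 1) * L, (E m)ᶜ with hF
  have hFmeas : ∀ r : ℕ,
      MeasurableSet[edgeSigma (box (-((2 * r + 1) * L)) ((2 * r + 1) * L))] (F r) := by
    intro r
    refine MeasurableSet.iUnion (m := edgeSigma _) fun m => MeasurableSet.iUnion fun hm => ?_
    exact edgeSigma_mono (box_subset (by linarith) (by linarith)) _
      (MeasurableSet.compl (m := edgeSigma _) (hE m))
  have hFβ : ∀ r, P (config v ⁻¹' F r) ≤ β r := by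
    intro r
    rcases Nat.eq_zero_or_pos r with rfl | hr
    · have hsub : config v ⁻¹' F 0 ⊆ (config v ⁻¹' ⋂ m, E m)ᶜ := by
        intro ω hω
        simp only [hF, Set.mem_preimage, Set.mem_iUnion] at hω
        obtain ⟨m, _, hm⟩ := hω
        exact fun h => hm (Set.mem_iInter.1 h m)
      refine (measure_mono hsub).trans ?_
      rw [prob_compl_eq_one_sub (hv.measurableSet_config hEuniv)]
      simp only [hβ, if_true]
      rw [Real.sq_sqrt (by linarith), ENNReal.ofReal_sub _ hq0.le, ENNReal.ofReal_one,
        ENNReal.ofReal_toReal (measure_ne_top _ _)]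
    · have hsub : config v ⁻¹' F r ⊆ ⋃ k : ℕ, config v ⁻¹' (E (r * L + k))ᶜ := by
        intro ω hω
        simp only [hF, Set.mem_preimage, Set.mem_iUnion] at hω
        obtain ⟨m, ⟨hm1, _⟩, hm⟩ := hω
        have hm2 : r * L ≤ m := by
          have : (r : ℤ) * L ≤ (2 * r - 1) * L := by
            have : (1 : ℤ) ≤ r := by exact_mod_cast hr
            nlinarith
          exact_mod_cast this.trans hm1.le
        refine Set.mem_iUnion.2 ⟨m - r * L, ?_⟩
        rwa [Set.mem_preimage, Nat.add_sub_cancel' hm2]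
      refine (measure_mono hsub).trans ((measure_iUnion_le _).trans ((hf (r * L)).trans ?_))
      refine ENNReal.ofReal_le_ofReal ?_
      rw [if_neg hr.ne', mul_pow, pow_right_comm √ρ, Real.sq_sqrt hρ.le]
      gcongr
      calc C = √C ^ 2 := (Real.sq_sqrt hC.le).symm
        _ ≤ _ := by gcongr; exact le_max_left _ _
  set Z : ℤ → ℕ → Set Ω := fun b r => config v ⁻¹' (shift (2 * L * b) ⁻¹' F r) with hZ
  have hZsub : ∀ (b : ℤ) (r : ℕ) (T : Set Edge),
      box (2 * L * b + -((2 * r + 1) * L)) (2 * L * b + (2 * r + 1) * L) ⊆ T →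
      MeasurableSet[edgeSigma T] (shift (2 * L * b) ⁻¹' F r) := fun b r T hT =>
    edgeSigma_mono hT _ (measurableSet_shift_box (hFmeas r) _)
  have hZβ : ∀ b r, P (Z b r) ≤ β r := fun b r => by
    rw [hZ, hv.measure_shift _ (measurableSet_univ_of (hFmeas r))]
    exact hFβ r
  -- The vertex `(2 * e + 1) * L` is the right end of block `e`. Consecutive blocks share this
  -- vertex but no edge, so disjoint ranges of blocks are independent.
  have hmain := measure_forall_exists_mul_pow_le (P := P)
    (𝓖 := fun e => MeasurableSpace.comap (config v) (edgeSigma (below ((2 * e + 1) * L))))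
    (Z := Z) (β := β) ?_ ?_ ?_ hZβ (x := ENNReal.ofReal x) (by simpa using hx.le) hsum
  rotate_left
  · intro e e' hee
    refine MeasurableSpace.comap_mono (edgeSigma_mono fun d hd => ?_)
    exact le_trans (show d.1.2 ≤ _ from hd) (by gcongr)
  · intro b r
    refine ⟨_, hZsub b r _ fun d hd => ?_, rfl⟩
    exact le_trans hd.2 (le_of_eq (by ring))
  · rintro e b r _ ⟨Y, hY, rfl⟩ hebr
    have hT := hZsub b r (above ((2 * e + 1) * L)) fun d hd => le_trans (by nlinarith) hd.1
    rw [hZ, hv.measure_inter (disjoint_below_above le_rfl) hY hT]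
    gcongr
    exact hZβ b r
  -- Only the block centres are tested, and `n` consecutive vertices provide `n / (2 * L)` of them.
  refine ⟨fun n => ENNReal.ofReal ((x⁻¹) ^ (n / (2 * L))), ?_, fun a n => ?_⟩
  · have h1 : ExpSmall fun n => ENNReal.ofReal ((x⁻¹) ^ n) :=
      ⟨1, x⁻¹, one_pos, by positivity, inv_lt_one_of_one_lt₀ hx, fun n => by rw [one_mul]⟩
    refine h1.comp (h := fun n => n / (2 * L)) (K := 2 * L) fun n => ?_
    have := Nat.lt_mul_div_succ n (show 0 < 2 * L by omega)
    omega
  · have hmeas : MeasurableSet[edgeSigma Set.univ]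
        {u : Conf | ∀ x : ℤ, 0 ≤ x → x < n → shift x u ∉ ⋂ m, E m} := by
      refine measurableSet_forall (m := edgeSigma Set.univ) fun x => measurableSet_forall
        fun _ => measurableSet_forall fun _ => measurableSet_not ?_
      exact measurable_shift_univ x hEuniv
    have heq : {ω | ∀ x, a ≤ x → x < a + n → shift x (config v ω) ∉ ⋂ m, E m} =
        config v ⁻¹' (shift a ⁻¹' {u : Conf | ∀ x : ℤ, 0 ≤ x → x < n →
          shift x u ∉ ⋂ m, E m}) := by
      ext ω
      simp only [Set.mem_preimage, Set.mem_ofPred_eq, shift_shift]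
      refine ⟨fun h x hx hxn => h (a + x) (by omega) (by omega), fun h x hx hxn => ?_⟩
      have := h (x - a) (by omega) (by omega)
      rwa [add_sub_cancel] at this
    simp only [inv_pow]
    rw [heq, hv.measure_shift _ hmeas,
      ENNReal.ofReal_inv_of_pos (by positivity), ENNReal.ofReal_pow (by positivity),
      ENNReal.le_inv_iff_mul_le]
    refine le_trans ?_ (hmain (n / (2 * L)))
    gcongr
    intro ω hω b hb hbn
    have h1 : (0 : ℤ) ≤ 2 * L * b := by positivity
    have h2 : 2 * L * b < n := by
      have h3 : (2 * L * (b + 1) : ℤ) ≤ 2 * L * (n / (2 * L) : ℕ) := by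
        gcongr
        omega
      have h4 : (2 * L * (n / (2 * L) : ℕ) : ℤ) ≤ n := by exact_mod_cast Nat.mul_div_le n (2 * L)
      have h5 : (1 : ℤ) ≤ L := by exact_mod_cast hL
      linarith
    have h6 := hω _ h1 h2
    simp only [Set.mem_iInter, not_forall] at h6
    obtain ⟨m, hm⟩ := h6
    -- The unique `r` with `(2 * r - 1) * L < m ≤ (2 * r + 1) * L`.
    refine ⟨(m + L - 1) / (2 * L), Set.mem_iUnion₂.2 ⟨m, ⟨?_, ?_⟩, hm⟩⟩
    · have h7 : 2 * L * ((m + L - 1) / (2 * L)) ≤ m + L - 1 := Nat.mul_div_le _ _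
      have h8 : 2 * L * ((m + L - 1) / (2 * L)) + 1 ≤ m + L := by omega
      have h9 : (2 * L * ((m + L - 1) / (2 * L) : ℕ) + 1 : ℤ) ≤ m + L := by exact_mod_cast h8
      linarith
    · have h7 := Nat.lt_mul_div_succ (m + L - 1) (show 0 < 2 * L by omega)
      have h8 : m + L ≤ 2 * L * ((m + L - 1) / (2 * L) + 1) := by omega
      have h9 : (m + L : ℤ) ≤ 2 * L * (((m + L - 1) / (2 * L) : ℕ) + 1) := by exact_mod_cast h8
      linarith

end Local

/-! ### First points of random sets and their exponential moments -/

section Points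

variable {A B : Set ℤ}

theorem sInf_int_mem {s : Set ℤ} (hne : s.Nonempty) {a : ℤ} (ha : ∀ x ∈ s, a ≤ x) : sInf s ∈ s :=
  Int.csInf_mem hne ⟨a, ha⟩

theorem point0_le {x : ℤ} (hx : x ∈ A) (h0 : 0 ≤ x) : point0 A ≤ x :=
  csInf_le ⟨0, fun _ h => h.2⟩ ⟨hx, h0⟩

theorem point1_le {x : ℤ} (hx : x ∈ A) (h0 : point0 A < x) : point1 A ≤ x :=
  csInf_le ⟨point0 A, fun _ h => h.2.le⟩ ⟨hx, h0⟩

theorem BiInfinite.exists_gt (hA : BiInfinite A) (a : ℤ) : ∃ x ∈ A, a < x :=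
  not_bddAbove_iff.1 hA.1 a

theorem BiInfinite.point0_mem (hA : BiInfinite A) : point0 A ∈ A ∧ 0 ≤ point0 A := by
  obtain ⟨x, hx, h0⟩ := hA.exists_gt 0
  exact sInf_int_mem (s := {x | x ∈ A ∧ 0 ≤ x}) ⟨x, hx, h0.le⟩ (a := 0) fun _ h => h.2

theorem BiInfinite.point1_mem (hA : BiInfinite A) : point1 A ∈ A ∧ point0 A < point1 A := by
  obtain ⟨x, hx, h0⟩ := hA.exists_gt (point0 A)
  exact sInf_int_mem (s := {x | x ∈ A ∧ point0 A < x}) ⟨x, hx, h0⟩ (a := point0 A)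
    fun _ h => h.2.le

theorem BiInfinite.superset (hA : BiInfinite A) (h : A ⊆ B) : BiInfinite B :=
  ⟨fun hB => hA.1 (hB.mono h), fun hB => hA.2 (hB.mono h)⟩

theorem BiInfinite.point1_le_point1 (hA : BiInfinite A) (h : A ⊆ B) : point1 B ≤ point1 A := by
  have h0 := hA.point0_mem
  have h1 := hA.point1_mem
  exact point1_le (h h1.1) ((point0_le (h h0.1) h0.2).trans_lt h1.2)

theorem point0_eq_iff (hA : BiInfinite A) {x : ℤ} :
    point0 A = x ↔ x ∈ A ∧ 0 ≤ x ∧ ∀ z, 0 ≤ z → z < x → z ∉ A := by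
  constructor
  · rintro rfl
    exact ⟨hA.point0_mem.1, hA.point0_mem.2, fun z h0 hz hzA => hz.not_ge (point0_le hzA h0)⟩
  · rintro ⟨hx, h0, h⟩
    refine le_antisymm (point0_le hx h0) ?_
    by_contra! hlt
    exact h _ hA.point0_mem.2 hlt hA.point0_mem.1

theorem point1_eq_iff (hA : BiInfinite A) {y : ℤ} :
    point1 A = y ↔ y ∈ A ∧ point0 A < y ∧ ∀ z, point0 A < z → z < y → z ∉ A := by
  constructor
  · rintro rfl
    exact ⟨hA.point1_mem.1, hA.point1_mem.2, fun z h0 hz hzA => hz.not_ge (point1_le hzA h0)⟩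
  · rintro ⟨hx, h0, h⟩
    refine le_antisymm (point1_le hx h0) ?_
    by_contra! hlt
    exact h _ hA.point1_mem.2 hlt hA.point1_mem.1

end Points

section RandomSets

variable {Ω : Type*} [MeasurableSpace Ω] {P : Measure Ω} {A B : Ω → Set ℤ}

theorem measurable_sInf_ge (hA : ∀ x, MeasurableSet {ω | x ∈ A ω}) (a : ℤ) :
    Measurable fun ω => sInf {x | x ∈ A ω ∧ a ≤ x} := by
  refine measurable_to_countable' fun y => ?_
  -- The second set covers the default value `sInf ∅ = 0`.
  have : (fun ω => sInf {x | x ∈ A ω ∧ a ≤ x}) ⁻¹' {y} =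
      {ω | y ∈ A ω ∧ a ≤ y ∧ ∀ z, a ≤ z → z < y → z ∉ A ω} ∪
        {ω | y = 0 ∧ ∀ z, a ≤ z → z ∉ A ω} := by
    ext ω
    simp only [Set.mem_preimage, Set.mem_singleton_iff, Set.mem_union, Set.mem_ofPred_eq]
    rcases Set.eq_empty_or_nonempty {x | x ∈ A ω ∧ a ≤ x} with he | hne
    · have hz : ∀ z, a ≤ z → z ∉ A ω := fun z hz hzA =>
        (Set.eq_empty_iff_forall_notMem.1 he z) ⟨hzA, hz⟩
      rw [he, Int.csInf_empty]
      exact ⟨fun h => .inr ⟨h.symm, hz⟩, fun h => h.elim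
        (fun h => absurd h.1 (hz y h.2.1)) (fun h => h.1.symm)⟩
    · have hmem := sInf_int_mem hne (a := a) fun _ h => h.2
      constructor
      · rintro rfl
        refine .inl ⟨hmem.1, hmem.2, fun z hz hlt hzA => hlt.not_ge ?_⟩
        exact csInf_le ⟨a, fun _ h => h.2⟩ ⟨hzA, hz⟩
      · rintro (⟨hy, hay, h⟩ | ⟨-, h⟩)
        · refine le_antisymm (csInf_le ⟨a, fun _ h => h.2⟩ ⟨hy, hay⟩) ?_
          by_contra! hlt
          exact h _ hmem.2 hlt hmem.1
        · exact absurd hmem.1 (h _ hmem.2)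
  rw [this]
  refine MeasurableSet.union ?_ ?_
  · exact measurableSet_and (hA y) (measurableSet_prop_and fun _ => measurableSet_forall fun z =>
      measurableSet_forall fun _ => measurableSet_forall fun _ => measurableSet_not (hA z))
  · exact measurableSet_prop_and fun _ => measurableSet_forall fun z =>
      measurableSet_forall fun _ => measurableSet_not (hA z)

theorem measurable_point0 (hA : ∀ x, MeasurableSet {ω | x ∈ A ω}) :
    Measurable fun ω => point0 (A ω) :=
  measurable_sInf_ge hA 0

theorem measurable_point1 (hA : ∀ x, MeasurableSet {ω | x ∈ A ω}) :
    Measurable fun ω => point1 (A ω) := by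
  refine measurable_to_countable' fun y => ?_
  have : (fun ω => point1 (A ω)) ⁻¹' {y} = ⋃ p : ℤ, {ω | point0 (A ω) = p ∧
      sInf {x | x ∈ A ω ∧ p + 1 ≤ x} = y} := by
    ext ω
    simp only [Set.mem_preimage, Set.mem_singleton_iff, Set.mem_iUnion, Set.mem_ofPred_eq,
      exists_eq_left', point1, Int.add_one_le_iff]
  rw [this]
  exact .iUnion fun p => measurableSet_and (measurable_point0 hA (measurableSet_singleton p))
    (measurable_sInf_ge hA (p + 1) (measurableSet_singleton y))

/-- The gaps of the random set `A` have uniformly exponentially small tails. -/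
structure ExpRecurrent (P : Measure Ω) (A : Ω → Set ℤ) : Prop where
  measurableSet : ∀ x, MeasurableSet {ω | x ∈ A ω}
  gap : ∃ f, ExpSmall f ∧ ∀ (a : ℤ) (n : ℕ), P {ω | ∀ x, a ≤ x → x < a + n → x ∉ A ω} ≤ f n

theorem ExpRecurrent.ae_exists_gt (hA : ExpRecurrent P A) (a : ℤ) :
    ∀ᵐ ω ∂P, ∃ x ∈ A ω, a < x := by
  obtain ⟨f, hf, hgap⟩ := hA.gap
  rw [ae_iff]
  refine nonpos_iff_eq_zero.1 (le_of_forall_gt_imp_ge_of_dense fun ε hε => ?_)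
  obtain ⟨N, hN⟩ := hf.exists_lt hε
  refine (measure_mono fun ω hω => ?_).trans ((hgap (a + 1) N).trans (hN N le_rfl).le)
  intro x hx _ hxA
  exact hω ⟨x, hxA, by omega⟩

theorem ExpRecurrent.ae_exists_lt (hA : ExpRecurrent P A) (a : ℤ) :
    ∀ᵐ ω ∂P, ∃ x ∈ A ω, x < a := by
  obtain ⟨f, hf, hgap⟩ := hA.gap
  rw [ae_iff]
  refine nonpos_iff_eq_zero.1 (le_of_forall_gt_imp_ge_of_dense fun ε hε => ?_)
  obtain ⟨N, hN⟩ := hf.exists_lt hε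
  refine (measure_mono fun ω hω => ?_).trans ((hgap (a - N) N).trans (hN N le_rfl).le)
  intro x _ hx hxA
  exact hω ⟨x, hxA, by omega⟩

theorem ExpRecurrent.ae_biInfinite (hA : ExpRecurrent P A) : ∀ᵐ ω ∂P, BiInfinite (A ω) := by
  filter_upwards [ae_all_iff.2 hA.ae_exists_gt, ae_all_iff.2 hA.ae_exists_lt] with ω h1 h2
  exact ⟨not_bddAbove_iff.2 h1, not_bddBelow_iff.2 h2⟩

/-- The bound `exp (C N) ≤ 1 + ∑ exp (C n) 1{n ≤ N}` reduces the moment to the tails, and `ρ = exp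
(-2C)` leaves a geometric series of ratio `exp (-C)`. -/
theorem exists_lintegral_exp_ne_top [IsProbabilityMeasure P] {N : Ω → ℤ} (hN : Measurable N)
    (h : ExpSmall fun n => P {ω | (n : ℤ) ≤ N ω}) :
    ∃ C : ℝ, 0 < C ∧ ∫⁻ ω, ENNReal.ofReal (Real.exp (C * N ω)) ∂P ≠ ⊤ := by
  obtain ⟨D, ρ, hD, hρ, hρ1, hf⟩ := h
  have hlog : Real.log ρ < 0 := Real.log_neg hρ hρ1
  set C : ℝ := -Real.log ρ / 2 with hC
  have hρC : ρ = Real.exp (-(2 * C)) := by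
    rw [hC, mul_div_cancel₀ _ two_ne_zero, neg_neg, Real.exp_log hρ]
  have hC0 : 0 < C := by
    rw [hC]
    linarith
  refine ⟨C, hC0, ne_of_lt ?_⟩
  have hmeas : ∀ n : ℕ, MeasurableSet {ω | (n : ℤ) ≤ N ω} := fun n =>
    measurableSet_le measurable_const hN
  calc ∫⁻ ω, ENNReal.ofReal (Real.exp (C * N ω)) ∂P
      ≤ ∫⁻ ω, (1 + ∑' n : ℕ, {ω | (n : ℤ) ≤ N ω}.indicator
          (fun _ => ENNReal.ofReal (Real.exp (C * n))) ω) ∂P := by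
        refine lintegral_mono fun ω => ?_
        rcases le_or_gt (N ω) 0 with h0 | h0
        · refine le_add_right ?_
          rw [ENNReal.ofReal_le_one, Real.exp_le_one_iff]
          exact mul_nonpos_of_nonneg_of_nonpos hC0.le (by exact_mod_cast h0)
        · refine le_add_left (le_trans ?_ (ENNReal.le_tsum (N ω).toNat))
          have h1 : ((N ω).toNat : ℤ) = N ω := Int.toNat_of_nonneg h0.le
          have h2 : ((N ω).toNat : ℝ) = N ω := by exact_mod_cast h1
          rw [Set.indicator_of_mem (by simp [h1]), h2]
    _ = 1 + ∑' n : ℕ, ENNReal.ofReal (Real.exp (C * n)) * P {ω | (n : ℤ) ≤ N ω} := by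
        rw [lintegral_add_left measurable_const, lintegral_tsum fun n =>
          (measurable_const.indicator (hmeas n)).aemeasurable]
        simp only [lintegral_indicator_const (hmeas _), lintegral_const, measure_univ, mul_one]
    _ ≤ 1 + ∑' n : ℕ, ENNReal.ofReal (D * Real.exp (-C) ^ n) := by
        gcongr with n
        calc ENNReal.ofReal (Real.exp (C * n)) * P {ω | (n : ℤ) ≤ N ω}
            ≤ ENNReal.ofReal (Real.exp (C * n)) * ENNReal.ofReal (D * ρ ^ n) := by
              gcongr
              exact hf n
          _ = _ := by
              rw [← ENNReal.ofReal_mul (by positivity), hρC, ← Real.exp_nat_mul,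
                ← Real.exp_nat_mul, mul_left_comm, ← Real.exp_add]
              congr 3
              ring
    _ < ⊤ := by
        rw [← ENNReal.ofReal_tsum_of_nonneg (fun n => by positivity)]
        · exact ENNReal.add_lt_top.2 ⟨ENNReal.one_lt_top, ENNReal.ofReal_lt_top⟩
        · refine (summable_geometric_of_lt_one (by positivity) ?_).mul_left D
          rw [Real.exp_lt_one_iff]
          linarith

theorem ExpRecurrent.exists_lintegral_exp_point1 [IsProbabilityMeasure P]
    (hA : ExpRecurrent P A) :
    ∃ C : ℝ, 0 < C ∧ ∫⁻ ω, ENNReal.ofReal (Real.exp (C * point1 (A ω))) ∂P ≠ ⊤ := by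
  refine exists_lintegral_exp_ne_top (measurable_point1 hA.measurableSet) ?_
  have hbi := hA.ae_biInfinite
  obtain ⟨f, hf, hgap⟩ := hA.gap
  -- If `point1 ≥ n`, then `[0, n / 2)` or the next window of the same length misses `A`; otherwise
  -- a point of `A` in each would put the second point below `n`.
  have hf2 : ExpSmall fun n => f (n / 2) := hf.comp (h := fun n => n / 2) (K := 2) (by omega)
  refine (hf2.add hf2).mono fun n => ?_
  refine le_trans ?_ (add_le_add (hgap 0 (n / 2)) (hgap (n / 2 : ℕ) (n / 2)))
  refine le_trans (measure_mono_ae ?_) (measure_union_le _ _)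
  filter_upwards [hbi] with ω hω h1
  change (n : ℤ) ≤ point1 (A ω) at h1
  by_contra hnot
  have h2 : ¬ ((∀ x : ℤ, 0 ≤ x → x < 0 + (n / 2 : ℕ) → x ∉ A ω) ∨
      (∀ x : ℤ, (n / 2 : ℕ) ≤ x → x < (n / 2 : ℕ) + (n / 2 : ℕ) → x ∉ A ω)) := hnot
  push Not at h2
  obtain ⟨⟨x, hx0, hx, hxA⟩, y, hy0, hy, hyA⟩ := h2
  have h3 := point0_le hxA hx0
  have h4 := point1_le hyA (by omega)
  omega

/-- Exponential moments for random sets that contain an exponentially recurrent one. -/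
theorem ExpRecurrent.expMoments [IsProbabilityMeasure P] (hA : ExpRecurrent P A)
    (hB : ∀ x, MeasurableSet {ω | x ∈ B ω}) (hAB : ∀ ω, A ω ⊆ B ω) {C : ℝ} (hC : 0 < C)
    (hint : ∫⁻ ω, ENNReal.ofReal (Real.exp (C * point1 (A ω))) ∂P ≠ ⊤) : ExpMoments P B C := by
  have hcast : Measurable fun z : ℤ => (z : ℝ) := measurable_of_countable _
  have hint' : Integrable (fun ω => Real.exp (C * point1 (A ω))) P := by
    refine ⟨(Real.measurable_exp.comp ((hcast.comp
      (measurable_point1 hA.measurableSet)).const_mul C)).aestronglyMeasurable, ?_⟩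
    rw [hasFiniteIntegral_iff_ofReal (.of_forall fun ω => by positivity)]
    exact hint.lt_top
  -- Both quantities for `B` are dominated by `point1 (A ω)`, so the same `C` serves every superset
  -- of `A`.
  have key : ∀ᵐ ω ∂P, 0 ≤ point0 (B ω) ∧ point0 (B ω) ≤ point1 (B ω) ∧
      point1 (B ω) ≤ point1 (A ω) := by
    filter_upwards [hA.ae_biInfinite] with ω hω
    have h := hω.superset (hAB ω)
    exact ⟨h.point0_mem.2, h.point1_mem.2.le, hω.point1_le_point1 (hAB ω)⟩
  have m0 := hcast.comp (measurable_point0 hB)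
  have m1 := hcast.comp (measurable_point1 hB)
  constructor
  · refine hint'.mono' (Real.measurable_exp.comp (m0.const_mul C)).aestronglyMeasurable ?_
    filter_upwards [key] with ω ⟨h0, h1, h2⟩
    rw [Real.norm_of_nonneg (by positivity)]
    gcongr
    exact h1.trans h2
  · refine hint'.mono' (Real.measurable_exp.comp ((m1.sub m0).const_mul C)).aestronglyMeasurable ?_
    filter_upwards [key] with ω ⟨h0, h1, h2⟩
    rw [Real.norm_of_nonneg (by positivity)]
    gcongr
    have h3 : (0 : ℝ) ≤ point0 (B ω) := by exact_mod_cast h0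
    have h4 : (point1 (B ω) : ℝ) ≤ point1 (A ω) := by exact_mod_cast h2
    linarith

end RandomSets

/-! ### Positive probability of infinite intersections -/

section Positivity

variable {Ω : Type*} [MeasurableSpace Ω] {P : Measure Ω}
  {ν : Measure EReal} {v : ℤ → ℤ → Ω → EReal}

theorem measure_iInter_pos_of_tsum_lt {G : ℕ → Set Ω} {Q : Set Ω}
    (h : ∑' m, P (G m)ᶜ < P Q) : 0 < P (Q ∩ ⋂ m, G m) := by
  by_contra h0
  have h0 : P (Q ∩ ⋂ m, G m) = 0 := by simpa using h0
  refine h.not_ge ?_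
  calc P Q ≤ P ((Q ∩ ⋂ m, G m) ∪ ⋃ m, (G m)ᶜ) := by
        refine measure_mono fun ω hω => ?_
        by_cases hG : ω ∈ ⋂ m, G m
        · exact .inl ⟨hω, hG⟩
        · rw [← Set.compl_iInter]
          exact .inr hG
    _ ≤ _ := (measure_union_le _ _).trans (by rw [h0, zero_add]; exact measure_iUnion_le _)

/-- Infinitely many events that depend on disjoint sets of edges, have positive probability and
summable failure probabilities occur simultaneously with positive probability. -/
theorem IsIIDWeights.measure_iInter_pos [IsProbabilityMeasure P] (hv : IsIIDWeights P ν v) {S : ℕ → Set Edge}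
    (hS : Pairwise fun m n => Disjoint (S m) (S n)) {G : ℕ → Set Conf}
    (hG : ∀ m, MeasurableSet[edgeSigma (S m)] (G m))
    (hpos : ∀ m, 0 < P (config v ⁻¹' G m))
    (hsum : ExpSmall fun m => P (config v ⁻¹' (G m)ᶜ)) :
    0 < P (config v ⁻¹' ⋂ m, G m) := by
  -- The union bound handles the events from `N` on. The finitely many earlier ones are restored one
  -- at a time by independence.
  obtain ⟨N, hN⟩ := hsum.tail one_pos
  have htail : 0 < P (config v ⁻¹' ⋂ k, G (N + k)) := by
    have := measure_iInter_pos_of_tsum_lt (P := P) (Q := Set.univ)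
      (G := fun k => config v ⁻¹' G (N + k)) (by simpa [← Set.preimage_compl] using hN)
    simpa [← Set.preimage_iInter] using this
  have hmeas : ∀ n, MeasurableSet[edgeSigma (⋃ k, S (n + k))] (⋂ k, G (n + k)) := fun n =>
    MeasurableSet.iInter (m := edgeSigma _) fun k =>
      edgeSigma_mono (Set.subset_iUnion (fun k => S (n + k)) k) _ (hG _)
  have key : ∀ n ≤ N, 0 < P (config v ⁻¹' ⋂ k, G (N - n + k)) := by
    intro n
    induction n with
    | zero => simpa using htail
    | succ n ih =>
      intro hn
      have hsplit : ⋂ k, G (N - (n + 1) + k) = G (N - (n + 1)) ∩ ⋂ k, G (N - n + k) := by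
        ext u
        simp only [Set.mem_iInter, Set.mem_inter_iff]
        refine ⟨fun h => ⟨h 0, fun k => ?_⟩, fun h k => ?_⟩
        · have := h (k + 1)
          rwa [show N - (n + 1) + (k + 1) = N - n + k by omega] at this
        · cases k with
          | zero => exact h.1
          | succ k =>
            have := h.2 k
            rwa [show N - n + k = N - (n + 1) + (k + 1) by omega] at this
      rw [hsplit, Set.preimage_inter, hv.measure_inter ?_ (hG _) (hmeas _)]
      · exact ENNReal.mul_pos (hpos _).ne' (ih (by omega)).ne'
      · rw [Set.disjoint_iUnion_right]
        exact fun k => hS (by omega)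
  simpa using key N le_rfl

end Positivity

/-! ### Exponential recurrence of skeleton-plus vertices -/

section

variable {Ω : Type*} [MeasurableSpace Ω] {P : Measure Ω} [IsProbabilityMeasure P]
  {ν : Measure EReal} {v : ℤ → ℤ → Ω → EReal}

theorem IsIIDWeights.isProbabilityMeasure (hv : IsIIDWeights P ν v) : IsProbabilityMeasure ν := by
  rw [← hv.law 0 1 one_pos]
  exact Measure.isProbabilityMeasure_map (hv.measurable 0 1 one_pos).aemeasurable

omit [IsProbabilityMeasure P] in
theorem IsIIDWeights.measure_edge (hv : IsIIDWeights P ν v) {j k : ℤ} (h : j < k) {B : Set EReal}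
    (hB : MeasurableSet B) : P {ω | config v ω j k ∈ B} = ν B := by
  rw [← hv.law j k h, Measure.map_apply (hv.measurable j k h) hB]
  rfl

omit [IsProbabilityMeasure P] in
theorem IsIIDWeights.measure_edges (hv : IsIIDWeights P ν v) {ι : Type*} [Fintype ι]
    {e : ι → Edge} (he : Function.Injective e) {B : ι → Set EReal}
    (hB : ∀ i, MeasurableSet (B i)) :
    P {ω | ∀ i, config v ω (e i).1.1 (e i).1.2 ∈ B i} = ∏ i, ν (B i) := by
  have h := (hv.indep.precomp he).measure_inter_preimage_eq_mul Finset.univ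
    (sets := B) (fun i _ => hB i)
  refine Eq.trans (congrArg P ?_) (h.trans (Finset.prod_congr rfl fun i _ => ?_))
  · ext ω
    simp [config]
  · exact hv.measure_edge (e i).2 (hB i)

theorem IsIIDWeights.measure_nonpos_lt_one (hv : IsIIDWeights P ν v) (hν : 0 < ν (Set.Ioi 0)) :
    ν (Set.Iic 0) < 1 := by
  have := hv.isProbabilityMeasure
  rw [← Set.compl_Ioi, prob_compl_eq_one_sub measurableSet_Ioi]
  exact ENNReal.sub_lt_self ENNReal.one_ne_top one_ne_zero hν.ne'

theorem expSmall_pow {q : ENNReal} (hq : q < 1) : ExpSmall fun n => q ^ n := by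
  have hq' : q.toReal < 1 := by
    rw [← ENNReal.toReal_one]
    exact (ENNReal.toReal_lt_toReal (hq.trans ENNReal.one_lt_top).ne ENNReal.one_ne_top).2 hq
  refine ⟨1, (q.toReal + 1) / 2, one_pos, by positivity, by linarith, fun n => ?_⟩
  rw [one_mul, ENNReal.ofReal_pow (by positivity)]
  refine pow_le_pow_left' ?_ n
  rw [ENNReal.le_ofReal_iff_toReal_le (hq.trans ENNReal.one_lt_top).ne (by positivity)]
  linarith

/-- The vertices `m` and `-m` are attached to the vertex `0` by positive edges. -/
def attached (m : ℕ) : Set Conf :=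
  {u | 0 < m → (∃ j : ℤ, 0 ≤ j ∧ j < m ∧ 0 < u j m) ∧ ∃ k : ℤ, -m < k ∧ k ≤ 0 ∧ 0 < u (-m) k}

/-- The edges on which `attached m` depends. -/
def attachedEdges (m : ℕ) : Set Edge :=
  {e | (0 ≤ e.1.1 ∧ e.1.2 = m) ∨ (e.1.1 = -m ∧ e.1.2 ≤ 0)}

theorem attachedEdges_disjoint : Pairwise fun m n => Disjoint (attachedEdges m) (attachedEdges n) := by
  intro m n hmn
  rw [Set.disjoint_left]
  intro e h1 h2
  have := e.2
  simp only [attachedEdges, Set.mem_ofPred_eq] at h1 h2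
  omega

theorem measurableSet_attached (m : ℕ) :
    MeasurableSet[edgeSigma (attachedEdges m)] (attached m) := by
  refine measurableSet_forall (m := edgeSigma (attachedEdges m)) fun hm => measurableSet_and
    (measurableSet_exists fun j => measurableSet_prop_and fun hj => measurableSet_prop_and
      fun hjm => measurableSet_pos hjm (.inl ⟨hj, rfl⟩))
    (measurableSet_exists fun k => measurableSet_prop_and fun hk => measurableSet_prop_and
      fun hk0 => measurableSet_pos hk (.inr ⟨rfl, hk0⟩))

theorem attachedEdges_subset (m : ℕ) : attachedEdges m ⊆ box (-m) m := by
  intro e he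
  have := e.2
  simp only [attachedEdges, box, Set.mem_ofPred_eq] at he ⊢
  omega

/-- Splits the skeleton-plus property of `0` into events on the pairwise disjoint sets
`attachedEdges m`. Scale `m = 0` is vacuous. -/
theorem mem_iInter_attached {u : Conf} : u ∈ ⋂ m, attached m ↔ Sink u 0 ∧ Source u 0 := by
  simp only [Set.mem_iInter, attached, Set.mem_ofPred_eq]
  constructor
  · refine fun h => ⟨fun j hj => ?_, fun k hk => ?_⟩
    · obtain ⟨m, rfl⟩ : ∃ m : ℕ, j = -m := ⟨(-j).toNat, by omega⟩
      exact (h m (by omega)).2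
    · obtain ⟨m, rfl⟩ : ∃ m : ℕ, k = m := ⟨k.toNat, by omega⟩
      exact (h m (by omega)).1
  · exact fun h m hm => ⟨h.2 m (by omega), h.1 (-m) (by omega)⟩

theorem sink_shift {u : Conf} {x y : ℤ} : Sink (shift x u) y ↔ Sink u (x + y) := by
  constructor
  · intro h j hj
    obtain ⟨k, h1, h2, h3⟩ := h (j - x) (by omega)
    exact ⟨x + k, by omega, by omega, by simpa [shift] using h3⟩
  · intro h j hj
    obtain ⟨k, h1, h2, h3⟩ := h (x + j) (by omega)
    exact ⟨k - x, by omega, by omega, by simpa [shift] using h3⟩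

theorem source_shift {u : Conf} {x y : ℤ} : Source (shift x u) y ↔ Source u (x + y) := by
  constructor
  · intro h j hj
    obtain ⟨k, h1, h2, h3⟩ := h (j - x) (by omega)
    exact ⟨x + k, by omega, by omega, by simpa [shift] using h3⟩
  · intro h j hj
    obtain ⟨k, h1, h2, h3⟩ := h (x + j) (by omega)
    exact ⟨k - x, by omega, by omega, by simpa [shift] using h3⟩

theorem shift_mem_iInter_attached {u : Conf} {x : ℤ} :
    shift x u ∈ ⋂ m, attached m ↔ x ∈ skeletonPlus u := by
  rw [mem_iInter_attached, sink_shift, source_shift, add_zero, mem_skeletonPlus_iff]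

/-- Failure at `m` requires all `m` edges into `m` from `[0, m)`, or all `m` edges from `-m` into
`(-m, 0]`, to be non-positive. -/
theorem IsIIDWeights.expSmall_attached_compl (hv : IsIIDWeights P ν v)
    (hν : 0 < ν (Set.Ioi 0)) : ExpSmall fun m => P (config v ⁻¹' (attached m)ᶜ) := by
  have hpow := expSmall_pow (hv.measure_nonpos_lt_one hν)
  refine (hpow.add hpow).mono fun m => ?_
  have h1 : P {ω | ∀ i : Fin m, config v ω i m ∈ Set.Iic 0} = ν (Set.Iic 0) ^ m := by
    have := hv.measure_edges (ι := Fin m) (e := fun i => ⟨(i, m), by simp⟩)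
      (fun i j h => by simpa [Fin.ext_iff] using h) (B := fun _ => Set.Iic 0)
      fun _ => measurableSet_Iic
    simpa using this
  have h2 : P {ω | ∀ i : Fin m, config v ω (-m) (-i) ∈ Set.Iic 0} = ν (Set.Iic 0) ^ m := by
    have := hv.measure_edges (ι := Fin m) (e := fun i => ⟨(-m, -i), by simp⟩)
      (fun i j h => by simpa [Fin.ext_iff] using h) (B := fun _ => Set.Iic 0)
      fun _ => measurableSet_Iic
    simpa using this
  refine (measure_mono fun ω hω => ?_).trans ((measure_union_le _ _).trans
    (add_le_add h1.le h2.le))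
  by_contra hnot
  refine hω fun hm => ?_
  simp only [Set.mem_union, Set.mem_ofPred_eq, Set.mem_Iic, not_or, not_forall, not_le] at hnot
  obtain ⟨⟨i, hi⟩, j, hj⟩ := hnot
  exact ⟨⟨i, by omega, by omega, hi⟩, -j, by omega, by omega, hj⟩

theorem IsIIDWeights.measure_attached_pos (hv : IsIIDWeights P ν v)
    (hν : 0 < ν (Set.Ioi 0)) (m : ℕ) : 0 < P (config v ⁻¹' attached m) := by
  rcases Nat.eq_zero_or_pos m with rfl | hm
  · simp [attached]
  have h : P {ω | ∀ i : Bool, config v ω (if i then m - 1 else -m) (if i then m else -m + 1) ∈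
      Set.Ioi 0} = ν (Set.Ioi 0) ^ 2 := by
    have := hv.measure_edges (ι := Bool)
      (e := fun i => ⟨(if i then m - 1 else -m, if i then m else -m + 1), by cases i <;> simp⟩)
      (fun i j h => by
        cases i <;> cases j <;> simp at h ⊢ <;> omega) (B := fun _ => Set.Ioi 0)
      fun _ => measurableSet_Ioi
    simpa using this
  refine lt_of_lt_of_le (h ▸ ENNReal.pow_pos hν 2) (measure_mono fun ω hω _ => ?_)
  have h1 := hω true
  have h2 := hω false
  simp only [if_true, Set.mem_Ioi, Bool.false_eq_true, if_false] at h1 h2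
  exact ⟨⟨m - 1, by omega, by omega, h1⟩, -m + 1, by omega, by omega, h2⟩

theorem IsIIDWeights.measure_iInter_attached_pos (hv : IsIIDWeights P ν v)
    (hν : 0 < ν (Set.Ioi 0)) : 0 < P (config v ⁻¹' ⋂ m, attached m) :=
  hv.measure_iInter_pos attachedEdges_disjoint measurableSet_attached
    (hv.measure_attached_pos hν) (hv.expSmall_attached_compl hν)

theorem IsIIDWeights.measure_source_pos (hv : IsIIDWeights P ν v)
    (hν : 0 < ν (Set.Ioi 0)) : 0 < P (config v ⁻¹' {u | Source u 0}) :=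
  (hv.measure_iInter_attached_pos hν).trans_le
    (measure_mono fun _ hω => (mem_iInter_attached.1 hω).2)

theorem measurableSet_skeletonPlus (x : ℤ) :
    MeasurableSet[edgeSigma Set.univ] {u : Conf | x ∈ skeletonPlus u} := by
  simp only [mem_skeletonPlus_iff]
  exact measurableSet_and (m := edgeSigma Set.univ)
    (measurableSet_univ_of (measurableSet_sink x)) (measurableSet_univ_of (measurableSet_source x))

theorem IsIIDWeights.expRecurrent_skeletonPlus (hv : IsIIDWeights P ν v)
    (hν : 0 < ν (Set.Ioi 0)) : ExpRecurrent P fun ω => skeletonPlus (config v ω) := by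
  refine ⟨fun x => hv.measurableSet_config (measurableSet_skeletonPlus x), ?_⟩
  obtain ⟨f, hf, h⟩ := hv.expSmall_of_local
    (fun m => edgeSigma_mono (attachedEdges_subset m) _ (measurableSet_attached m))
    (hv.expSmall_attached_compl hν) (hv.measure_iInter_attached_pos hν)
  refine ⟨f, hf, fun a n => ?_⟩
  simpa only [shift_mem_iInter_attached] using h a n

end

/-! ### Cycles of the skeleton and factorisation of their law -/

/-- `[x, y]` is a cycle: its end points are joined to all its vertices, and no inner vertex is. -/
def Cycle (u : Conf) (x y : ℤ) : Prop :=
  SourceOn u x y ∧ SinkOn u x y ∧ ∀ z, x < z → z < y → ¬ (SinkOn u x z ∧ SourceOn u z y)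

/-- The part of the event that `x` is the first non-negative skeleton-plus vertex that depends on
the edges to the left of `x`. -/
def FirstLeft (u : Conf) (x : ℤ) : Prop :=
  Sink u x ∧ ∀ z, 0 ≤ z → z < x → ¬ (Sink u z ∧ SourceOn u z x)

theorem Source.of_sourceOn {u : Conf} {x y : ℤ} (h : SourceOn u x y) (hy : Source u y)
    (hxy : x ≤ y) : Source u x := by
  intro k hk
  rcases le_or_gt k y with hky | hky
  · exact h k hk hky
  · obtain ⟨j, hj, hjk, hu⟩ := hy k hky
    exact ⟨j, hxy.trans hj, hjk, hu⟩

theorem Sink.of_sinkOn {u : Conf} {x y : ℤ} (h : SinkOn u x y) (hx : Sink u x)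
    (hxy : x ≤ y) : Sink u y := by
  intro j hj
  rcases le_or_gt x j with hxj | hxj
  · exact h j hxj hj
  · obtain ⟨k, hk, hkx, hu⟩ := hx j hxj
    exact ⟨k, hk, hkx.trans hxy, hu⟩

theorem point0_skeletonPlus_eq_iff {u : Conf} (hu : BiInfinite (skeletonPlus u)) {x : ℤ}
    (hx : 0 ≤ x) : point0 (skeletonPlus u) = x ↔ FirstLeft u x ∧ Source u x := by
  simp only [point0_eq_iff hu, mem_skeletonPlus_iff]
  constructor
  · rintro ⟨⟨h1, h2⟩, -, h3⟩
    exact ⟨⟨h1, fun z hz hzx h => h3 z hz hzx ⟨h.1, .of_sourceOn h.2 h2 hzx.le⟩⟩, h2⟩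
  · rintro ⟨⟨h1, h3⟩, h2⟩
    exact ⟨⟨h1, h2⟩, hx, fun z hz hzx h => h3 z hz hzx ⟨h.1, h.2.sourceOn x⟩⟩

/-- Once `x` and `y` are skeleton-plus, whether a vertex between them is skeleton-plus is decided by
the edges in `[x, y]`. The three conditions therefore depend on the edges left of `x`, inside `[x,
y]` and right of `y`, and are independent. -/
theorem point_skeletonPlus_eq_iff {u : Conf} (hu : BiInfinite (skeletonPlus u)) {x y : ℤ}
    (hx : 0 ≤ x) (hxy : x < y) :
    (point0 (skeletonPlus u) = x ∧ point1 (skeletonPlus u) = y) ↔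
      FirstLeft u x ∧ Cycle u x y ∧ Source u y := by
  constructor
  · rintro ⟨h0, h1⟩
    have h2 := (point1_eq_iff hu).1 h1
    rw [h0] at h2
    simp only [mem_skeletonPlus_iff] at h2
    obtain ⟨hfx, hsx⟩ := (point0_skeletonPlus_eq_iff hu hx).1 h0
    obtain ⟨⟨h3, h4⟩, -, h5⟩ := h2
    refine ⟨hfx, ⟨hsx.sourceOn y, h3.sinkOn x, fun z hz hzy h => h5 z hz hzy
      ⟨.of_sinkOn h.1 hfx.1 hz.le, .of_sourceOn h.2 h4 hzy.le⟩⟩, h4⟩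
  · rintro ⟨h1, ⟨h2, h3, h4⟩, h5⟩
    have h0 := (point0_skeletonPlus_eq_iff hu hx).2 ⟨h1, .of_sourceOn h2 h5 hxy.le⟩
    refine ⟨h0, (point1_eq_iff hu).2 ?_⟩
    rw [h0]
    simp only [mem_skeletonPlus_iff]
    exact ⟨⟨.of_sinkOn h3 h1.1 hxy.le, h5⟩, hxy, fun z hz hzy h => h4 z hz hzy
      ⟨h.1.sinkOn x, h.2.sourceOn y⟩⟩

theorem measurableSet_cycle (x y : ℤ) :
    MeasurableSet[edgeSigma (box x y)] {u : Conf | Cycle u x y} := by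
  refine measurableSet_and (m := edgeSigma (box x y)) (measurableSet_sourceOn x y)
    (measurableSet_and (measurableSet_sinkOn x y) (measurableSet_forall fun z =>
      measurableSet_forall fun hz => measurableSet_forall fun hzy => measurableSet_not
        (measurableSet_and ?_ ?_)))
  · exact edgeSigma_mono (box_subset le_rfl hzy.le) _ (measurableSet_sinkOn x z)
  · exact edgeSigma_mono (box_subset hz.le le_rfl) _ (measurableSet_sourceOn z y)

theorem below_mono {a b : ℤ} (h : a ≤ b) : below a ⊆ below b := fun _ he => le_trans he h

theorem above_anti {a b : ℤ} (h : a ≤ b) : above b ⊆ above a := fun _ he => le_trans h he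

theorem measurableSet_firstLeft (x : ℤ) :
    MeasurableSet[edgeSigma (below x)] {u : Conf | FirstLeft u x} := by
  refine measurableSet_and (m := edgeSigma (below x)) (measurableSet_sink x)
    (measurableSet_forall fun z => measurableSet_forall fun hz => measurableSet_forall fun hzx =>
      measurableSet_not (measurableSet_and ?_ ?_))
  · exact edgeSigma_mono (below_mono hzx.le) _ (measurableSet_sink z)
  · exact edgeSigma_mono (box_subset_below z x) _ (measurableSet_sourceOn z x)

theorem sourceOn_shift {u : Conf} {x a b : ℤ} :
    SourceOn (shift x u) a b ↔ SourceOn u (x + a) (x + b) := by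
  constructor
  · intro h k hk hkb
    obtain ⟨j, h1, h2, h3⟩ := h (k - x) (by omega) (by omega)
    exact ⟨x + j, by omega, by omega, by simpa [shift] using h3⟩
  · intro h k hk hkb
    obtain ⟨j, h1, h2, h3⟩ := h (x + k) (by omega) (by omega)
    exact ⟨j - x, by omega, by omega, by simpa [shift] using h3⟩

theorem sinkOn_shift {u : Conf} {x a b : ℤ} :
    SinkOn (shift x u) a b ↔ SinkOn u (x + a) (x + b) := by
  constructor
  · intro h j hj hjb
    obtain ⟨k, h1, h2, h3⟩ := h (j - x) (by omega) (by omega)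
    exact ⟨x + k, by omega, by omega, by simpa [shift] using h3⟩
  · intro h j hj hjb
    obtain ⟨k, h1, h2, h3⟩ := h (x + j) (by omega) (by omega)
    exact ⟨k - x, by omega, by omega, by simpa [shift] using h3⟩

theorem cycle_shift {u : Conf} {x a b : ℤ} :
    Cycle (shift x u) a b ↔ Cycle u (x + a) (x + b) := by
  simp only [Cycle, sourceOn_shift, sinkOn_shift]
  refine and_congr_right fun _ => and_congr_right fun _ => ⟨fun h z hz hzb => ?_, fun h z hz hzb =>
    h (x + z) (by omega) (by omega)⟩
  have := h (z - x) (by omega) (by omega)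
  rwa [add_sub_cancel] at this

theorem minPosWeight_shift (u : Conf) (x a b : ℤ) :
    minPosWeight (shift x u) a b = minPosWeight u (x + a) (x + b) := by
  rw [minPosWeight, minPosWeight]
  congr 1
  ext r
  refine and_congr_right fun _ => ⟨?_, ?_⟩
  · rintro ⟨i, j, h1, h2, h3, h4⟩
    exact ⟨x + i, x + j, by omega, by omega, by omega, h4⟩
  · rintro ⟨i, j, h1, h2, h3, h4⟩
    exact ⟨i - x, j - x, by omega, by omega, by omega, by simpa [shift] using h4⟩

/-- The exponential weight `exp (-θ M)` of a cycle with smallest positive weight `M`. -/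
noncomputable def cycleWeight (θ : ℝ) (x y : ℤ) : Conf → ENNReal :=
  {u | Cycle u x y}.indicator fun u => ENNReal.ofReal (Real.exp (-θ * minPosWeight u x y))

theorem measurable_cycleWeight (θ : ℝ) (x y : ℤ) :
    Measurable[edgeSigma (box x y)] (cycleWeight θ x y) := by
  refine Measurable.indicator (m := edgeSigma (box x y)) ?_ (measurableSet_cycle x y)
  exact ENNReal.measurable_ofReal.comp (Real.measurable_exp.comp
    ((measurable_minPosWeight x y).const_mul _))

theorem cycleWeight_shift (θ : ℝ) (x a b : ℤ) (u : Conf) :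
    cycleWeight θ a b (shift x u) = cycleWeight θ (x + a) (x + b) u := by
  by_cases h : Cycle u (x + a) (x + b) <;>
    simp [cycleWeight, cycle_shift, minPosWeight_shift, h]

theorem measurable_of_sub {S T : Set Edge} {β : Type*} [MeasurableSpace β] {f : Conf → β}
    (hf : Measurable[edgeSigma S] f) (h : S ⊆ T) : Measurable[edgeSigma T] f :=
  fun _ hA => edgeSigma_mono h _ (hf hA)

section Measure

variable {Ω : Type*} [MeasurableSpace Ω] {P : Measure Ω} [IsProbabilityMeasure P]
  {ν : Measure EReal} {v : ℤ → ℤ → Ω → EReal}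

omit [IsProbabilityMeasure P] in
theorem IsIIDWeights.lintegral_indicator (hv : IsIIDWeights P ν v) {S : Set Edge}
    {A : Set Conf} (hA : MeasurableSet[edgeSigma S] A) :
    ∫⁻ ω, A.indicator 1 (config v ω) ∂P = P (config v ⁻¹' A) := by
  rw [← MeasureTheory.lintegral_indicator_one (hv.measurableSet_config hA)]
  rfl

theorem IsIIDWeights.measure_source (hv : IsIIDWeights P ν v) (x : ℤ) :
    P (config v ⁻¹' {u | Source u x}) = P (config v ⁻¹' {u | Source u 0}) := by
  rw [← hv.measure_shift x (measurableSet_univ_of (measurableSet_source 0))]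
  congr 1
  ext ω
  simp [source_shift]

theorem IsIIDWeights.lintegral_cycleWeight (hv : IsIIDWeights P ν v) (θ : ℝ) (x y : ℤ) :
    ∫⁻ ω, cycleWeight θ x (x + y) (config v ω) ∂P = ∫⁻ ω, cycleWeight θ 0 y (config v ω) ∂P := by
  rw [← hv.lintegral_shift x (measurable_of_sub (measurable_cycleWeight θ 0 y)
    (Set.subset_univ _))]
  simp only [cycleWeight_shift, add_zero]

/-- The exponential weights of cycles are bounded by the moment generating function of the first
complete cycle on the non-negative half-line. -/
theorem IsIIDWeights.tsum_cycleWeight_le (hv : IsIIDWeights P ν v) (hν : 0 < ν (Set.Ioi 0))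
    (θ c : ℝ) :
    ∑' y : ℕ, (∫⁻ ω, cycleWeight θ 0 (y + 1) (config v ω) ∂P) *
        ENNReal.ofReal (Real.exp (θ * (c * (y + 1)))) ≤
      ∫⁻ ω, ENNReal.ofReal (Real.exp (θ *
        (c * (point1 (skeletonPlus (config v ω)) - point0 (skeletonPlus (config v ω)) : ℤ) -
          minPosWeight (config v ω) (point0 (skeletonPlus (config v ω)))
            (point1 (skeletonPlus (config v ω)))))) ∂P := by
  set a : ℕ → ENNReal := fun y => (∫⁻ ω, cycleWeight θ 0 (y + 1) (config v ω) ∂P) *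
        ENNReal.ofReal (Real.exp (θ * (c * (y + 1)))) with ha
  set α := P (config v ⁻¹' {u | Source u 0}) with hα
  set F : ℤ → Conf → ENNReal := fun x => {u | FirstLeft u x}.indicator 1 with hF
  set S : ℤ → Conf → ENNReal := fun x => {u | Source u x}.indicator 1 with hS
  have hFm : ∀ x, Measurable[edgeSigma (below x)] (F x) := fun x =>
    Measurable.indicator (m := edgeSigma (below x)) measurable_const (measurableSet_firstLeft x)
  have hSm : ∀ x, Measurable[edgeSigma (above x)] (S x) := fun x =>
    Measurable.indicator (m := edgeSigma (above x)) measurable_const (measurableSet_source x)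
  have hF1 : ∀ x u, F x u ≤ 1 := fun x u => Set.indicator_le_self' (fun _ _ => zero_le) u
  have hS1 : ∀ x u, S x u ≤ 1 := fun x u => Set.indicator_le_self' (fun _ _ => zero_le) u
  have hSα : ∀ x, ∫⁻ ω, S x (config v ω) ∂P = α := fun x => by
    rw [hv.lintegral_indicator (measurableSet_source x), hv.measure_source]
  have hbi := (hv.expRecurrent_skeletonPlus hν).ae_biInfinite
  -- Almost surely a first non-negative skeleton-plus vertex exists, and the conditions on its two
  -- sides are independent.
  have hone : 1 ≤ ∑' x : ℕ, (∫⁻ ω, F x (config v ω) ∂P) * α := by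
    calc (1 : ENNReal) = P Set.univ := measure_univ.symm
      _ ≤ P (⋃ x : ℕ, config v ⁻¹' {u | FirstLeft u x} ∩ config v ⁻¹' {u | Source u x}) := by
          refine measure_mono_ae ?_
          filter_upwards [hbi] with ω hω _
          have h0 := hω.point0_mem.2
          refine Set.mem_iUnion.2 ⟨(point0 (skeletonPlus (config v ω))).toNat, ?_⟩
          rw [Int.toNat_of_nonneg h0]
          exact (point0_skeletonPlus_eq_iff hω h0).1 rfl
      _ ≤ ∑' x : ℕ, P (config v ⁻¹' {u | FirstLeft u x} ∩ config v ⁻¹' {u | Source u x}) :=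
          measure_iUnion_le _
      _ = _ := by
          refine tsum_congr fun x => ?_
          rw [hv.measure_inter (disjoint_below_above le_rfl) (measurableSet_firstLeft x)
            (measurableSet_source x), hv.measure_source,
            hv.lintegral_indicator (measurableSet_firstLeft x)]
  have hprod : ∀ x y : ℕ, (∫⁻ ω, F x (config v ω) * (cycleWeight θ x (x + (y + 1)) (config v ω) *
      S (x + (y + 1)) (config v ω)) ∂P) * ENNReal.ofReal (Real.exp (θ * (c * (y + 1)))) =
      (∫⁻ ω, F x (config v ω) ∂P) * α * a y := by
    intro x y
    have hxy : (x : ℤ) ≤ x + (y + 1) := by omega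
    rw [hv.lintegral_mul (disjoint_below_above le_rfl) (hFm x)
      (g := fun u => cycleWeight θ x (x + (y + 1)) u * S (x + (y + 1)) u)
      (Measurable.mul (m := edgeSigma (above x))
        (measurable_of_sub (measurable_cycleWeight θ _ _) (box_subset_above _ _))
        (measurable_of_sub (hSm _) (above_anti hxy))),
      hv.lintegral_mul (disjoint_below_above le_rfl)
        (measurable_of_sub (measurable_cycleWeight θ _ _) (box_subset_below _ _)) (hSm _),
      hSα, hv.lintegral_cycleWeight]
    simp only [ha]
    ring
  calc ∑' y, a y ≤ (∑' x : ℕ, (∫⁻ ω, F x (config v ω) ∂P) * α) * ∑' y, a y :=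
        le_mul_of_one_le_left' hone
    _ = ∑' p : ℕ × ℕ, ∫⁻ ω, F p.1 (config v ω) * (cycleWeight θ p.1 (p.1 + (p.2 + 1)) (config v ω) *
          S (p.1 + (p.2 + 1)) (config v ω)) *
            ENNReal.ofReal (Real.exp (θ * (c * (p.2 + 1)))) ∂P := by
        simp only [lintegral_mul_const' _ _ ENNReal.ofReal_ne_top, hprod]
        rw [ENNReal.tsum_prod (f := fun x y : ℕ => (∫⁻ ω, F x (config v ω) ∂P) * α * a y)]
        simp only [ENNReal.tsum_mul_left, ENNReal.tsum_mul_right]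
    _ = ∫⁻ ω, ∑' p : ℕ × ℕ, F p.1 (config v ω) *
          (cycleWeight θ p.1 (p.1 + (p.2 + 1)) (config v ω) *
          S (p.1 + (p.2 + 1)) (config v ω)) *
            ENNReal.ofReal (Real.exp (θ * (c * (p.2 + 1)))) ∂P := by
        rw [lintegral_tsum]
        intro p
        have hc := hv.measurable_config Set.univ
        have h1 : Measurable fun ω => F p.1 (config v ω) :=
          (measurable_of_sub (hFm p.1) (Set.subset_univ _)).comp hc
        have h2 : Measurable fun ω => cycleWeight θ p.1 (p.1 + (p.2 + 1)) (config v ω) :=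
          (measurable_of_sub (measurable_cycleWeight θ _ _) (Set.subset_univ _)).comp hc
        have h3 : Measurable fun ω => S (p.1 + (p.2 + 1)) (config v ω) :=
          (measurable_of_sub (hSm _) (Set.subset_univ _)).comp hc
        exact ((h1.mul (h2.mul h3)).mul_const _).aemeasurable
    _ ≤ _ := by
        refine lintegral_mono_ae ?_
        filter_upwards [hbi] with ω hω
        have h0 := hω.point0_mem.2
        have h1 := hω.point1_mem.2
        have hval : ∀ p : ℕ × ℕ, F p.1 (config v ω) *
            (cycleWeight θ p.1 (p.1 + (p.2 + 1)) (config v ω) *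
            S (p.1 + (p.2 + 1)) (config v ω)) ≠ 0 →
            point0 (skeletonPlus (config v ω)) = p.1 ∧
              point1 (skeletonPlus (config v ω)) = p.1 + (p.2 + 1) := by
          intro p hp
          rw [point_skeletonPlus_eq_iff hω (by omega) (by omega)]
          by_contra hnot
          refine hp ?_
          by_cases hA : FirstLeft (config v ω) p.1
          · by_cases hB : Cycle (config v ω) p.1 (p.1 + (p.2 + 1))
            · have hC : ¬ Source (config v ω) (p.1 + (p.2 + 1)) := fun hC => hnot ⟨hA, hB, hC⟩
              simp [hS, hC]
            · simp [cycleWeight, hB]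
          · simp [hF, hA]
        -- Only the pair given by `t₀⁺` and `t₁⁺ - t₀⁺ - 1` contributes; the lengths are indexed as
        -- `y + 1` because cycles are non-trivial.
        rw [tsum_eq_single ((point0 (skeletonPlus (config v ω))).toNat,
          (point1 (skeletonPlus (config v ω)) - point0 (skeletonPlus (config v ω)) - 1).toNat)]
        · set p : ℕ × ℕ := ((point0 (skeletonPlus (config v ω))).toNat,
            (point1 (skeletonPlus (config v ω)) - point0 (skeletonPlus (config v ω)) - 1).toNat)
            with hp
          by_cases hz : F p.1 (config v ω) *
            (cycleWeight θ p.1 (p.1 + (p.2 + 1)) (config v ω) *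
            S (p.1 + (p.2 + 1)) (config v ω)) = 0
          · rw [hz, zero_mul]
            exact zero_le
          · obtain ⟨e0, e1⟩ := hval p hz
            rw [e0, e1]
            have hle : F p.1 (config v ω) *
                (cycleWeight θ p.1 (p.1 + (p.2 + 1)) (config v ω) *
                  S (p.1 + (p.2 + 1)) (config v ω)) ≤
                ENNReal.ofReal (Real.exp (-θ * minPosWeight (config v ω) p.1
                  (p.1 + (p.2 + 1)))) := by
              refine (mul_le_of_le_one_left' (hF1 _ _)).trans
                ((mul_le_of_le_one_right' (hS1 _ _)).trans ?_)
              exact Set.indicator_le_self' (fun _ _ => zero_le) _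
            refine (mul_le_mul_left hle _).trans (le_of_eq ?_)
            rw [← ENNReal.ofReal_mul (by positivity), ← Real.exp_add]
            congr 2
            push_cast
            ring
        · intro p hp
          by_contra hne
          obtain ⟨e0, e1⟩ := hval p fun h => hne (by rw [h, zero_mul])
          refine hp (Prod.ext ?_ ?_)
          · simp [e0]
          · simp only [e0, e1]
            omega

end Measure

/-! ### Moment generating functions near zero -/

/-- A bound uniform in `θ`, for dominated convergence of the difference quotients. For `x ≤ 0` the
term `|x|` is enough; for `x > 0` half of the exponent `C` pays for the factor `x`. -/
theorem abs_inv_mul_exp_sub_one_le {θ C x : ℝ} (hθ : 0 < θ) (hθC : θ ≤ C / 2) :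
    |θ⁻¹ * (Real.exp (θ * x) - 1)| ≤ |x| + 2 / C * Real.exp (C * x) := by
  have hC : 0 < C := by linarith
  rw [abs_mul, abs_of_pos (inv_pos.2 hθ), inv_mul_le_iff₀ hθ]
  rcases le_or_gt x 0 with hx | hx
  · have h1 : Real.exp (θ * x) ≤ 1 := Real.exp_le_one_iff.2 (mul_nonpos_of_nonneg_of_nonpos hθ.le hx)
    have h2 := Real.add_one_le_exp (θ * x)
    rw [abs_of_nonpos (by linarith), abs_of_nonpos hx]
    have h3 : 0 ≤ θ * (2 / C * Real.exp (C * x)) := by positivity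
    nlinarith
  · have h1 : 1 ≤ Real.exp (θ * x) := Real.one_le_exp (by positivity)
    have h2 : Real.exp (θ * x) - 1 ≤ θ * x * Real.exp (θ * x) := by
      have := Real.add_one_le_exp (-(θ * x))
      rw [Real.exp_neg] at this
      have h3 := mul_le_mul_of_nonneg_right this (Real.exp_pos (θ * x)).le
      rw [inv_mul_cancel₀ (Real.exp_pos _).ne'] at h3
      linarith
    have h3 : Real.exp (θ * x) ≤ Real.exp (C / 2 * x) := by gcongr
    have h4 : x ≤ 2 / C * Real.exp (C / 2 * x) := by
      have := Real.add_one_le_exp (C / 2 * x)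
      have h5 : C / 2 * x ≤ Real.exp (C / 2 * x) := by linarith
      calc x = 2 / C * (C / 2 * x) := by field_simp
        _ ≤ _ := by gcongr
    have h5 : x * Real.exp (θ * x) ≤ 2 / C * Real.exp (C * x) := by
      calc x * Real.exp (θ * x) ≤ (2 / C * Real.exp (C / 2 * x)) * Real.exp (C / 2 * x) := by gcongr
        _ = _ := by rw [mul_assoc, ← Real.exp_add]; ring_nf
    rw [abs_of_nonneg (by linarith), abs_of_pos hx]
    nlinarith

/-- A random variable with negative mean that is bounded above by one with an exponential moment
has a moment generating function that does not exceed one at some positive argument. -/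
theorem exists_lintegral_exp_le_one {Ω : Type*} [MeasurableSpace Ω] {P : Measure Ω}
    [IsProbabilityMeasure P] {X T : Ω → ℝ} (hX : Integrable X P) (hX0 : ∫ ω, X ω ∂P < 0)
    (hXT : ∀ᵐ ω ∂P, X ω ≤ T ω) {C : ℝ} (hC : 0 < C)
    (hT : Integrable (fun ω => Real.exp (C * T ω)) P) :
    ∃ θ : ℝ, 0 < θ ∧ ∫⁻ ω, ENNReal.ofReal (Real.exp (θ * X ω)) ∂P ≤ 1 := by
  set F : ℝ → Ω → ℝ := fun θ ω => θ⁻¹ * (Real.exp (θ * X ω) - 1) with hF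
  have hmeas : ∀ θ, AEStronglyMeasurable (F θ) P := fun θ =>
    (((Real.measurable_exp.comp_aemeasurable (hX.1.aemeasurable.const_mul θ)).sub_const
      1).const_mul θ⁻¹).aestronglyMeasurable
  have hbint : Integrable (fun ω => |X ω| + 2 / C * Real.exp (C * T ω)) P :=
    hX.abs.add (hT.const_mul _)
  have hbound : ∀ θ ∈ Set.Ioc 0 (C / 2), ∀ᵐ ω ∂P,
      ‖F θ ω‖ ≤ |X ω| + 2 / C * Real.exp (C * T ω) := by
    intro θ hθ
    filter_upwards [hXT] with ω hω
    refine (abs_inv_mul_exp_sub_one_le hθ.1 hθ.2).trans ?_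
    gcongr
  have hmem : Set.Ioc 0 (C / 2) ∈ nhdsWithin (0 : ℝ) (Set.Ioi 0) :=
    Ioc_mem_nhdsGT (by positivity)
  have htend : Filter.Tendsto (fun θ => ∫ ω, F θ ω ∂P) (nhdsWithin 0 (Set.Ioi 0))
      (nhds (∫ ω, X ω ∂P)) := by
    refine tendsto_integral_filter_of_dominated_convergence _ (.of_forall hmeas)
      (Filter.mem_of_superset hmem hbound) hbint (.of_forall fun ω => ?_)
    -- The quotients tend to the derivative `X ω` at `θ = 0`, so `E (exp (θ X) - 1) / θ` becomes
    -- negative together with `E X`.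
    have hd : HasDerivAt (fun θ => Real.exp (θ * X ω)) (X ω) 0 := by
      simpa using (((hasDerivAt_id (0 : ℝ)).mul_const (X ω)).exp)
    simpa [hF] using hd.tendsto_slope_zero_right
  obtain ⟨θ, hθ0, hθ⟩ := ((htend.eventually (gt_mem_nhds hX0)).and hmem).exists
  refine ⟨θ, hθ.1, ?_⟩
  have hFint : Integrable (F θ) P := hbint.mono' (hmeas θ) (hbound θ hθ)
  have hexp : ∀ ω, Real.exp (θ * X ω) = θ * F θ ω + 1 := fun ω => by
    rw [hF]
    have := hθ.1.ne'
    field_simp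
    ring
  have hint : Integrable (fun ω => Real.exp (θ * X ω)) P := by
    simp only [hexp]
    exact (hFint.const_mul θ).add (integrable_const 1)
  rw [← ofReal_integral_eq_lintegral_ofReal hint (.of_forall fun ω => (Real.exp_pos _).le),
    ENNReal.ofReal_le_one]
  simp only [hexp]
  rw [integral_add (hFint.const_mul θ) (integrable_const 1), integral_const_mul]
  simp only [integral_const, probReal_univ, smul_eq_mul, mul_one]
  nlinarith [hθ.1]

/-! ### Spanning intervals and lower large deviations of `w⁺` -/

/-- Both end points of `[x, y]` are joined to all its vertices. -/
def Spanning (u : Conf) (x y : ℤ) : Prop := SourceOn u x y ∧ SinkOn u x y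

theorem measurableSet_spanning (x y : ℤ) :
    MeasurableSet[edgeSigma (box x y)] {u : Conf | Spanning u x y} :=
  measurableSet_and (m := edgeSigma (box x y)) (measurableSet_sourceOn x y)
    (measurableSet_sinkOn x y)

theorem spanning_shift {u : Conf} {x a b : ℤ} :
    Spanning (shift x u) a b ↔ Spanning u (x + a) (x + b) := by
  simp only [Spanning, sourceOn_shift, sinkOn_shift]

/-- The exponential weight `exp (-θ w⁺)` of `[x, y]` if it is spanning. -/
noncomputable def spanWeight (θ : ℝ) (x y : ℤ) : Conf → ENNReal :=
  {u | Spanning u x y}.indicator fun u => (maxWeightPlus u x y).exp ^ (-θ)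

theorem measurable_spanWeight (θ : ℝ) (x y : ℤ) :
    Measurable[edgeSigma (box x y)] (spanWeight θ x y) := by
  refine Measurable.indicator (m := edgeSigma (box x y)) ?_ (measurableSet_spanning x y)
  exact (EReal.measurable_exp.comp (measurable_maxWeightPlus x y)).pow_const _

theorem spanWeight_shift (θ : ℝ) {x a b : ℤ} (hab : a < b) (u : Conf) :
    spanWeight θ a b (shift x u) = spanWeight θ (x + a) (x + b) u := by
  by_cases h : Spanning u (x + a) (x + b) <;>
    simp [spanWeight, spanning_shift, maxWeightPlus_shift x u hab, h]

theorem exp_coe_rpow_neg (θ m : ℝ) :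
    (m : EReal).exp ^ (-θ) = ENNReal.ofReal (Real.exp (-θ * m)) := by
  rw [EReal.exp_coe, ENNReal.ofReal_rpow_of_pos (Real.exp_pos _), ← Real.exp_mul]
  ring_nf

theorem rpow_neg_anti {θ : ℝ} (hθ : 0 ≤ θ) {a b : ENNReal} (h : a ≤ b) : b ^ (-θ) ≤ a ^ (-θ) := by
  rw [ENNReal.rpow_neg, ENNReal.rpow_neg, ENNReal.inv_le_inv]
  exact ENNReal.rpow_le_rpow h hθ

/-- Decomposition of a spanning interval with respect to its first cycle. -/
theorem spanWeight_le {θ : ℝ} (hθ : 0 ≤ θ) {u : Conf} (hu : ∀ j k, j < k → u j k ≠ ⊤) (n : ℕ) :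
    spanWeight θ 0 (n + 1) u ≤ cycleWeight θ 0 (n + 1) u +
      ∑ z ∈ Finset.range n, cycleWeight θ 0 (z + 1) u * spanWeight θ (z + 1) (n + 1) u := by
  by_cases hs : Spanning u 0 (n + 1)
  swap
  · simp [spanWeight, hs]
  -- The least such vertex `z + 1` ends the first cycle and leaves a spanning interval `[z + 1, n +
  -- 1]`; superadditivity of `w⁺` turns this into a product. If there is none, the whole interval is
  -- one cycle.
  by_cases hc : ∃ z : ℕ, z < n ∧ SinkOn u 0 (z + 1) ∧ SourceOn u (z + 1) (n + 1)
  · classical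
    have hmin := fun m => Nat.find_min (H := hc) (m := m)
    obtain ⟨hzn, hz1, hz2⟩ := Nat.find_spec hc
    set z := Nat.find hc with hz
    have hcyc : Cycle u 0 (z + 1) := by
      refine ⟨fun k hk hkz => hs.1 k hk (by omega), hz1, fun y hy hyz h => ?_⟩
      refine hmin (y - 1).toNat (by omega) ⟨by omega, ?_⟩
      rw [show (((y - 1).toNat : ℤ) + 1) = y by omega]
      refine ⟨h.1, fun k hk hkn => ?_⟩
      rcases le_or_gt k (z + 1) with hkz | hkz
      · exact h.2 k hk hkz
      · obtain ⟨j, hj, hjk, hjp⟩ := hz2 k hkz hkn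
        exact ⟨j, by omega, hjk, hjp⟩
    have hspan : Spanning u (z + 1) (n + 1) := ⟨hz2, fun j hj hjn => hs.2 j (by omega) hjn⟩
    refine le_add_left (le_trans ?_ (Finset.single_le_sum (f := fun z : ℕ =>
      cycleWeight θ 0 (z + 1) u * spanWeight θ (z + 1) (n + 1) u) (fun _ _ => zero_le)
      (Finset.mem_range.2 hzn)))
    simp only [spanWeight, cycleWeight]
    rw [Set.indicator_of_mem (by exact hs), Set.indicator_of_mem (by exact hcyc),
      Set.indicator_of_mem (by exact hspan), ← exp_coe_rpow_neg,
      ← ENNReal.mul_rpow_of_ne_zero, ← EReal.exp_add]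
    · refine rpow_neg_anti hθ (EReal.exp_monotone ?_)
      refine le_trans (add_le_add_left (minPosWeight_le_maxWeightPlus hu
        (hcyc.1.joined (by omega) le_rfl)) _) (maxWeightPlus_add_le u (by omega) (by omega))
    · simp [Real.exp_pos]
    · have h0 := (hspan.1.joined (k := n + 1) (by omega) le_rfl).maxWeightPlus_nonneg
      simp only [ne_eq, EReal.exp_eq_zero_iff]
      exact ne_bot_of_le_ne_bot (by simp) h0
  · have hcyc : Cycle u 0 (n + 1) := by
      refine ⟨hs.1, hs.2, fun y hy hyn h => hc ⟨(y - 1).toNat, by omega, ?_⟩⟩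
      rwa [show (((y - 1).toNat : ℤ) + 1) = y by omega]
    refine le_add_right ?_
    simp only [spanWeight, cycleWeight]
    rw [Set.indicator_of_mem (by exact hs), Set.indicator_of_mem (by exact hcyc),
      ← exp_coe_rpow_neg]
    exact rpow_neg_anti hθ (EReal.exp_monotone (minPosWeight_le_maxWeightPlus hu
      (hs.1.joined (by omega) le_rfl)))

section Measure

variable {Ω : Type*} [MeasurableSpace Ω] {P : Measure Ω} [IsProbabilityMeasure P]
  {ν : Measure EReal} {v : ℤ → ℤ → Ω → EReal}

/-- By independence of the first cycle from the rest, the normalised weights satisfy `s n ≤ a n + ∑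
a z * s (n - z - 1)`. If all earlier `s` are at most one, then `s n ≤ ∑ a ≤ 1`. -/
theorem IsIIDWeights.lintegral_spanWeight_le (hv : IsIIDWeights P ν v) {θ c : ℝ} (hθ : 0 ≤ θ)
    (h : ∑' y : ℕ, (∫⁻ ω, cycleWeight θ 0 (y + 1) (config v ω) ∂P) *
      ENNReal.ofReal (Real.exp (θ * (c * (y + 1)))) ≤ 1) (n : ℕ) :
    (∫⁻ ω, spanWeight θ 0 (n + 1) (config v ω) ∂P) *
      ENNReal.ofReal (Real.exp (θ * (c * (n + 1)))) ≤ 1 := by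
  induction n using Nat.strong_induction_on with
  | _ n ih =>
  have hcm : ∀ x y, Measurable fun ω => cycleWeight θ x y (config v ω) := fun x y =>
    (measurable_cycleWeight θ x y).comp (hv.measurable_config _)
  have hsm : ∀ x y, Measurable fun ω => spanWeight θ x y (config v ω) := fun x y =>
    (measurable_spanWeight θ x y).comp (hv.measurable_config _)
  have hprod : ∀ z ∈ Finset.range n, Measurable fun ω =>
      cycleWeight θ 0 (z + 1) (config v ω) * spanWeight θ (z + 1) (n + 1) (config v ω) :=
    fun z _ => (hcm _ _).mul (hsm _ _)
  have hz : ∀ z ∈ Finset.range n, (∫⁻ ω, cycleWeight θ 0 (z + 1) (config v ω) *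
      spanWeight θ (z + 1) (n + 1) (config v ω) ∂P) *
        ENNReal.ofReal (Real.exp (θ * (c * (n + 1)))) ≤
      (∫⁻ ω, cycleWeight θ 0 (z + 1) (config v ω) ∂P) *
        ENNReal.ofReal (Real.exp (θ * (c * (z + 1)))) := by
    intro z hz
    rw [Finset.mem_range] at hz
    have hshift : ∫⁻ ω, spanWeight θ (z + 1) (n + 1) (config v ω) ∂P =
        ∫⁻ ω, spanWeight θ 0 ((n - z - 1 : ℕ) + 1) (config v ω) ∂P := by
      rw [← hv.lintegral_shift (z + 1) (measurable_of_sub (measurable_spanWeight θ 0 _)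
        (Set.subset_univ _))]
      refine lintegral_congr fun ω => ?_
      rw [spanWeight_shift θ (by omega)]
      congr 1
      omega
    rw [hv.lintegral_mul (disjoint_below_above le_rfl)
      (measurable_of_sub (measurable_cycleWeight θ 0 (z + 1)) (box_subset_below _ _))
      (measurable_of_sub (measurable_spanWeight θ (z + 1) (n + 1)) (box_subset_above _ _)), hshift]
    have hexp : ENNReal.ofReal (Real.exp (θ * (c * (n + 1)))) =
        ENNReal.ofReal (Real.exp (θ * (c * ((n - z - 1 : ℕ) + 1)))) *
          ENNReal.ofReal (Real.exp (θ * (c * (z + 1)))) := by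
      rw [← ENNReal.ofReal_mul (Real.exp_pos _).le, ← Real.exp_add]
      congr 2
      have : ((n - z - 1 : ℕ) : ℝ) = n - z - 1 := by
        rw [Nat.sub_sub, Nat.cast_sub (by omega)]
        push_cast
        ring
      rw [this]
      ring
    rw [hexp, mul_assoc, ← mul_assoc (∫⁻ ω, spanWeight θ 0 _ (config v ω) ∂P)]
    refine mul_le_mul_right (mul_le_of_le_one_left' ?_) _
    exact_mod_cast ih (n - z - 1) (by omega)
  calc (∫⁻ ω, spanWeight θ 0 (n + 1) (config v ω) ∂P) *
        ENNReal.ofReal (Real.exp (θ * (c * (n + 1))))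
      ≤ (∫⁻ ω, (cycleWeight θ 0 (n + 1) (config v ω) + ∑ z ∈ Finset.range n,
          cycleWeight θ 0 (z + 1) (config v ω) *
            spanWeight θ (z + 1) (n + 1) (config v ω)) ∂P) *
        ENNReal.ofReal (Real.exp (θ * (c * (n + 1)))) := by
        gcongr with ω
        exact spanWeight_le hθ (fun j k h => hv.ne_top j k h ω) n
    _ = (∫⁻ ω, cycleWeight θ 0 (n + 1) (config v ω) ∂P) *
          ENNReal.ofReal (Real.exp (θ * (c * (n + 1)))) +
        ∑ z ∈ Finset.range n, (∫⁻ ω, cycleWeight θ 0 (z + 1) (config v ω) *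
          spanWeight θ (z + 1) (n + 1) (config v ω) ∂P) *
            ENNReal.ofReal (Real.exp (θ * (c * (n + 1)))) := by
        rw [lintegral_add_left (hcm _ _), lintegral_finsetSum _ hprod, add_mul, Finset.sum_mul]
    _ ≤ ∑ z ∈ Finset.range (n + 1), (∫⁻ ω, cycleWeight θ 0 (z + 1) (config v ω) ∂P) *
        ENNReal.ofReal (Real.exp (θ * (c * (z + 1)))) := by
        rw [Finset.sum_range_succ, add_comm]
        exact add_le_add_left (Finset.sum_le_sum hz) _
    _ ≤ 1 := (ENNReal.sum_le_tsum _).trans h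

/-- Lower large deviations of `w⁺` on spanning intervals. -/
theorem IsIIDWeights.measure_spanning_lt_le (hv : IsIIDWeights P ν v) {θ c : ℝ} (hθ : 0 ≤ θ)
    (h : ∑' y : ℕ, (∫⁻ ω, cycleWeight θ 0 (y + 1) (config v ω) ∂P) *
      ENNReal.ofReal (Real.exp (θ * (c * (y + 1)))) ≤ 1) (t : ℝ) {a b : ℤ} (hab : a < b) :
    P (config v ⁻¹' {u | Spanning u a b ∧ maxWeightPlus u a b < t}) ≤
      ENNReal.ofReal (Real.exp (θ * (t - c * (b - a)))) := by
  obtain ⟨n, hn⟩ : ∃ n : ℕ, b = a + (n + 1) := ⟨(b - a - 1).toNat, by omega⟩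
  subst hn
  have hmeas : MeasurableSet[edgeSigma (box 0 (n + 1))]
      {u : Conf | Spanning u 0 (n + 1) ∧ maxWeightPlus u 0 (n + 1) < t} :=
    measurableSet_and (m := edgeSigma (box 0 (n + 1))) (measurableSet_spanning _ _)
      (measurableSet_lt (measurable_maxWeightPlus _ _) measurable_const)
  have hset : config v ⁻¹' {u | Spanning u a (a + (n + 1)) ∧
      maxWeightPlus u a (a + (n + 1)) < t} = config v ⁻¹' (shift a ⁻¹'
        {u | Spanning u 0 (n + 1) ∧ maxWeightPlus u 0 (n + 1) < t}) := by
    ext ω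
    simp only [Set.mem_preimage, Set.mem_ofPred_eq, spanning_shift, add_zero]
    rw [maxWeightPlus_shift _ _ (by omega), add_zero]
  rw [hset, hv.measure_shift a (measurableSet_univ_of hmeas)]
  -- Markov's inequality for `exp (-θ w⁺)`.
  have h1 : P (config v ⁻¹' {u | Spanning u 0 (n + 1) ∧ maxWeightPlus u 0 (n + 1) < t}) *
      ENNReal.ofReal (Real.exp (-θ * t)) ≤ ∫⁻ ω, spanWeight θ 0 (n + 1) (config v ω) ∂P := by
    rw [mul_comm, ← lintegral_indicator_const (hv.measurableSet_config hmeas)]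
    refine lintegral_mono (Set.indicator_le fun ω hω => ?_)
    rw [spanWeight, Set.indicator_of_mem (by exact hω.1), ← exp_coe_rpow_neg]
    exact rpow_neg_anti hθ (EReal.exp_monotone hω.2.le)
  have h2 := (mul_le_mul_left h1 _).trans (hv.lintegral_spanWeight_le hθ h n)
  rw [mul_assoc, ← ENNReal.ofReal_mul (Real.exp_pos _).le, ← Real.exp_add,
    ← ENNReal.le_inv_iff_mul_le, ← ENNReal.ofReal_inv_of_pos (Real.exp_pos _), ← Real.exp_neg] at h2
  refine h2.trans (le_of_eq ?_)
  congr 2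
  push_cast
  ring

end Measure

/-! ### Linear growth of `w⁺` up to exponentially small probabilities -/

section

variable {Ω : Type*} [MeasurableSpace Ω] {P : Measure Ω} [IsProbabilityMeasure P]
  {ν : Measure EReal} {v : ℤ → ℤ → Ω → EReal}

theorem IsIIDWeights.ae_one_le_cycleLength (hv : IsIIDWeights P ν v) (hν : 0 < ν (Set.Ioi 0)) :
    ∀ᵐ ω ∂P, (1 : ℝ) ≤
      (point1 (skeletonPlus (config v ω)) - point0 (skeletonPlus (config v ω)) : ℤ) := by
  filter_upwards [(hv.expRecurrent_skeletonPlus hν).ae_biInfinite] with ω hω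
  have := hω.point1_mem.2
  exact_mod_cast (by omega : (1 : ℤ) ≤
    point1 (skeletonPlus (config v ω)) - point0 (skeletonPlus (config v ω)))

theorem IsIIDWeights.exists_integrable_exp_cycleLength (hv : IsIIDWeights P ν v)
    (hν : 0 < ν (Set.Ioi 0)) : ∃ C : ℝ, 0 < C ∧ Integrable (fun ω => Real.exp (C *
      (point1 (skeletonPlus (config v ω)) - point0 (skeletonPlus (config v ω)) : ℤ))) P := by
  have h := hv.expRecurrent_skeletonPlus hν
  obtain ⟨C, hC, hint⟩ := h.exists_lintegral_exp_point1
  refine ⟨C, hC, ?_⟩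
  simpa using (h.expMoments h.measurableSet (fun _ => le_rfl) hC hint).2

theorem IsIIDWeights.integrable_cycleLength (hv : IsIIDWeights P ν v)
    (hν : 0 < ν (Set.Ioi 0)) : Integrable (fun ω =>
      ((point1 (skeletonPlus (config v ω)) - point0 (skeletonPlus (config v ω)) : ℤ) : ℝ)) P := by
  obtain ⟨C, hC, hint⟩ := hv.exists_integrable_exp_cycleLength hν
  have h := (hv.expRecurrent_skeletonPlus hν).measurableSet
  refine (hint.const_mul C⁻¹).mono' ?_ ?_
  · exact ((measurable_of_countable _).comp
      ((measurable_point1 h).sub (measurable_point0 h))).aestronglyMeasurable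
  · filter_upwards [hv.ae_one_le_cycleLength hν] with ω hω
    rw [Real.norm_of_nonneg (by linarith), inv_mul_eq_div, le_div_iff₀ hC]
    have := Real.add_one_le_exp (C *
      (point1 (skeletonPlus (config v ω)) - point0 (skeletonPlus (config v ω)) : ℤ))
    linarith

theorem IsIIDWeights.one_le_integral_cycleLength (hv : IsIIDWeights P ν v)
    (hν : 0 < ν (Set.Ioi 0)) : 1 ≤ ∫ ω,
      ((point1 (skeletonPlus (config v ω)) - point0 (skeletonPlus (config v ω)) : ℤ) : ℝ) ∂P := by
  have := integral_mono_ae (integrable_const (1 : ℝ)) (hv.integrable_cycleLength hν)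
    (hv.ae_one_le_cycleLength hν)
  simpa using this

theorem IsIIDWeights.gammaPlus_pos (hv : IsIIDWeights P ν v) (hν : 0 < ν (Set.Ioi 0)) :
    0 < gammaPlus P v :=
  inv_pos.2 (one_pos.trans_le (hv.one_le_integral_cycleLength hν))

theorem IsIIDWeights.gammaPlus_le_one (hv : IsIIDWeights P ν v) (hν : 0 < ν (Set.Ioi 0)) :
    gammaPlus P v ≤ 1 :=
  inv_le_one_of_one_le₀ (hv.one_le_integral_cycleLength hν)

/-- The assumption on `c` says that `c * τ - M` has negative mean. It is at most `c * τ`, which has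
an exponential moment, so no exponential moment of `M` is needed. -/
theorem IsIIDWeights.exists_tsum_cycleWeight_le_one (hv : IsIIDWeights P ν v)
    (hν : 0 < ν (Set.Ioi 0)) {c : ℝ} (hc0 : 0 < c) (hc : c < gammaPlus P v * meanMin P v) :
    ∃ θ : ℝ, 0 < θ ∧ ∑' y : ℕ, (∫⁻ ω, cycleWeight θ 0 (y + 1) (config v ω) ∂P) *
      ENNReal.ofReal (Real.exp (θ * (c * (y + 1)))) ≤ 1 := by
  set M : Ω → ℝ := fun ω => minPosWeight (config v ω) (point0 (skeletonPlus (config v ω)))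
    (point1 (skeletonPlus (config v ω))) with hM
  set τ : Ω → ℝ := fun ω =>
    (point1 (skeletonPlus (config v ω)) - point0 (skeletonPlus (config v ω)) : ℤ) with hτ
  -- Without integrability the Bochner integral `V` would be `0`, contradicting `0 < c < γ⁺V`.
  have hMint : Integrable M P := by
    by_contra hnot
    have : meanMin P v = 0 := integral_undef hnot
    rw [this, mul_zero] at hc
    linarith
  have hτint : Integrable τ P := hv.integrable_cycleLength hν
  have hτ1 : 1 ≤ ∫ ω, τ ω ∂P := hv.one_le_integral_cycleLength hν
  have hX0 : ∫ ω, (c * τ ω - M ω) ∂P < 0 := by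
    rw [integral_sub (hτint.const_mul c) hMint, integral_const_mul]
    have h1 : c * ∫ ω, τ ω ∂P < ∫ ω, M ω ∂P := by
      rw [gammaPlus, inv_mul_eq_div, lt_div_iff₀ (by linarith)] at hc
      exact hc
    linarith
  obtain ⟨C, hC, hint⟩ := hv.exists_integrable_exp_cycleLength hν
  obtain ⟨θ, hθ, hle⟩ := exists_lintegral_exp_le_one (P := P) (X := fun ω => c * τ ω - M ω)
    (T := fun ω => c * τ ω) ((hτint.const_mul c).sub hMint) hX0
    (.of_forall fun ω => sub_le_self _ (minPosWeight_nonneg _ _ _)) (C := C / c) (by positivity)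
    (by
      refine hint.congr (.of_forall fun ω => ?_)
      simp only [hτ]
      congr 1
      field_simp)
  exact ⟨θ, hθ, (hv.tsum_cycleWeight_le hν θ c).trans hle⟩

/-- The stretches `[0, a]` and `[b, i]` contribute non-negative amounts, since skeleton-plus
vertices are joined to every other vertex. -/
theorem maxWeightPlus_skeleton_le {u : Conf} {a b : ℤ} {i : ℕ} (ha : a ∈ skeletonPlus u)
    (hb : b ∈ skeletonPlus u) (ha0 : 0 ≤ a) (hab : a ≤ b) (hbi : b ≤ i) :
    maxWeightPlus u a b ≤ maxWeightPlus u 0 i := by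
  rw [mem_skeletonPlus_iff] at ha hb
  have h1 : 0 ≤ maxWeightPlus u 0 a := by
    rcases ha0.eq_or_lt with rfl | h
    · rw [maxWeightPlus_self]
    · exact ((ha.1.sinkOn 0).joined h le_rfl).maxWeightPlus_nonneg
  have h2 : 0 ≤ maxWeightPlus u b i := by
    rcases hbi.eq_or_lt with rfl | h
    · rw [maxWeightPlus_self]
    · exact ((hb.2.sourceOn i).joined h le_rfl).maxWeightPlus_nonneg
  calc maxWeightPlus u a b ≤ maxWeightPlus u 0 a + maxWeightPlus u a b :=
        le_add_of_nonneg_left h1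
    _ ≤ maxWeightPlus u 0 b := maxWeightPlus_add_le u ha0 hab
    _ ≤ maxWeightPlus u 0 b + maxWeightPlus u b i := le_add_of_nonneg_right h2
    _ ≤ _ := maxWeightPlus_add_le u (ha0.trans hab) hbi

/-- The maximal weight `w⁺` grows at least linearly up to exponentially small probabilities. -/
theorem IsIIDWeights.expSmall_maxWeightPlus_lt (hv : IsIIDWeights P ν v)
    (hν : 0 < ν (Set.Ioi 0)) {c : ℝ} (hc0 : 0 < c) (hc : c < gammaPlus P v * meanMin P v) :
    ExpSmall fun i : ℕ =>
      P (config v ⁻¹' {u | maxWeightPlus u 0 i < ((c * i : ℝ) : EReal)}) := by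
  obtain ⟨c', hcc', hc'⟩ := exists_between hc
  obtain ⟨θ, hθ, hle⟩ := hv.exists_tsum_cycleWeight_le_one hν (hc0.trans hcc') hc'
  obtain ⟨f, hf, hgap⟩ := (hv.expRecurrent_skeletonPlus hν).gap
  -- Skeleton-plus vertices are sought within distance `i / K` of both ends. Dropping these pieces
  -- loses at most `2 * c' / K * i`, which is less than `(c' - c) * i`; `K > 3` keeps the two
  -- windows apart.
  obtain ⟨K, hK⟩ := exists_nat_gt (2 * c' / (c' - c) + 3)
  have hcc0 : 0 < c' - c := by linarith
  have hc'0 : 0 < c' := by linarith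
  have hK0 : (3 : ℝ) < K := by
    have : 0 < 2 * c' / (c' - c) := by positivity
    linarith
  have hK3 : 3 < K := by exact_mod_cast hK0
  have hκ : 0 < c' - c - 2 * c' / K := by
    have h1 : 2 * c' / (c' - c) < K := by linarith
    rw [div_lt_iff₀ hcc0] at h1
    have h2 : 2 * c' / K < c' - c := by
      rw [div_lt_iff₀ (by linarith)]
      linarith
    linarith
  set κ := c' - c - 2 * c' / K with hκdef
  have hfK : ExpSmall fun i => f (i / K) := hf.comp (h := fun i => i / K) (K := K) fun n => by
    have := Nat.lt_mul_div_succ n (show 0 < K by omega)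
    omega
  have hexp : ExpSmall fun i : ℕ => ENNReal.ofReal (Real.exp (-(θ * κ)) ^ i) :=
    ⟨1, Real.exp (-(θ * κ)), one_pos, Real.exp_pos _, by
      rw [Real.exp_lt_one_iff]
      have : 0 < θ * κ := by positivity
      linarith, fun n => by rw [one_mul]⟩
  refine ((hfK.add hfK).add hexp.nat_mul.nat_mul).mono fun i => ?_
  set d := i / K with hd
  have hdK : K * d ≤ i := Nat.mul_div_le i K
  have hd3 : 3 * d ≤ i := le_trans (by gcongr) hdK
  have hdK' : (d : ℝ) ≤ i / K := by
    rw [le_div_iff₀ (by linarith), mul_comm]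
    exact_mod_cast hdK
  have hterm : ∀ a ∈ Finset.range d, ∀ b ∈ Finset.range d,
      P (config v ⁻¹' {u | Spanning u a (i - b) ∧ maxWeightPlus u a (i - b) <
        ((c * i : ℝ) : EReal)}) ≤ ENNReal.ofReal (Real.exp (-(θ * κ)) ^ i) := by
    intro a ha b hb
    rw [Finset.mem_range] at ha hb
    refine (hv.measure_spanning_lt_le hθ.le hle (c * i) (by omega)).trans ?_
    refine ENNReal.ofReal_le_ofReal ?_
    rw [← Real.exp_nat_mul, Real.exp_le_exp]
    have ha' : (a : ℝ) ≤ d := by exact_mod_cast ha.le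
    have hb' : (b : ℝ) ≤ d := by exact_mod_cast hb.le
    have h1 : c * i - c' * (i - b - a) ≤ -(κ * i) := by
      have h2 : c' * (a + b) ≤ c' * (2 * (i / K)) := by
        gcongr
        linarith
      rw [hκdef]
      have h3 : c' * (2 * (i / K)) = 2 * c' / K * i := by ring
      linarith
    push_cast
    calc θ * (c * i - c' * (i - b - a)) ≤ θ * -(κ * i) := by gcongr
      _ = _ := by ring
  calc P (config v ⁻¹' {u | maxWeightPlus u 0 i < ((c * i : ℝ) : EReal)})
      ≤ P (({ω | ∀ x : ℤ, 0 ≤ x → x < 0 + d → x ∉ skeletonPlus (config v ω)} ∪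
          {ω | ∀ x : ℤ, i - d + 1 ≤ x → x < i - d + 1 + d → x ∉ skeletonPlus (config v ω)}) ∪
          ⋃ a ∈ Finset.range d, ⋃ b ∈ Finset.range d, config v ⁻¹'
            {u | Spanning u a (i - b) ∧ maxWeightPlus u a (i - b) < ((c * i : ℝ) : EReal)}) := by
        refine measure_mono fun ω hω => ?_
        by_contra hnot
        simp only [Set.mem_union, Set.mem_ofPred_eq, not_or, not_forall, not_not, Set.mem_iUnion,
          not_exists] at hnot
        obtain ⟨⟨⟨x, hx0, hxd, hx⟩, y, hy0, hyd, hy⟩, hnot⟩ := hnot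
        refine hnot x.toNat (Finset.mem_range.2 (by omega)) (i - y).toNat
          (Finset.mem_range.2 (by omega)) ?_
        have e1 : (x.toNat : ℤ) = x := by omega
        have e2 : (i : ℤ) - ((i - y).toNat : ℤ) = y := by omega
        simp only [Set.mem_preimage, Set.mem_ofPred_eq]
        rw [e1, e2]
        refine ⟨⟨(mem_skeletonPlus_iff.1 hx).2.sourceOn y, (mem_skeletonPlus_iff.1 hy).1.sinkOn x⟩,
          lt_of_le_of_lt (maxWeightPlus_skeleton_le hx hy hx0 (by omega) (by omega)) hω⟩
    _ ≤ (f d + f d) + ∑ a ∈ Finset.range d, ∑ b ∈ Finset.range d,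
          ENNReal.ofReal (Real.exp (-(θ * κ)) ^ i) := by
        refine (measure_union_le _ _).trans (add_le_add ((measure_union_le _ _).trans
          (add_le_add (hgap 0 d) (hgap _ d))) ?_)
        refine (measure_biUnion_finset_le _ _).trans (Finset.sum_le_sum fun a ha => ?_)
        exact (measure_biUnion_finset_le _ _).trans (Finset.sum_le_sum fun b hb => hterm a ha b hb)
    _ ≤ _ := by
        simp only [Finset.sum_const, Finset.card_range, nsmul_eq_mul]
        -- There are `d` choices for each end, whence the two factors from `nat_mul`.
        have hdi : d ≤ i + 1 := by omega
        gcongr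

end

/-! ### Growth from a vertex at all distances -/

section Growth

theorem maxWeightPlus_ge_of_edges {u : Conf} {c : ℝ} (hc : 0 < c) {a b : ℤ}
    (h : ∀ k, a ≤ k → k < b → (c : EReal) ≤ u k (k + 1)) (n : ℕ) (hn : a + n ≤ b) :
    ((c * n : ℝ) : EReal) ≤ maxWeightPlus u a (a + n) := by
  induction n with
  | zero => simp [maxWeightPlus_self]
  | succ n ih =>
    have h1 := ih (by omega)
    have h2 := h (a + n) (by omega) (by omega)
    have hpos : (0 : EReal) < u (a + n) (a + n + 1) :=
      lt_of_lt_of_le (by exact_mod_cast hc) h2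
    have h3 := (PathWeight.edge (by omega) hpos).le
    calc ((c * (n + 1 : ℕ) : ℝ) : EReal) = ((c * n : ℝ) : EReal) + (c : EReal) := by
          rw [← EReal.coe_add]
          congr 1
          push_cast
          ring
      _ ≤ maxWeightPlus u a (a + n) + maxWeightPlus u (a + n) (a + n + 1) :=
          add_le_add h1 (h2.trans h3)
      _ ≤ _ := by
          have := maxWeightPlus_add_le u (j := a) (l := a + n) (k := a + n + 1) (by omega) (by omega)
          rwa [Nat.cast_succ, ← add_assoc]

theorem measurableSet_le_maxWeightPlus (t : EReal) (a b : ℤ) :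
    MeasurableSet[edgeSigma (box a b)] {u : Conf | t ≤ maxWeightPlus u a b} :=
  measurableSet_le (mδ := edgeSigma (box a b)) measurable_const (measurable_maxWeightPlus a b)

theorem measurableSet_rightGrowthPlus (c : ℝ) (x : ℤ) :
    MeasurableSet[edgeSigma (above x)] {u : Conf | RightGrowthPlus u c x} := by
  refine measurableSet_forall (m := edgeSigma (above x)) fun i => measurableSet_forall fun _ => ?_
  exact edgeSigma_mono (box_subset_above _ _) _ (measurableSet_le_maxWeightPlus _ _ _)

theorem measurableSet_leftGrowthPlus (c : ℝ) (x : ℤ) :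
    MeasurableSet[edgeSigma (below x)] {u : Conf | LeftGrowthPlus u c x} := by
  refine measurableSet_forall (m := edgeSigma (below x)) fun i => measurableSet_forall fun _ => ?_
  exact edgeSigma_mono (box_subset_below _ _) _ (measurableSet_le_maxWeightPlus _ _ _)

theorem rightGrowthPlus_shift {u : Conf} {c : ℝ} {x y : ℤ} :
    RightGrowthPlus (shift x u) c y ↔ RightGrowthPlus u c (x + y) := by
  refine forall_congr' fun i => forall_congr' fun hi => ?_
  rw [maxWeightPlus_shift _ _ (by omega), add_assoc]

theorem leftGrowthPlus_shift {u : Conf} {c : ℝ} {x y : ℤ} :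
    LeftGrowthPlus (shift x u) c y ↔ LeftGrowthPlus u c (x + y) := by
  refine forall_congr' fun i => forall_congr' fun hi => ?_
  rw [maxWeightPlus_shift _ _ (by omega), add_sub_assoc]

theorem crossingBound_shift {u : Conf} {c : ℝ} {x y : ℤ} :
    CrossingBound (shift x u) c y ↔ CrossingBound u c (x + y) := by
  refine forall_congr' fun j => forall_congr' fun i => forall_congr' fun _ =>
    forall_congr' fun _ => ?_
  simp only [shift, add_assoc, add_sub_assoc]

/-- Lengthening the good stretch by edges of weight at least `c'` from `-N` to `0`. -/
theorem rightGrowthPlus_of_edges {u : Conf} {c c' : ℝ} (hc : 0 < c) (hcc' : c < c') {N M : ℕ}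
    (hNM : c * M ≤ (c' - c) * N) (hs : Source u 0)
    (hw : ∀ k : ℕ, ((c * (M + k : ℕ) : ℝ) : EReal) ≤ maxWeightPlus u 0 (M + k : ℕ))
    (he : ∀ k : Fin N, (c' : EReal) ≤ u (-(k + 1)) (-k)) : RightGrowthPlus u c (-N) := by
  have hc' : 0 < c' := hc.trans hcc'
  have hedge : ∀ k : ℤ, -N ≤ k → k < 0 → (c' : EReal) ≤ u k (k + 1) := by
    intro k hk hk0
    have h := he ⟨(-k - 1).toNat, by omega⟩
    simp only at h
    rwa [show -((((-k - 1).toNat : ℕ) : ℤ) + 1) = k by omega,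
      show -(((-k - 1).toNat : ℕ) : ℤ) = k + 1 by omega] at h
  intro i hi
  rcases le_or_gt i N with hiN | hiN
  · refine le_trans ?_ (maxWeightPlus_ge_of_edges hc' hedge i (by omega))
    rw [EReal.coe_le_coe_iff]
    gcongr
  · obtain ⟨k, rfl⟩ : ∃ k : ℕ, i = N + k := ⟨i - N, by omega⟩
    have h1 := maxWeightPlus_ge_of_edges hc' hedge N (by omega)
    rw [neg_add_cancel] at h1
    have hsum := maxWeightPlus_add_le u (j := -N) (l := 0) (k := k) (by omega) (by omega)
    have hidx : (-N + (N + k : ℕ) : ℤ) = k := by push_cast; ring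
    rw [hidx]
    refine le_trans ?_ hsum
    -- The surplus of the heavy run pays for the next `M` vertices, where only `w⁺ ≥ 0` is known.
    have hNM' : c * M + c * N ≤ c' * N := by linarith
    rcases lt_or_ge k M with hkM | hkM
    · have h2 : 0 ≤ maxWeightPlus u 0 k :=
        ((hs.sourceOn k).joined (by omega) le_rfl).maxWeightPlus_nonneg
      refine le_trans ?_ (add_le_add h1 h2)
      rw [add_zero, EReal.coe_le_coe_iff]
      push_cast
      have : c * k ≤ c * M := by gcongr
      linarith
    · obtain ⟨l, rfl⟩ : ∃ l : ℕ, k = M + l := ⟨k - M, by omega⟩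
      refine le_trans ?_ (add_le_add h1 (hw l))
      rw [← EReal.coe_add, EReal.coe_le_coe_iff]
      have h4 : c * N ≤ c' * N := by gcongr
      push_cast at h4 ⊢
      linarith

end Growth

section Probability

variable {Ω : Type*} [MeasurableSpace Ω] {P : Measure Ω} [IsProbabilityMeasure P]
  {ν : Measure EReal} {v : ℤ → ℤ → Ω → EReal}

omit [IsProbabilityMeasure P] in
theorem IsIIDWeights.measure_top (hv : IsIIDWeights P ν v) : ν {⊤} = 0 := by
  rw [← hv.law 0 1 one_pos, Measure.map_apply (hv.measurable 0 1 one_pos)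
    (measurableSet_singleton ⊤)]
  convert measure_empty (μ := P)
  ext ω
  simpa using hv.ne_top 0 1 one_pos ω

theorem minPosWeight_le_of_forall_le {u : Conf} {c : ℝ} (hc : 0 ≤ c)
    (h : ∀ e : Edge, u e.1.1 e.1.2 < (c : EReal)) (a b : ℤ) : minPosWeight u a b ≤ c := by
  rw [minPosWeight]
  rcases Set.eq_empty_or_nonempty
    {r : ℝ | 0 < r ∧ ∃ i j : ℤ, a ≤ i ∧ i < j ∧ j ≤ b ∧ u i j = (r : EReal)} with he | ⟨r, hr⟩
  · rw [he, Real.sInf_empty]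
    exact hc
  · refine (csInf_le (minPosWeight_bddBelow u a b) hr).trans ?_
    obtain ⟨-, i, j, -, hij, -, hu⟩ := hr
    have := h ⟨(i, j), hij⟩
    simp only [hu, EReal.coe_lt_coe_iff] at this
    exact this.le

/-- As `γ⁺ ≤ 1`, the bound on `c` gives `c < V`, which is impossible if almost surely no weight
reaches `c`. -/
theorem IsIIDWeights.measure_Ici_pos (hv : IsIIDWeights P ν v) (hν : 0 < ν (Set.Ioi 0)) {c : ℝ}
    (hc0 : 0 ≤ c) (hc : c < gammaPlus P v * meanMin P v) : 0 < ν (Set.Ici (c : EReal)) := by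
  by_contra h0
  have h0 : ν (Set.Ici (c : EReal)) = 0 := by simpa using h0
  have hlt : ∀ᵐ ω ∂P, ∀ e : Edge, config v ω e.1.1 e.1.2 < (c : EReal) := by
    refine ae_all_iff.2 fun e => ?_
    rw [ae_iff]
    simp only [not_lt]
    exact (hv.measure_edge e.2 measurableSet_Ici).trans h0
  have hV : meanMin P v ≤ c := by
    have h := integral_mono_of_nonneg (μ := P) (f := fun ω => minPosWeight (config v ω)
      (point0 (skeletonPlus (config v ω))) (point1 (skeletonPlus (config v ω))))
      (.of_forall fun ω => minPosWeight_nonneg _ _ _) (integrable_const c)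
      (hlt.mono fun ω hω => minPosWeight_le_of_forall_le hc0 hω _ _)
    simpa [meanMin] using h
  have hV0 : 0 ≤ meanMin P v := integral_nonneg fun ω => minPosWeight_nonneg _ _ _
  have := mul_le_of_le_one_left hV0 (hv.gammaPlus_le_one hν)
  linarith

theorem IsIIDWeights.measure_rightGrowthPlus_pos (hv : IsIIDWeights P ν v)
    (hν : 0 < ν (Set.Ioi 0)) {c : ℝ} (hc0 : 0 < c) (hc : c < gammaPlus P v * meanMin P v) :
    0 < P (config v ⁻¹' {u | RightGrowthPlus u c 0}) := by
  obtain ⟨c', hcc', hc'⟩ := exists_between hc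
  have hIci := hv.measure_Ici_pos hν (hc0.trans hcc').le hc'
  -- From distance `M` on, the failure probabilities sum to less than the probability of `Source u
  -- 0`, so both hold together with positive probability.
  obtain ⟨M, hM⟩ := (hv.expSmall_maxWeightPlus_lt hν hc0 hc).tail (hv.measure_source_pos hν)
  obtain ⟨N, hN⟩ := exists_nat_ge (c * M / (c' - c))
  rw [div_le_iff₀ (by linarith)] at hN
  set A : Set Conf := {u | Source u 0} ∩
    ⋂ k : ℕ, {u | ((c * (M + k : ℕ) : ℝ) : EReal) ≤ maxWeightPlus u 0 (M + k : ℕ)} with hA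
  set B : Set Conf := {u | ∀ k : Fin N, (c' : EReal) ≤ u (-(k + 1)) (-k)} with hB
  have hAm : MeasurableSet[edgeSigma (above 0)] A :=
    MeasurableSet.inter (m := edgeSigma (above 0)) (measurableSet_source 0)
      (MeasurableSet.iInter fun k => edgeSigma_mono (box_subset_above _ _) _
        (measurableSet_le_maxWeightPlus _ _ _))
  have hBm : MeasurableSet[edgeSigma (below 0)] B := by
    refine measurableSet_forall (m := edgeSigma (below 0)) fun k => ?_
    exact measurableSet_le measurable_const
      (measurable_weight (by omega) (show -(k : ℤ) ≤ 0 by omega))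
  have hA0 : 0 < P (config v ⁻¹' A) := by
    rw [hA, Set.preimage_inter, Set.preimage_iInter]
    refine measure_iInter_pos_of_tsum_lt ?_
    simpa only [← Set.preimage_compl, Set.compl_ofPred, not_le] using hM
  have hB0 : 0 < P (config v ⁻¹' B) := by
    have := hv.measure_edges (ι := Fin N) (e := fun k => ⟨(-(k + 1), -k), by simp⟩)
      (fun i j h => by simpa [Fin.ext_iff] using h) (B := fun _ => Set.Ici (c' : EReal))
      fun _ => measurableSet_Ici
    refine lt_of_lt_of_eq ?_ this.symm
    simpa using ENNReal.pow_pos hIci N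
  have hAB := hv.measure_inter (disjoint_below_above le_rfl) hBm hAm
  -- The heavy run occupies `[-N, 0]`, so growth is obtained at `-N` and moved to `0` by
  -- stationarity.
  rw [← hv.measure_shift (-N) (measurableSet_univ_of (measurableSet_rightGrowthPlus c 0))]
  refine lt_of_lt_of_le (hAB ▸ ENNReal.mul_pos hB0.ne' hA0.ne') (measure_mono ?_)
  rintro ω ⟨hωB, hωA⟩
  simp only [Set.mem_preimage, Set.mem_ofPred_eq, rightGrowthPlus_shift, add_zero]
  exact rightGrowthPlus_of_edges hc0 hcc' (by linarith) hωA.1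
    (fun k => Set.mem_iInter.1 hωA.2 k) hωB

theorem IsIIDWeights.measure_leftGrowthPlus_pos (hv : IsIIDWeights P ν v)
    (hν : 0 < ν (Set.Ioi 0)) {c : ℝ} (hc0 : 0 < c) (hc : c < gammaPlus P v * meanMin P v) :
    0 < P (config v ⁻¹' {u | LeftGrowthPlus u c 0}) := by
  simp only [leftGrowthPlus_iff_reflect]
  refine lt_of_lt_of_eq (hv.measure_rightGrowthPlus_pos hν hc0 hc) ?_
  exact (hv.measure_reflect (measurableSet_univ_of (measurableSet_rightGrowthPlus c 0))).symm

/-! ### The law of a single weight -/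

theorem posLaw_apply (ν : Measure EReal) {B : Set ℝ} (hB : MeasurableSet B) :
    posLaw ν B = (ν (Set.Ioi 0))⁻¹ * ν (Set.Ioi 0 ∩ EReal.toReal ⁻¹' B) := by
  rw [posLaw, Measure.map_apply measurable_ereal_toReal hB, cond_apply measurableSet_Ioi]

theorem IsIIDWeights.measure_Ici_le_posLaw (hv : IsIIDWeights P ν v) {t : ℝ} (ht : 0 < t) :
    ν (Set.Ici (t : EReal)) ≤ posLaw ν (Set.Ici t) := by
  have := hv.isProbabilityMeasure
  rw [posLaw_apply ν measurableSet_Ici]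
  calc ν (Set.Ici (t : EReal)) ≤ ν ((Set.Ioi 0 ∩ EReal.toReal ⁻¹' Set.Ici t) ∪ {⊤}) := by
        refine measure_mono fun x hx => ?_
        rcases eq_or_ne x ⊤ with rfl | hxt
        · exact .inr rfl
        · have hx0 : (0 : EReal) < x := lt_of_lt_of_le (by exact_mod_cast ht) hx
          refine .inl ⟨hx0, ?_⟩
          rw [Set.mem_preimage, Set.mem_Ici, ← EReal.coe_le_coe_iff,
            EReal.coe_toReal hxt (ne_bot_of_gt hx0)]
          exact hx
    _ ≤ ν (Set.Ioi 0 ∩ EReal.toReal ⁻¹' Set.Ici t) :=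
        (measure_union_le _ _).trans (by rw [hv.measure_top, add_zero])
    _ ≤ _ := le_mul_of_one_le_left' (ENNReal.one_le_inv.2 prob_le_one)

/-- Exponential Chebyshev inequality for `v⁺`; passing from `v` to `v⁺` only increases the tail at
positive levels. -/
theorem IsIIDWeights.expSmall_measure_Ici (hv : IsIIDWeights P ν v) (hm : MainCondition ν) {c : ℝ}
    (hc : 0 < c) : ExpSmall fun m : ℕ => ν (Set.Ici ((c * m : ℝ) : EReal)) := by
  have := hv.isProbabilityMeasure
  obtain ⟨C, hC, hint⟩ := hm.expMoment
  set D := ∫⁻ x, ENNReal.ofReal (Real.exp (C * x)) ∂(posLaw ν) with hD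
  have hDtop : D ≠ ⊤ := by
    have := hint.2
    rw [hasFiniteIntegral_iff_ofReal (.of_forall fun x => (Real.exp_pos _).le)] at this
    exact this.ne
  have hexp : ExpSmall fun m : ℕ => ENNReal.ofReal (Real.exp (-(C * c)) ^ m) :=
    ⟨1, Real.exp (-(C * c)), one_pos, Real.exp_pos _, by
      rw [Real.exp_lt_one_iff]
      have : 0 < C * c := by positivity
      linarith, fun n => by rw [one_mul]⟩
  refine (hexp.const_mul (c := D + 1) (by simp [hDtop])).mono fun m => ?_
  rcases Nat.eq_zero_or_pos m with rfl | hpos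
  · refine prob_le_one.trans ?_
    simp
  · have hcm : 0 < c * m := by positivity
    refine (hv.measure_Ici_le_posLaw hcm).trans ?_
    have h1 : posLaw ν (Set.Ici (c * m)) * ENNReal.ofReal (Real.exp (C * (c * m))) ≤ D := by
      rw [mul_comm, ← lintegral_indicator_const measurableSet_Ici]
      refine lintegral_mono (Set.indicator_le fun x hx => ?_)
      refine ENNReal.ofReal_le_ofReal (Real.exp_le_exp.2 ?_)
      have : c * m ≤ x := hx
      gcongr
    have h2 : ENNReal.ofReal (Real.exp (C * (c * m))) *
        ENNReal.ofReal (Real.exp (-(C * c)) ^ m) = 1 := by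
      rw [← ENNReal.ofReal_mul (Real.exp_pos _).le, ← Real.exp_nat_mul, ← Real.exp_add,
        show C * (c * m) + m * -(C * c) = 0 by ring, Real.exp_zero, ENNReal.ofReal_one]
    calc posLaw ν (Set.Ici (c * m)) = posLaw ν (Set.Ici (c * m)) *
          ENNReal.ofReal (Real.exp (C * (c * m))) * ENNReal.ofReal (Real.exp (-(C * c)) ^ m) := by
          rw [mul_assoc, h2, mul_one]
      _ ≤ (D + 1) * ENNReal.ofReal (Real.exp (-(C * c)) ^ m) := by
          gcongr
          exact h1.trans le_self_add

theorem essInfPlus_nonneg (ν : Measure EReal) : 0 ≤ essInfPlus ν :=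
  Real.sInf_nonneg fun _ h => h.1.le

theorem IsIIDWeights.gammaPlus_eq_one (hv : IsIIDWeights P ν v) (h0 : ν (Set.Iic 0) = 0) :
    gammaPlus P v = 1 := by
  have hpos : ∀ᵐ ω ∂P, ∀ e : Edge, 0 < config v ω e.1.1 e.1.2 := by
    refine ae_all_iff.2 fun e => ?_
    rw [ae_iff]
    simp only [not_lt]
    exact (hv.measure_edge e.2 measurableSet_Iic).trans h0
  rw [gammaPlus, inv_eq_one]
  have : ∀ᵐ ω ∂P, ((point1 (skeletonPlus (config v ω)) - point0 (skeletonPlus (config v ω)) : ℤ) :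
      ℝ) = 1 := by
    filter_upwards [hpos] with ω hω
    have hS : skeletonPlus (config v ω) = Set.univ := by
      refine Set.eq_univ_of_forall fun x => mem_skeletonPlus_iff.2 ⟨fun j hj => ?_, fun k hk => ?_⟩
      · exact ⟨x, hj, le_rfl, hω ⟨(j, x), hj⟩⟩
      · exact ⟨x, le_rfl, hk, hω ⟨(x, k), hk⟩⟩
    have hbi : BiInfinite (Set.univ : Set ℤ) := ⟨not_bddAbove_univ, not_bddBelow_univ⟩
    have e0 : point0 (Set.univ : Set ℤ) = 0 :=
      (point0_eq_iff hbi).2 ⟨trivial, le_rfl, fun z hz hz' => by omega⟩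
    have e1 : point1 (Set.univ : Set ℤ) = 1 :=
      (point1_eq_iff hbi).2 ⟨trivial, by rw [e0]; omega, fun z hz hz' => by omega⟩
    rw [hS, e0, e1]
    simp
  rw [integral_congr_ae this]
  simp

/-- If `v ≥ c > 0` almost surely, then all edges are positive, every vertex is skeleton-plus and `γ⁺
= 1`. The assumption becomes `ess inf v⁺ < c`, a contradiction. -/
theorem IsIIDWeights.measure_Iio_pos (hv : IsIIDWeights P ν v) (hν : 0 < ν (Set.Ioi 0)) {c : ℝ}
    (hc0 : 0 < c) (hc : gammaPlus P v * essInfPlus ν < c) : 0 < ν (Set.Iio (c : EReal)) := by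
  have hprob := hv.isProbabilityMeasure
  by_contra hnot
  have hnot : ν (Set.Iio (c : EReal)) = 0 := by simpa using hnot
  have h0 : ν (Set.Iic 0) = 0 :=
    measure_mono_null (Set.Iic_subset_Iio.2 (by exact_mod_cast hc0)) hnot
  rw [hv.gammaPlus_eq_one h0, one_mul] at hc
  have hzero : ∀ t ≤ c, posLaw ν (Set.Iio t) = 0 := by
    intro t ht
    rw [posLaw_apply ν measurableSet_Iio]
    refine mul_eq_zero_of_right _ (measure_mono_null (t := Set.Iio (c : EReal) ∪ {⊤}) ?_
      (measure_union_null hnot hv.measure_top))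
    rintro x ⟨hx0, hx⟩
    rcases eq_or_ne x ⊤ with rfl | hxt
    · exact .inr rfl
    · refine .inl ?_
      rw [Set.mem_Iio, ← EReal.coe_toReal hxt (ne_bot_of_gt hx0), EReal.coe_lt_coe_iff]
      exact lt_of_lt_of_le hx ht
  -- Rules out that `essInfPlus ν` is merely the default infimum `0` of the empty set.
  have hne : {t : ℝ | 0 < t ∧ 0 < posLaw ν (Set.Iio t)}.Nonempty := by
    by_contra hemp
    rw [Set.not_nonempty_iff_eq_empty, Set.eq_empty_iff_forall_notMem] at hemp
    have h1 : posLaw ν (⋃ n : ℕ, Set.Iio ((n : ℝ) + 1)) = 0 := by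
      refine measure_iUnion_null fun n => ?_
      by_contra hpos
      exact hemp (n + 1) ⟨by positivity, pos_iff_ne_zero.2 hpos⟩
    have h2 : ⋃ n : ℕ, Set.Iio ((n : ℝ) + 1) = Set.univ := by
      refine Set.eq_univ_of_forall fun x => Set.mem_iUnion.2 ?_
      obtain ⟨n, hn⟩ := exists_nat_gt x
      exact ⟨n, by rw [Set.mem_Iio]; linarith⟩
    rw [h2, posLaw_apply ν MeasurableSet.univ, Set.preimage_univ, Set.inter_univ,
      ENNReal.inv_mul_cancel hν.ne' (measure_ne_top _ _)] at h1
    exact one_ne_zero h1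
  obtain ⟨t, ht, htc⟩ := exists_lt_of_csInf_lt hne hc
  exact ht.2.ne' (hzero t htc.le)

end Probability

/-! ### Renewal-plus vertices as an intersection of local conditions -/

section Renewal

/-- The edges across the vertex `0` whose longer side has length `m`. -/
def crossingEdges (m : ℕ) : Set Edge :=
  {e | e.1.1 < 0 ∧ 0 < e.1.2 ∧ max (-e.1.1) e.1.2 = m}

/-- The part of the crossing bound at `0` that concerns the edges in `crossingEdges m`. -/
def crossingAt (c : ℝ) (m : ℕ) : Set Conf :=
  {u | ∀ j i : ℕ, 1 ≤ j → 1 ≤ i → max j i = m → u (-j) i < ((c * (j + i) : ℝ) : EReal)}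

theorem crossingEdges_disjoint :
    Pairwise fun m n => Disjoint (crossingEdges m) (crossingEdges n) := by
  intro m n hmn
  rw [Set.disjoint_left]
  intro e h1 h2
  simp only [crossingEdges, Set.mem_ofPred_eq] at h1 h2
  omega

theorem measurableSet_crossingAt (c : ℝ) (m : ℕ) :
    MeasurableSet[edgeSigma (crossingEdges m)] (crossingAt c m) := by
  refine measurableSet_forall (m := edgeSigma (crossingEdges m)) fun j => measurableSet_forall
    fun i => measurableSet_forall fun hj => measurableSet_forall fun hi => measurableSet_forall
    fun hm => measurableSet_lt (measurable_weight (by omega) ?_) measurable_const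
  simp only [crossingEdges, Set.mem_ofPred_eq]
  omega

theorem mem_iInter_crossingAt {u : Conf} {c : ℝ} :
    u ∈ ⋂ m, crossingAt c m ↔ CrossingBound u c 0 := by
  simp only [Set.mem_iInter, crossingAt, Set.mem_ofPred_eq, CrossingBound, zero_sub, zero_add]
  exact ⟨fun h j i hj hi => h _ j i hj hi rfl, fun h m j i hj hi _ => h j i hj hi⟩

/-- The growth and crossing conditions at distance `m` from the vertex `0`. -/
def renewalAt (a b : ℝ) (m : ℕ) : Set Conf :=
  {u | ((a * m : ℝ) : EReal) ≤ maxWeightPlus u 0 m} ∩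
    {u | ((a * m : ℝ) : EReal) ≤ maxWeightPlus u (-m) 0} ∩ crossingAt b m

theorem measurableSet_renewalAt (a b : ℝ) (m : ℕ) :
    MeasurableSet[edgeSigma (box (-m) m)] (renewalAt a b m) := by
  refine MeasurableSet.inter (m := edgeSigma (box (-m) m)) (MeasurableSet.inter
    (edgeSigma_mono (box_subset (by omega) le_rfl) _ (measurableSet_le_maxWeightPlus _ _ _))
    (edgeSigma_mono (box_subset le_rfl (by omega)) _ (measurableSet_le_maxWeightPlus _ _ _)))
    (edgeSigma_mono (fun e he => ?_) _ (measurableSet_crossingAt b m))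
  simp only [crossingEdges, box, Set.mem_ofPred_eq] at he ⊢
  omega

theorem mem_iInter_renewalAt {u : Conf} {a b : ℝ} :
    u ∈ ⋂ m, renewalAt a b m ↔ 0 ∈ renewalPlus u a b := by
  simp only [renewalAt, Set.iInter_inter_distrib, Set.mem_inter_iff, mem_iInter_crossingAt]
  simp only [renewalPlus, Set.mem_ofPred_eq, Set.mem_iInter, LeftGrowthPlus, RightGrowthPlus,
    zero_sub, zero_add]
  constructor
  · rintro ⟨⟨h1, h2⟩, h3⟩
    exact ⟨fun j _ => h2 j, h3, fun i _ => h1 i⟩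
  · rintro ⟨h2, h3, h1⟩
    refine ⟨⟨fun m => ?_, fun m => ?_⟩, h3⟩ <;> rcases Nat.eq_zero_or_pos m with rfl | hm
    · simp [maxWeightPlus_self]
    · exact h1 m hm
    · simp [maxWeightPlus_self]
    · exact h2 m hm

/-- Puts the renewal-plus property into the form required by `expSmall_of_local`. -/
theorem shift_mem_iInter_renewalAt {u : Conf} {a b : ℝ} {x : ℤ} :
    shift x u ∈ ⋂ m, renewalAt a b m ↔ x ∈ renewalPlus u a b := by
  rw [mem_iInter_renewalAt]
  simp only [renewalPlus, Set.mem_ofPred_eq, leftGrowthPlus_shift, crossingBound_shift,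
    rightGrowthPlus_shift, add_zero]

theorem measurableSet_crossingBound (c : ℝ) (x : ℤ) :
    MeasurableSet[edgeSigma Set.univ] {u : Conf | CrossingBound u c x} := by
  refine measurableSet_forall (m := edgeSigma Set.univ) fun j => measurableSet_forall
    fun i => measurableSet_forall fun hj => measurableSet_forall fun hi =>
    measurableSet_lt (measurable_weight (by omega) trivial) measurable_const

theorem measurableSet_renewalPlus (a b : ℝ) (x : ℤ) :
    MeasurableSet[edgeSigma Set.univ] {u : Conf | x ∈ renewalPlus u a b} :=
  measurableSet_and (m := edgeSigma Set.univ)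
    (measurableSet_univ_of (measurableSet_leftGrowthPlus a x))
    (measurableSet_and (measurableSet_crossingBound b x)
      (measurableSet_univ_of (measurableSet_rightGrowthPlus a x)))

theorem measurableSet_renewal (a b : ℝ) (x : ℤ) :
    MeasurableSet[edgeSigma Set.univ] {u : Conf | x ∈ renewal u a b} := by
  refine measurableSet_and (m := edgeSigma Set.univ) ?_
    (measurableSet_and (measurableSet_crossingBound b x) ?_) <;>
  exact measurableSet_forall (m := edgeSigma Set.univ) fun i => measurableSet_forall fun _ =>
    measurableSet_le measurable_const
      (measurable_of_sub (measurable_maxWeight _ _) (Set.subset_univ _))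

theorem renewalPlus_subset_renewal (u : Conf) (a b : ℝ) : renewalPlus u a b ⊆ renewal u a b :=
  fun _ hx => ⟨fun j hj => (hx.1 j hj).trans (maxWeightPlus_le_maxWeight _ _ _), hx.2.1,
    fun i hi => (hx.2.2 i hi).trans (maxWeightPlus_le_maxWeight _ _ _)⟩

theorem renewal_anti_mono (u : Conf) {a b a' b' : ℝ} (ha : a' ≤ a) (hb : b ≤ b') :
    renewal u a b ⊆ renewal u a' b' := by
  refine fun x hx => ⟨fun j hj => le_trans ?_ (hx.1 j hj), fun j i hj hi =>
    (hx.2.1 j i hj hi).trans_le ?_, fun i hi => le_trans ?_ (hx.2.2 i hi)⟩ <;>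
  · rw [EReal.coe_le_coe_iff]
    gcongr

end Renewal

/-! ### Exponential recurrence of renewal-plus vertices -/

section Probability

variable {Ω : Type*} [MeasurableSpace Ω] {P : Measure Ω} [IsProbabilityMeasure P]
  {ν : Measure EReal} {v : ℤ → ℤ → Ω → EReal}

/-- Union bound over at most `(m + 1) ^ 2` edges; since `j + i ≥ max j i = m`, a violating weight is
at least `c * m`. -/
theorem IsIIDWeights.expSmall_crossingAt_compl (hv : IsIIDWeights P ν v) (hm : MainCondition ν)
    {c : ℝ} (hc : 0 < c) : ExpSmall fun m => P (config v ⁻¹' (crossingAt c m)ᶜ) := by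
  refine (hv.expSmall_measure_Ici hm hc).nat_mul.nat_mul.mono fun m => ?_
  calc P (config v ⁻¹' (crossingAt c m)ᶜ)
      ≤ P (⋃ j ∈ Finset.range (m + 1), ⋃ i ∈ Finset.range (m + 1),
          {ω | config v ω (-(j + 1)) (i + 1) ∈ Set.Ici ((c * m : ℝ) : EReal)}) := by
        refine measure_mono fun ω hω => ?_
        simp only [crossingAt, Set.mem_preimage, Set.mem_compl_iff, Set.mem_ofPred_eq, not_forall,
          not_lt] at hω
        obtain ⟨j, i, hj, hi, hmax, hω⟩ := hω
        refine Set.mem_iUnion₂.2 ⟨j - 1, Finset.mem_range.2 (by omega),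
          Set.mem_iUnion₂.2 ⟨i - 1, Finset.mem_range.2 (by omega), ?_⟩⟩
        have e1 : (((j - 1 : ℕ) : ℤ) + 1) = j := by omega
        have e2 : (((i - 1 : ℕ) : ℤ) + 1) = i := by omega
        rw [Set.mem_ofPred_eq, e1, e2]
        refine le_trans ?_ hω
        rw [EReal.coe_le_coe_iff]
        have : m ≤ j + i := by omega
        gcongr
        exact_mod_cast this
    _ ≤ ∑ j ∈ Finset.range (m + 1), ∑ i ∈ Finset.range (m + 1),
          ν (Set.Ici ((c * m : ℝ) : EReal)) := by
        refine (measure_biUnion_finset_le _ _).trans (Finset.sum_le_sum fun j _ => ?_)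
        refine (measure_biUnion_finset_le _ _).trans (Finset.sum_le_sum fun i _ => ?_)
        exact (hv.measure_edge (by omega) measurableSet_Ici).le
    _ = _ := by simp

-- It suffices that each of the finitely many edges from `[-m, -1]` to `[1, m]` weighs less than
-- `c`, because `c ≤ c * (j + i)`.
omit [IsProbabilityMeasure P] in
theorem IsIIDWeights.measure_crossingAt_pos (hv : IsIIDWeights P ν v) {c : ℝ} (hc : 0 < c)
    (hIio : 0 < ν (Set.Iio (c : EReal))) (m : ℕ) : 0 < P (config v ⁻¹' crossingAt c m) := by
  have h := hv.measure_edges (ι := Fin m × Fin m)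
    (e := fun p => ⟨(-(p.1 + 1), p.2 + 1), by simp only; omega⟩)
    (fun p q h => by
      simp only [Subtype.mk.injEq, Prod.mk.injEq] at h
      exact Prod.ext (Fin.ext (by omega)) (Fin.ext (by omega)))
    (B := fun _ => Set.Iio (c : EReal)) fun _ => measurableSet_Iio
  have hpos : 0 < ∏ _p : Fin m × Fin m, ν (Set.Iio (c : EReal)) := by
    rw [Finset.prod_const]
    exact ENNReal.pow_pos hIio _
  rw [← h] at hpos
  refine hpos.trans_le (measure_mono fun ω hω j i hj hi hmax => ?_)
  have h1 := hω (⟨j - 1, by omega⟩, ⟨i - 1, by omega⟩)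
  have e1 : (((j - 1 : ℕ) : ℤ) + 1) = j := by omega
  have e2 : (((i - 1 : ℕ) : ℤ) + 1) = i := by omega
  simp only [e1, e2] at h1
  refine lt_of_lt_of_le h1 ?_
  rw [EReal.coe_le_coe_iff]
  have hj' : (1 : ℝ) ≤ j := by exact_mod_cast hj
  have hi' : (1 : ℝ) ≤ i := by exact_mod_cast hi
  nlinarith

/-- Left growth, right growth and the crossing bound depend on the edges below `0`, above `0` and
across `0`, so the probabilities multiply. -/
theorem IsIIDWeights.measure_iInter_renewalAt_pos (hv : IsIIDWeights P ν v)
    (hm : MainCondition ν) {a b : ℝ} (ha : 0 < a) (ha' : a < gammaPlus P v * meanMin P v)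
    (hb : 0 < b) (hb' : gammaPlus P v * essInfPlus ν < b) :
    0 < P (config v ⁻¹' ⋂ m, renewalAt a b m) := by
  have hX := hv.measure_iInter_pos crossingEdges_disjoint (measurableSet_crossingAt b)
    (hv.measure_crossingAt_pos hb (hv.measure_Iio_pos hm.pos hb hb'))
    (hv.expSmall_crossingAt_compl hm hb)
  have hXm : MeasurableSet[edgeSigma (⋃ m, crossingEdges m)] (⋂ m, crossingAt b m) :=
    MeasurableSet.iInter (m := edgeSigma _) fun m =>
      edgeSigma_mono (Set.subset_iUnion crossingEdges m) _ (measurableSet_crossingAt b m)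
  have hLR := hv.measure_inter (disjoint_below_above le_rfl)
    (measurableSet_leftGrowthPlus a 0) (measurableSet_rightGrowthPlus a 0)
  have hLRm : MeasurableSet[edgeSigma (below 0 ∪ above 0)]
      ({u : Conf | LeftGrowthPlus u a 0} ∩ {u : Conf | RightGrowthPlus u a 0}) :=
    MeasurableSet.inter (m := edgeSigma (below 0 ∪ above 0))
      (edgeSigma_mono Set.subset_union_left _ (measurableSet_leftGrowthPlus a 0))
      (edgeSigma_mono Set.subset_union_right _ (measurableSet_rightGrowthPlus a 0))
  have hdisj : Disjoint (below 0 ∪ above 0) (⋃ m, crossingEdges m) := by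
    rw [Set.disjoint_left]
    intro e h1 h2
    obtain ⟨m, h2⟩ := Set.mem_iUnion.1 h2
    simp only [crossingEdges, below, above, Set.mem_union, Set.mem_ofPred_eq] at h1 h2
    omega
  have hall := hv.measure_inter hdisj hLRm hXm
  rw [Set.preimage_inter, hLR] at hall
  have hpos := ENNReal.mul_pos (ENNReal.mul_pos
    (hv.measure_leftGrowthPlus_pos hm.pos ha ha').ne'
    (hv.measure_rightGrowthPlus_pos hm.pos ha ha').ne').ne' hX.ne'
  rw [← hall] at hpos
  refine hpos.trans_le (measure_mono ?_)
  rintro ω ⟨⟨h1, h2⟩, h3⟩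
  exact mem_iInter_renewalAt.2 ⟨h1, mem_iInter_crossingAt.1 h3, h2⟩

theorem IsIIDWeights.expSmall_renewalAt_compl (hv : IsIIDWeights P ν v)
    (hm : MainCondition ν) {a b : ℝ} (ha : 0 < a) (ha' : a < gammaPlus P v * meanMin P v)
    (hb : 0 < b) : ExpSmall fun m => P (config v ⁻¹' (renewalAt a b m)ᶜ) := by
  have hw := hv.expSmall_maxWeightPlus_lt hm.pos ha ha'
  refine ((hw.add hw).add (hv.expSmall_crossingAt_compl hm hb)).mono fun m => ?_
  rw [renewalAt, Set.compl_inter, Set.compl_inter, Set.preimage_union, Set.preimage_union]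
  refine (measure_union_le _ _).trans (add_le_add ((measure_union_le _ _).trans
    (add_le_add ?_ ?_)) le_rfl)
  · simp only [Set.compl_ofPred, not_le, le_refl]
  · simp only [Set.compl_ofPred, not_le]
    rcases Nat.eq_zero_or_pos m with rfl | hpos
    · simp
    · have hmeas : MeasurableSet[edgeSigma Set.univ]
          {u : Conf | maxWeightPlus u 0 m < ((a * m : ℝ) : EReal)} :=
        measurableSet_univ_of (measurableSet_lt (mδ := edgeSigma (box 0 m))
          (measurable_maxWeightPlus 0 m) measurable_const)
      -- By stationarity `w⁺_{-m,0}` has the law of `w⁺_{0,m}`.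
      rw [← hv.measure_shift (-m) hmeas]
      refine measure_mono fun ω hω => ?_
      simp only [Set.mem_preimage, Set.mem_ofPred_eq] at hω ⊢
      rwa [maxWeightPlus_shift _ _ (by omega), add_zero, neg_add_cancel]

theorem IsIIDWeights.expRecurrent_renewalPlus (hv : IsIIDWeights P ν v)
    (hm : MainCondition ν) {a b : ℝ} (ha : 0 < a) (ha' : a < gammaPlus P v * meanMin P v)
    (hb : 0 < b) (hb' : gammaPlus P v * essInfPlus ν < b) :
    ExpRecurrent P fun ω => renewalPlus (config v ω) a b := by
  refine ⟨fun x => hv.measurableSet_config (measurableSet_renewalPlus a b x), ?_⟩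
  obtain ⟨f, hf, h⟩ := hv.expSmall_of_local (measurableSet_renewalAt a b)
    (hv.expSmall_renewalAt_compl hm ha ha' hb) (hv.measure_iInter_renewalAt_pos hm ha ha' hb hb')
  refine ⟨f, hf, fun x n => ?_⟩
  simpa only [shift_mem_iInter_renewalAt] using h x n

end Probability

end DirectedGraph

/-! ### Conclusion -/

open DirectedGraph
theorem lemma3 {Ω : Type*} [MeasurableSpace Ω] (P : Measure Ω) [IsProbabilityMeasure P]
    (ν : Measure EReal) (v : ℤ → ℤ → Ω → EReal) (hv : IsIIDWeights P ν v)
    (hν : MainCondition ν) (c₁ c₂ : ℝ)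
    (hc₂ : gammaPlus P v * essInfPlus ν < c₂) (hc : c₂ ≤ c₁)
    (hc₁ : c₁ < gammaPlus P v * meanMin P v) :
    (∀ᵐ ω ∂P, BiInfinite (renewalPlus (config v ω) c₁ c₂) ∧
      BiInfinite (renewal (config v ω) c₁ c₂) ∧ BiInfinite (renewal (config v ω) c₂ c₁)) ∧
    ∃ C : ℝ, 0 < C ∧
      ExpMoments P (fun ω => renewalPlus (config v ω) c₁ c₂) C ∧
      ExpMoments P (fun ω => renewal (config v ω) c₁ c₂) C ∧
      ExpMoments P (fun ω => renewal (config v ω) c₂ c₁) C := by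
  have h2 : 0 < c₂ :=
    (mul_nonneg (hv.gammaPlus_pos hν.pos).le (essInfPlus_nonneg ν)).trans_lt hc₂
  have hA := hv.expRecurrent_renewalPlus hν (h2.trans_le hc) hc₁ h2 hc₂
  have hsub1 : ∀ ω, renewalPlus (config v ω) c₁ c₂ ⊆ renewal (config v ω) c₁ c₂ :=
    fun ω => renewalPlus_subset_renewal _ _ _
  -- Exchanging the constants lowers the growth rate and raises the crossing bound, so both
  -- conditions are relaxed.
  have hsub2 : ∀ ω, renewalPlus (config v ω) c₁ c₂ ⊆ renewal (config v ω) c₂ c₁ :=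
    fun ω => (hsub1 ω).trans (renewal_anti_mono _ hc hc)
  have hmeas : ∀ a b x, MeasurableSet {ω | x ∈ renewal (config v ω) a b} :=
    fun a b x => hv.measurableSet_config (measurableSet_renewal a b x)
  refine ⟨hA.ae_biInfinite.mono fun ω hω => ⟨hω, hω.superset (hsub1 ω), hω.superset (hsub2 ω)⟩, ?_⟩
  obtain ⟨C, hC, hint⟩ := hA.exists_lintegral_exp_point1
  exact ⟨C, hC, hA.expMoments hA.measurableSet (fun _ => le_rfl) hC hint,
    hA.expMoments (hmeas _ _) hsub1 hC hint, hA.expMoments (hmeas _ _) hsub2 hC hint⟩
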